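/- Let $G$ be a locally compact (Hausdorff) group and $H<G$ a closed subgroup; all Banach spaces are over $\mathbf R$. Conventions. A *convex compact $G$-space* is a convex compact subset $K$ of a Hausdorff locally convex topological vector space endowed with an affine representation of $G$ that preserves $K$ and whose action on $K$ is continuous. $L^1(G)$ is taken with respect to a left Haar measure and is a Banach algebra under convolution; $L^1_0(G)\subseteq L^1(G)$ is the set of functions of integral zero. Choose left Haar measures on $G$ and $H$ and endow $G/H$ with the resulting $G$-quasi-invariant measure (class); $J^1(G,H)$ is the kernel of the map $T\colon L^1(G)\to L^1(G/H)$ given by integration over the cosets of $H$, i.e. the set of $\varphi\in L^1(G)$ with $\int_H \varphi(xh)\,\Delta_G(h)\,\Delta_H(h)^{-1}\,dh=0$ for (locally) almost every $x$, where $\Delta_G,\Delta_H$ are the modular functions, normalised by $\mu_G(Ag)=\Delta_G(g)\mu_G(A)$ and likewise for $H$; it does not depend on the choices. For $M,B\subseteq L^1(G)$, a *bounded right approximate identity for $M$ in $B$* is a net $(u_i)_i$ in $B$, bounded in norm, such that $\|\varphi * u_i-\varphi\|_1\to 0$ for every $\varphi\in M$. $\mathrm C_{\mathrm b}^{\mathrm{ru}}(G)$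 is the space of bounded continuous functions $f$ on $G$ for which $g\mapsto f(g^{-1}\,\cdot\,)$ is continuous from $G$ to $\mathrm C_{\mathrm b}(G)$ with the sup-norm; a *mean* on it is a positive linear functional taking the value $1$ at $\mathbf 1_G$. $L^\infty(G)$ and $L^\infty(G/H)$ are the spaces of bounded measurable functions modulo locally null functions, with the essential sup-norm; $G$ acts on them by left translation and $L^1(G)$ by left convolution, $(\varphi * f)(x)=\int_G\varphi(y)f(y^{-1}x)\,dy$. **Theorem (Relative amenability).** The following are equivalent: 1. (i) $H$ is relatively amenable in $G$: every non-empty convex compact $G$-space contains an $H$-fixed point. 2. (ii) $J^1(G,H)$ has a bounded right approximate identity in $L^1_0(G)$. 3. (iii) There is a left $H$-invariant mean on $\mathrm C_{\mathrm b}^{\mathrm{ru}}(G)$. 4. (iv) There is a $G$-equivariant continuous linear map $\alpha\colon L^\infty(G)\to L^\infty(G/H)$ with $\alpha(\mathbf 1_G)=\mathbf 1_{G/H}$. 5. (v) There is a map as in (iv) which is moreover positive and of norm one. Moreover, $G$-equivariance can be replaced by $L^1(G)$-equivariance in (iv) and in (v): the two resulting conditions are also equivalent to (i)–(v). -/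

import Mathlib

open MeasureTheory Filter Topology
open scoped ENNReal NNReal BoundedContinuousFunction

universe u v w

namespace RelAmen

noncomputable section

/-! ### Convex compact `G`-spaces and relative amenability -/

/-- `K` is a non-empty convex compact `G`-space for the affine representation `ρ` of `G` on `E`:
`ρ` preserves the non-empty convex compact set `K` and the action map `G × K → K` is
continuous. -/
structure IsConvexCompactGSpace {G : Type u} [Group G] [TopologicalSpace G]
    {E : Type v} [AddCommGroup E] [Module ℝ E] [TopologicalSpace E]
    (ρ : G →* (E ≃ᵃ[ℝ] E)) (K : Set E) : Prop where
  nonempty : K.Nonempty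
  convex : Convex ℝ K
  isCompact : IsCompact K
  mapsTo : ∀ g : G, Set.MapsTo (ρ g) K K
  continuousOn : ContinuousOn (fun p : G × E => ρ p.1 p.2) (Set.univ ×ˢ K)

/-- `H` fixes a point in every non-empty convex compact `G`-space, the latter being a subset of a
Hausdorff locally convex topological vector space. -/
def RelativelyAmenable (G : Type u) [Group G] [TopologicalSpace G] (H : Subgroup G) : Prop :=
  ∀ (E : Type (max u v)) [AddCommGroup E] [Module ℝ E] [TopologicalSpace E]
    [IsTopologicalAddGroup E] [ContinuousSMul ℝ E] [LocallyConvexSpace ℝ E] [T2Space E]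
    (ρ : G →* (E ≃ᵃ[ℝ] E)) (K : Set E),
    IsConvexCompactGSpace ρ K → ∃ x ∈ K, ∀ h ∈ H, ρ h x = x

/-! ### Right uniformly continuous bounded functions and means -/

section Cbru

variable {G : Type u} [Group G] [TopologicalSpace G] [IsTopologicalGroup G]

/-- Left translation `(g f)(x) = f (g⁻¹ x)` on bounded continuous functions. -/
def translateCb (g : G) (f : G →ᵇ ℝ) : G →ᵇ ℝ :=
  f.compContinuous ⟨fun x => g⁻¹ * x, by fun_prop⟩

variable (G) in
/-- The space of bounded right uniformly continuous functions: the continuous vectors of the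
left translation representation on bounded continuous functions with the sup-norm. -/
def Cbru : Submodule ℝ (G →ᵇ ℝ) where
  carrier := {f | Continuous fun g : G => translateCb g f}
  add_mem' {a _} ha hb := Continuous.add (f := fun g => translateCb g a) ha hb
  zero_mem' := continuous_const (y := (0 : G →ᵇ ℝ))
  smul_mem' c f hf := Continuous.const_smul (g := fun g => translateCb g f) hf c

theorem translateCb_mem (g : G) {f : G →ᵇ ℝ} (hf : f ∈ Cbru G) : translateCb g f ∈ Cbru G := by
  have h : Continuous fun k : G => translateCb (k * g) f :=
    Continuous.comp (g := fun k => translateCb k f) hf (continuous_mul_const g)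
  refine h.congr fun k => ?_
  ext x
  simp [translateCb, mul_assoc]

/-- The left translation action of `g : G` on `Cbru G`. -/
def translateCbru (g : G) (f : Cbru G) : Cbru G := ⟨translateCb g f, translateCb_mem g f.2⟩

variable (G) in
/-- The constant function `1`. -/
def oneCbru : Cbru G :=
  ⟨BoundedContinuousFunction.const G 1, continuous_const (y := BoundedContinuousFunction.const G 1)⟩

/-- A mean on `Cbru G`: a positive linear functional that takes the value `1` at `1`. -/
structure IsMean (m : Cbru G →ₗ[ℝ] ℝ) : Prop where
  nonneg : ∀ f : Cbru G, (∀ x, 0 ≤ (f : G →ᵇ ℝ) x) → 0 ≤ m f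
  map_one : m (oneCbru G) = 1

/-- The mean `m` is left `H`-invariant. -/
def IsLeftInvariant (H : Subgroup G) (m : Cbru G →ₗ[ℝ] ℝ) : Prop :=
  ∀ h ∈ H, ∀ f : Cbru G, m (translateCbru h f) = m f

end Cbru

variable {G : Type u} [Group G] [TopologicalSpace G] [IsTopologicalGroup G]
  [MeasurableSpace G] [BorelSpace G]

/-- `S` is locally null: it meets every compact set in a null set. -/
def LocallyNull (μ : Measure G) (S : Set G) : Prop := ∀ K, IsCompact K → μ (S ∩ K) = 0

/-- The Banach space `L¹(G)`. -/
abbrev LOne (μ : Measure G) : Type u := Lp ℝ 1 μ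

section Inversion

variable (μ : Measure G) [LocallyCompactSpace G] [T2Space G] [μ.IsHaarMeasure] [μ.Regular]

theorem measure_inv_eq_zero_of_isCompact {K : Set G} (hK : IsCompact K) (h0 : μ K = 0) :
    μ K⁻¹ = 0 := by
  obtain ⟨g, g_comp, g_nonneg, g_pos⟩ :
    ∃ g : C(G, ℝ), HasCompactSupport g ∧ 0 ≤ g ∧ g 1 ≠ 0 := exists_continuous_nonneg_pos 1
  set D : G → ℝ := fun x => ∫ y, g (y⁻¹ * x) ∂μ.inv with hD
  have D_cont : Continuous D := continuous_integral_apply_inv_mul g.continuous g_comp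
  have D_nonneg : ∀ x, 0 ≤ D x := fun x => integral_nonneg fun y => g_nonneg _
  have D_pos : ∀ x, 0 < D x := by
    intro x
    have C : Continuous (fun y ↦ g (y⁻¹ * x)) := by fun_prop
    apply (integral_pos_iff_support_of_nonneg _ _).2
    · apply C.isOpen_support.measure_pos μ.inv
      exact ⟨x, by simpa using g_pos⟩
    · exact fun y ↦ g_nonneg (y⁻¹ * x)
    · apply C.integrable_of_hasCompactSupport
      exact g_comp.comp_homeomorph ((Homeomorph.inv G).trans (Homeomorph.mulRight x))
  have hg : 0 < ∫ x, g x ∂μ :=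
    g.continuous.integral_pos_of_hasCompactSupport_nonneg_nonzero g_comp g_nonneg g_pos
  obtain ⟨V, hV, hKV⟩ := exists_compact_superset hK
  obtain ⟨M, hM⟩ := (hV.image D_cont).bddAbove
  have hM' : ∀ x ∈ V, D x ≤ M := fun x hx => hM ⟨x, hx, rfl⟩
  rcases K.eq_empty_or_nonempty with rfl | ⟨k, hk⟩
  · simp
  have M_pos : 0 < M := (D_pos k).trans_le (hM' k (interior_subset (hKV hk)))
  have key : ∀ ε : ℝ, 0 < ε → μ.inv.real K ≤ ε * (M / ∫ x, g x ∂μ) := by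
    intro ε hε
    obtain ⟨U, hKU, hU, hUε⟩ := K.exists_isOpen_lt_of_lt (μ := μ) (ENNReal.ofReal ε)
      (by rw [h0]; simpa using hε)
    obtain ⟨f, f1, f0, f_comp, f01⟩ := exists_continuous_one_zero_of_isCompact hK
      (hU.inter isOpen_interior).isClosed_compl
      (Set.disjoint_compl_right_iff_subset.2 (Set.subset_inter hKU hKV))
    have hfU : ∀ x, x ∉ U → f x = 0 := fun x hx => f0 fun h => hx h.1
    have hfV : ∀ x, x ∉ V → f x = 0 := fun x hx => f0 fun h => hx (interior_subset h.2)
    have combo := Measure.integral_isMulLeftInvariant_isMulRightInvariant_combo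
      (μ := μ) (ν := μ.inv) f.continuous f_comp g.continuous g_comp g_nonneg g_pos
    have e1 : ∫ x, f x ∂μ ≤ ε := by
      calc ∫ x, f x ∂μ ≤ ∫ x, U.indicator (fun _ => (1 : ℝ)) x ∂μ := by
            refine integral_mono (f.continuous.integrable_of_hasCompactSupport f_comp) ?_ ?_
            · exact (integrable_indicator_iff hU.measurableSet).2
                (integrableOn_const (hUε.trans ENNReal.ofReal_lt_top).ne)
            · intro x
              by_cases hx : x ∈ U
              · simpa [hx] using (f01 x).2
              · simp [hx, hfU x hx]
        _ = μ.real U := by simp [integral_indicator hU.measurableSet]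
        _ ≤ ε := ENNReal.toReal_le_of_le_ofReal hε.le hUε.le
    have e2 : M⁻¹ * μ.inv.real K ≤ ∫ y, f y * (D y)⁻¹ ∂μ.inv := by
      calc M⁻¹ * μ.inv.real K = ∫ x, K.indicator (fun _ => M⁻¹) x ∂μ.inv := by
            simp [integral_indicator hK.measurableSet, mul_comm]
        _ ≤ _ := by
            refine integral_mono ?_ ?_ ?_
            · exact (integrable_indicator_iff hK.measurableSet).2
                (integrableOn_const hK.measure_lt_top.ne)
            · refine Continuous.integrable_of_hasCompactSupport
                (f.continuous.mul (D_cont.inv₀ fun x => (D_pos x).ne')) f_comp.mul_right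
            · intro x
              by_cases hx : x ∈ K
              · have : f x = 1 := f1 hx
                simpa [hx, this] using
                  inv_anti₀ (D_pos x) (hM' x (interior_subset (hKV hx)))
              · simpa [hx] using mul_nonneg (f01 x).1 (inv_nonneg.2 (D_nonneg x))
    have e3 : M⁻¹ * μ.inv.real K * ∫ x, g x ∂μ ≤ ε :=
      (mul_le_mul_of_nonneg_right e2 hg.le).trans (combo.symm.le.trans e1)
    rw [← mul_div_assoc, le_div_iff₀ hg]
    calc μ.inv.real K * ∫ x, g x ∂μ = M * (M⁻¹ * μ.inv.real K * ∫ x, g x ∂μ) := by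
          field_simp
      _ ≤ M * ε := by gcongr
      _ = ε * M := mul_comm _ _
  have hz : μ.inv.real K = 0 := by
    refine le_antisymm (le_of_forall_pos_le_add fun δ hδ => ?_) measureReal_nonneg
    have hq : 0 < M / ∫ x, g x ∂μ := div_pos M_pos hg
    have := key (δ / (M / ∫ x, g x ∂μ)) (div_pos hδ hq)
    rw [div_mul_cancel₀ _ hq.ne'] at this
    simpa using this
  rw [← Measure.inv_apply]
  exact (measureReal_eq_zero_iff hK.measure_lt_top.ne).1 hz

variable {μ}

theorem LocallyNull.measure_inter {S T : Set G} (hS : LocallyNull μ S) (hSm : MeasurableSet S)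
    (hT : MeasurableSet T) (hfin : μ T ≠ ∞) : μ (S ∩ T) = 0 := by
  rw [(hSm.inter hT).measure_eq_iSup_isCompact_of_ne_top (measure_inter_ne_top_of_right_ne_top hfin)]
  simp only [ENNReal.iSup_eq_zero]
  intro K hK hKc
  exact measure_mono_null (fun x (hx : x ∈ K) => (⟨(hK hx).1, hx⟩ : x ∈ S ∩ K)) (hS K hKc)

theorem LocallyNull.inv {S : Set G} (hS : LocallyNull μ S) (hSm : MeasurableSet S) :
    LocallyNull μ S⁻¹ := by
  intro K hK
  rw [(hSm.inv.inter hK.measurableSet).measure_eq_iSup_isCompact_of_ne_top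
    (measure_inter_ne_top_of_right_ne_top hK.measure_lt_top.ne)]
  simp only [ENNReal.iSup_eq_zero]
  intro C hC hCc
  have h : μ C⁻¹ = 0 := measure_mono_null
    (fun x (hx : x ∈ C⁻¹) => show x ∈ S ∩ C⁻¹ from ⟨by simpa using (hC (Set.mem_inv.1 hx)).1, hx⟩) (hS C⁻¹ hCc.inv)
  simpa using measure_inv_eq_zero_of_isCompact μ hCc.inv h

theorem LocallyNull.preimage_mul_left {S : Set G} (hS : LocallyNull μ S) (g : G) :
    LocallyNull μ ((fun y => g * y) ⁻¹' S) := by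
  intro K hK
  rw [← measure_preimage_mul μ g⁻¹]
  refine measure_mono_null ?_ (hS ((fun y => g⁻¹ * y) ⁻¹' K)
    ((Homeomorph.mulLeft g⁻¹).isCompact_preimage.2 hK))
  rintro y ⟨hy, hyK⟩
  exact ⟨by simpa using hy, hyK⟩

theorem LocallyNull.ae_eq_zero {S : Set G} (hS : LocallyNull μ S) (hSm : MeasurableSet S)
    (φ : LOne μ) : ∀ᵐ y ∂μ, y ∈ S → φ y = 0 := by
  have hφ : StronglyMeasurable φ := Lp.stronglyMeasurable φ
  have hint : Integrable φ μ := L1.integrable_coeFn φ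
  have h : ∀ n : ℕ, μ (S ∩ {y | (n + 1 : ℝ)⁻¹ ≤ ‖φ y‖}) = 0 := fun n =>
    hS.measure_inter hSm (measurableSet_le measurable_const hφ.norm.measurable)
      (hint.measure_norm_ge_lt_top (by positivity)).ne
  refine measure_mono_null ?_ (measure_iUnion_null h)
  intro y hy
  obtain ⟨hyS, hy0⟩ : y ∈ S ∧ φ y ≠ 0 := by simpa using hy
  obtain ⟨n, hn⟩ := exists_nat_one_div_lt (norm_pos_iff.2 hy0)
  exact Set.mem_iUnion.2 ⟨n, hyS, by simpa using hn.le⟩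

end Inversion

/-! ### The convolution algebra `L¹(G)` and the ideal `J¹(G, H)` -/

section LOne

variable (μ : Measure G)

/-- Left translation `(g f)(x) = f (g⁻¹ x)` on `L¹(G)`. -/
def translateLOne [μ.IsMulLeftInvariant] (g : G) (f : LOne μ) : LOne μ :=
  DomMulAct.mk g⁻¹ • f

/-- Convolution on `L¹(G)`, `(φ * ψ)(x) = ∫ φ(y) ψ(y⁻¹ x) dy`, written as the `L¹(G)`-valued
integral of the left translates of `ψ` against `φ`. -/
def conv [μ.IsMulLeftInvariant] (φ ψ : LOne μ) : LOne μ :=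
  ∫ y, φ y • translateLOne μ y ψ ∂μ

/-- `L¹₀(G)`, the functions in `L¹(G)` of integral zero. -/
def LOneZero : Set (LOne μ) := {φ | ∫ x, φ x ∂μ = 0}

variable {H : Subgroup G} (ν : Measure H)

/-- Integration over the fibre `xH`: `∫_H φ(xh) Δ_G(h) / Δ_H(h) dh` with the classical modular
functions `Δ` (for which `μ(Ag) = Δ_G(g) μ(A)`); these are the inverses of Mathlib's modular
characters. If `ρ : G → (0, ∞)` is continuous with `ρ(xh) = ρ(x) Δ_H(h) / Δ_G(h)`, it determines a
`G`-quasi-invariant measure on `G ⧸ H`, and `T : L¹(G) → L¹(G ⧸ H)` is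
`Tφ(xH) = ∫_H φ(xh) / ρ(xh) dh = ρ(x)⁻¹ * fibreIntegral φ x`. -/
def fibreIntegral [LocallyCompactSpace G] (hH : IsClosed (H : Set G)) (φ : LOne μ) (x : G) : ℝ :=
  haveI : LocallyCompactSpace H := hH.isClosedEmbedding_subtypeVal.locallyCompactSpace
  ∫ h : H, φ (x * h) *
    ((Measure.modularCharacter h : ℝ≥0) / (Measure.modularCharacter (h : G) : ℝ≥0) : ℝ) ∂ν

/-- `J¹(G, H)`, the kernel of `T : L¹(G) → L¹(G ⧸ H)`. A subset of `G ⧸ H` is locally null for the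
`G`-quasi-invariant measure if and only if its preimage in `G` is locally null, so `Tφ = 0` in
`L¹(G ⧸ H)` means that the integrals of `φ` over the fibres vanish outside a locally null set. -/
def JOne [LocallyCompactSpace G] (hH : IsClosed (H : Set G)) : Set (LOne μ) :=
  {φ | LocallyNull μ {x | fibreIntegral μ ν hH φ x ≠ 0}}

/-- The right `L¹(G)`-module structure on `M ⊆ L¹(G)` being convolution, `M` has a bounded right
approximate identity in `B ⊆ L¹(G)`: a bounded net `u` in `B` such that `φ * u i` converges to `φ`
in norm for all `φ` in `M`. -/
def HasBoundedRightApproxIdentity [μ.IsMulLeftInvariant] (M B : Set (LOne μ)) : Prop :=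
  ∃ (I : Type u) (_ : Preorder I) (_ : IsDirectedOrder I) (_ : Nonempty I) (u : I → LOne μ),
    (∀ i, u i ∈ B) ∧ (∃ C : ℝ, ∀ i, ‖u i‖ ≤ C) ∧
      ∀ φ ∈ M, Tendsto (fun i => conv μ φ (u i)) atTop (𝓝 φ)

end LOne

/-! ### The spaces `L^∞(G)` and `L^∞(G ⧸ H)`

Both are instances of one construction for a `G`-space `X` with base point `x₀` (`X = G` with
`x₀ = 1`, respectively `X = G ⧸ H` with `x₀ = H`): bounded functions on `X`, measurable after
pull-back along `g ↦ g x₀`, modulo those which vanish outside a set whose preimage in `G` is locally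
null. For `X = G` these are the bounded Borel functions modulo locally null functions, so that
`L^∞(G)` is the dual of `L¹(G)` also if `G` is not `σ`-compact. For `X = G ⧸ H` the sets with
locally null preimage in `G` are the locally null sets of the `G`-quasi-invariant measures. -/

section LInfty

variable {X : Type w} [MulAction G X] (x₀ : X)

/-- Bounded measurable functions on `X`, with the sup-norm. -/
def BoundedMeasurable : Submodule ℝ (lp (fun _ : X => ℝ) ∞) where
  carrier := {f | Measurable fun g : G => f (g • x₀)}
  add_mem' ha hb := Measurable.add ha hb
  zero_mem' := by simp
  smul_mem' c f hf := by simpa using Measurable.const_mul hf c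

variable (μ : Measure G)

/-- The locally null functions. -/
def LocallyNullFun : Submodule ℝ (BoundedMeasurable (G := G) x₀) where
  carrier := {f | LocallyNull μ {g | f.1 (g • x₀) ≠ 0}}
  add_mem' {a b} ha hb K hK := by
    refine measure_mono_null ?_ (measure_union_null (ha K hK) (hb K hK))
    rintro g ⟨hg, hgK⟩
    by_contra h
    simp_all
  zero_mem' K _ := by simp
  smul_mem' c f hf K hK := by
    refine measure_mono_null ?_ (hf K hK)
    rintro g ⟨hg, hgK⟩
    simp_all

/-- The space of bounded measurable function classes on `X`, with the essential sup-norm (as a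
quotient norm). -/
abbrev LInfty : Type w := BoundedMeasurable (G := G) x₀ ⧸ LocallyNullFun x₀ μ

/-- Bounded measurable functions from explicit data. -/
def BoundedMeasurable.of (f : X → ℝ) (C : ℝ) (hC : ∀ x, |f x| ≤ C)
    (hf : Measurable fun g : G => f (g • x₀)) : BoundedMeasurable (G := G) x₀ :=
  ⟨⟨f, memℓp_infty ⟨C, by rintro _ ⟨x, rfl⟩; exact hC x⟩⟩, hf⟩

/-- The class of the constant function `1`. -/
def LInfty.one : LInfty x₀ μ :=
  Submodule.Quotient.mk (BoundedMeasurable.of x₀ (fun _ => 1) 1 (by simp) measurable_const)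

/-- The order on `L^∞`: a class is non-negative if it has a non-negative representative. -/
def LInfty.IsNonneg (F : LInfty x₀ μ) : Prop :=
  ∃ f : BoundedMeasurable (G := G) x₀, Submodule.Quotient.mk f = F ∧ ∀ x, 0 ≤ f.1 x

theorem BoundedMeasurable.abs_le {x₀ : X} (f : BoundedMeasurable (G := G) x₀) (x : X) :
    |f.1 x| ≤ ‖f‖ := lp.norm_apply_le_norm (by simp) f.1 x

/-- Left translation `(g f)(x) = f (g⁻¹ x)` on bounded measurable functions. -/
def BoundedMeasurable.translate (g : G) :
    BoundedMeasurable (G := G) x₀ →ₗ[ℝ] BoundedMeasurable (G := G) x₀ where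
  toFun f := BoundedMeasurable.of x₀ (fun x => f.1 (g⁻¹ • x)) ‖f‖ (fun _ => BoundedMeasurable.abs_le f _) (by
    simpa [mul_smul, Function.comp_def] using
      Measurable.comp (g := fun g : G => f.1 (g • x₀)) f.2 (measurable_const_mul g⁻¹))
  map_add' a b := rfl
  map_smul' c a := rfl

theorem LocallyNullFun.translate [μ.IsMulLeftInvariant] (g : G)
    (f : BoundedMeasurable (G := G) x₀) (hf : f ∈ LocallyNullFun x₀ μ) :
    BoundedMeasurable.translate x₀ g f ∈ LocallyNullFun x₀ μ := by
  intro K hK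
  have h := hf ((fun y => g * y) ⁻¹' K) ((Homeomorph.mulLeft g).isCompact_preimage.2 hK)
  rw [← measure_preimage_mul μ g⁻¹] at h
  refine measure_mono_null ?_ h
  rintro k ⟨hk, hkK⟩
  refine ⟨?_, by simpa using hkK⟩
  have hk' : f.1 (g⁻¹ • k • x₀) ≠ 0 := hk
  simpa [mul_smul] using hk'

/-- The `G`-action on `L^∞` by left translation, `(g f)(x) = f (g⁻¹ x)`. -/
def LInfty.translate [μ.IsMulLeftInvariant] (g : G) : LInfty x₀ μ →ₗ[ℝ] LInfty x₀ μ :=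
  (LocallyNullFun x₀ μ).mapQ (LocallyNullFun x₀ μ) (BoundedMeasurable.translate x₀ g)
    (LocallyNullFun.translate x₀ μ g)

end LInfty

section Convolution

variable [LocallyCompactSpace G] [T2Space G] {μ : Measure G} [μ.IsHaarMeasure] [μ.Regular]
  {X : Type w} [MulAction G X] {x₀ : X}

theorem BoundedMeasurable.measurable_inv_smul (f : BoundedMeasurable (G := G) x₀) (g : G) :
    Measurable fun y : G => f.1 (y⁻¹ • g • x₀) := by
  simpa [mul_smul, Function.comp_def] using
    Measurable.comp (g := fun g : G => f.1 (g • x₀)) f.2 (measurable_inv.mul_const g)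

theorem BoundedMeasurable.integrable_conv (φ : LOne μ) (f : BoundedMeasurable (G := G) x₀)
    (g : G) : Integrable (fun y => φ y * f.1 (y⁻¹ • g • x₀)) μ :=
  (L1.integrable_coeFn φ).mul_bdd (c := ‖f‖) (BoundedMeasurable.measurable_inv_smul f g).aestronglyMeasurable
    (ae_of_all _ fun _ => BoundedMeasurable.abs_le f _)

theorem BoundedMeasurable.abs_integral_le (φ : LOne μ) (f : BoundedMeasurable (G := G) x₀)
    (x : X) : |∫ y, φ y * f.1 (y⁻¹ • x) ∂μ| ≤ ‖φ‖ * ‖f‖ := by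
  rw [L1.norm_eq_integral_norm, ← integral_mul_const, ← Real.norm_eq_abs]
  refine norm_integral_le_of_norm_le ((L1.integrable_coeFn φ).norm.mul_const _)
    (ae_of_all _ fun y => ?_)
  rw [norm_mul]
  exact mul_le_mul_of_nonneg_left (BoundedMeasurable.abs_le f _) (norm_nonneg _)

theorem BoundedMeasurable.continuous_conv (φ : LOne μ) (f : BoundedMeasurable (G := G) x₀) :
    Continuous fun g : G => ∫ y, φ y * f.1 (y⁻¹ • g • x₀) ∂μ := by
  have hint : ∀ ψ : LOne μ, Integrable (fun y => ψ y * f.1 (y⁻¹ • x₀)) μ := fun ψ => by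
    simpa using BoundedMeasurable.integrable_conv ψ f 1
  let L : LOne μ →ₗ[ℝ] ℝ :=
    { toFun := fun ψ => ∫ y, ψ y * f.1 (y⁻¹ • x₀) ∂μ
      map_add' := fun a b => by
        rw [← integral_add (hint a) (hint b)]
        refine integral_congr_ae ?_
        filter_upwards [Lp.coeFn_add a b] with y hy
        rw [hy, Pi.add_apply, add_mul]
      map_smul' := fun c a => by
        rw [RingHom.id_apply, smul_eq_mul, ← integral_const_mul]
        refine integral_congr_ae ?_
        filter_upwards [Lp.coeFn_smul c a] with y hy
        rw [hy, Pi.smul_apply, smul_eq_mul, mul_assoc] }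
  have hL : Continuous L := AddMonoidHomClass.continuous_of_bound L ‖f‖ fun ψ => by
    rw [mul_comm]; exact BoundedMeasurable.abs_integral_le ψ f x₀
  have : Fact ((1 : ℝ≥0∞) ≠ ∞) := ⟨ENNReal.one_ne_top⟩
  have h : Continuous fun g : G => L (DomMulAct.mk g • φ) :=
    hL.comp (DomMulAct.continuous_mk.smul continuous_const)
  refine h.congr fun g => ?_
  change ∫ y, (DomMulAct.mk g • φ : LOne μ) y * f.1 (y⁻¹ • x₀) ∂μ = _
  rw [← integral_mul_left_eq_self (fun y => φ y * f.1 (y⁻¹ • g • x₀)) g]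
  refine integral_congr_ae ?_
  filter_upwards [DomMulAct.smul_Lp_ae_eq (DomMulAct.mk g) φ] with y hy
  rw [hy]
  simp [mul_smul]

variable [MulAction.IsPretransitive G X]

/-- Left convolution `(φ * f)(x) = ∫ φ(y) f(y⁻¹ x) dy` of a bounded measurable function `f` by
`φ ∈ L¹(G)`. -/
def BoundedMeasurable.conv (φ : LOne μ) :
    BoundedMeasurable (G := G) x₀ →ₗ[ℝ] BoundedMeasurable (G := G) x₀ where
  toFun f := BoundedMeasurable.of x₀ (fun x => ∫ y, φ y * f.1 (y⁻¹ • x) ∂μ) (‖φ‖ * ‖f‖)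
    (BoundedMeasurable.abs_integral_le φ f)
    (BoundedMeasurable.continuous_conv φ f).measurable
  map_add' a b := by
    ext x
    obtain ⟨g, rfl⟩ := MulAction.exists_smul_eq G x₀ x
    change ∫ y, φ y * (a.1 (y⁻¹ • g • x₀) + b.1 (y⁻¹ • g • x₀)) ∂μ =
      ∫ y, φ y * a.1 (y⁻¹ • g • x₀) ∂μ + ∫ y, φ y * b.1 (y⁻¹ • g • x₀) ∂μ
    rw [← integral_add (BoundedMeasurable.integrable_conv φ a g)
      (BoundedMeasurable.integrable_conv φ b g)]
    simp only [mul_add]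
  map_smul' c a := by
    ext x
    change ∫ y, φ y * (c * a.1 (y⁻¹ • x)) ∂μ = c * ∫ y, φ y * a.1 (y⁻¹ • x) ∂μ
    rw [← integral_const_mul]
    simp only [mul_left_comm]

theorem LocallyNullFun.conv (φ : LOne μ) (f : BoundedMeasurable (G := G) x₀)
    (hf : f ∈ LocallyNullFun x₀ μ) : BoundedMeasurable.conv φ f ∈ LocallyNullFun x₀ μ := by
  have hfn : LocallyNull μ {g | f.1 (g • x₀) ≠ 0} := hf
  have hm : MeasurableSet {g : G | f.1 (g • x₀) ≠ 0} :=
    (show Measurable fun g : G => f.1 (g • x₀) from f.2) (measurableSet_singleton 0).compl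
  have hzero : ∀ g : G, ∫ y, φ y * f.1 (y⁻¹ • g • x₀) ∂μ = 0 := by
    intro g
    refine integral_eq_zero_of_ae ?_
    filter_upwards [((hfn.inv hm).preimage_mul_left g⁻¹).ae_eq_zero
      (measurable_const_mul g⁻¹ hm.inv) φ] with y hy
    by_cases h : f.1 (y⁻¹ • g • x₀) = 0
    · simp [h]
    · simp [hy (by simpa [mul_smul] using h)]
  intro K _
  refine measure_mono_null ?_ measure_empty
  rintro g ⟨hg, -⟩
  exact hg (hzero g)

/-- The `L¹(G)`-action on `L^∞` by left convolution. -/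
def LInfty.conv (φ : LOne μ) : LInfty x₀ μ →ₗ[ℝ] LInfty x₀ μ :=
  (LocallyNullFun x₀ μ).mapQ (LocallyNullFun x₀ μ) (BoundedMeasurable.conv φ)
    (LocallyNullFun.conv φ)

end Convolution

/-! ### Maps from `L^∞(G)` to `L^∞(G ⧸ H)` -/

section Maps

variable (μ : Measure G) (H : Subgroup G)

/-- `L^∞(G)`. -/
abbrev LInftyGroup : Type u := LInfty (1 : G) μ

/-- `L^∞(G ⧸ H)`. -/
abbrev LInftyQuotient : Type u := LInfty ((1 : G) : G ⧸ H) μ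

variable {μ H} (α : LInftyGroup μ →L[ℝ] LInftyQuotient μ H)

/-- `α` sends `1` to `1`. -/
def IsUnital : Prop := α (LInfty.one _ μ) = LInfty.one _ μ

/-- `α` is positive. -/
def IsPositiveMap : Prop := ∀ F, LInfty.IsNonneg _ μ F → LInfty.IsNonneg _ μ (α F)

/-- `α` is `G`-equivariant for left translations. -/
def IsEquivariant [μ.IsMulLeftInvariant] : Prop :=
  ∀ (g : G) (F : LInftyGroup μ), α (LInfty.translate _ μ g F) = LInfty.translate _ μ g (α F)

/-- `α` is `L¹(G)`-equivariant for left convolution. -/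
def IsLOneEquivariant [LocallyCompactSpace G] [T2Space G] [μ.IsHaarMeasure] [μ.Regular] : Prop :=
  ∀ (φ : LOne μ) (F : LInftyGroup μ), α (LInfty.conv φ F) = LInfty.conv φ (α F)

end Maps

end

end RelAmen

/-!
All conditions are compared with the existence of an `H`-invariant mean on `Cbru G`.

*Fixed points.* The means on `Cbru G` form a convex compact `G`-space, so relative amenability gives
an invariant one (`exists_mean_of_relativelyAmenable`). Conversely, the orbit map of a point of a
convex compact `G`-space `K` pulls functions on `K` back to `Cbru G`, and the barycenter of an
invariant mean is a fixed point (`IsConvexCompactGSpace.exists_barycenter`,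
`relativelyAmenable_of_exists_mean`).

*Equivariant maps.* The space `L^∞(G ⧸ H)` embeds in the dual of `L¹(G)` as left `H`-invariant
functionals. An equivariant unital map `α` composed with an approximate evaluation at the base point
is a bounded invariant functional on `Cbru G`, and the normalized positive part of such a functional
is an invariant mean (`exists_mean_of_functional`, `exists_mean_of_equivariant`). Conversely, an
invariant mean `m` gives for `F` in `L^∞(G)` the left `H`-invariant functional `φ ↦ m (φ * F)` on
`L¹(G)`. The point is to represent it by a function on `G ⧸ H`
(`exists_invariant_representative`): it is a weak limit of continuous left `H`-invariant functions,
on `σ`-finite pieces convex combinations of these converge almost everywhere, and the upper limit of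
such a sequence is invariant everywhere. No measure on `G ⧸ H` and no lifting is needed. The
resulting map is `L¹(G)`-equivariant, and this implies `G`-equivariance by means of an approximate
identity.

*The ideal `J¹(G, H)`.* Two facts link it to `H`-invariance, both deduced from the adjunction
`∫ χ · T f = ∫ f · S χ` between the weighted and the plain integration over fibres
(`integral_mul_fibreWeightedSum`): the differences `ρ h q - q` of right translates of compactly
supported continuous functions lie in `J¹(G, H)` (`rightTranslate_sub_mem_JOne`), and bounded
continuous right `H`-invariant functions annihilate it (`integral_mul_eq_zero_of_mem_JOne`). If `u` is
an approximate identity for `J¹(G, H)` consisting of functions of integral zero, the first fact shows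
that limits of the functionals `f ↦ f(1) - ∫ u f` are invariant (`exists_mean_of_approxIdentity`). For
the converse, the second fact shows that an invariant mean vanishes at `x ↦ L (ρ x φ)` for `φ` in
`J¹(G, H)` and every functional `L` on `L¹(G)`; approximate units `v - w`, with probability densities
`v` and `w`, then exist by the Hahn-Banach theorem (`exists_conv_sub_lt_of_mean`).
-/

set_option linter.unusedSectionVars false

open scoped CompactlySupported

namespace RelAmen

noncomputable section

/-! ### The modular character and change of variables -/

section Modular

variable {G : Type u} [Group G] [TopologicalSpace G] [IsTopologicalGroup G]
  [LocallyCompactSpace G] [T2Space G]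

/-- Mathlib's modular character as a real number: `modChar g = Δ(g)⁻¹` for the classical modular
function `Δ` with `μ (A g) = Δ(g) μ A`. -/
def modChar (g : G) : ℝ := (Measure.modularCharacter g : ℝ≥0)

theorem modChar_pos (g : G) : 0 < modChar g :=
  NNReal.coe_pos.2 (Measure.modularCharacterFun_pos g)

theorem modChar_mul (g h : G) : modChar (g * h) = modChar g * modChar h := by
  simp [modChar]

theorem modChar_one : modChar (1 : G) = 1 := by simp [modChar]

variable [MeasurableSpace G] [BorelSpace G]

theorem map_mul_right_eq_smul (μ : Measure G) [μ.IsHaarMeasure] [μ.Regular] (g : G) :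
    Measure.map (· * g) μ = (Measure.modularCharacter g : ℝ≥0) • μ := by
  have : (Measure.map (· * g) μ).Regular :=
    Measure.Regular.map (Homeomorph.mulRight g)
  change _ = Measure.modularCharacterFun g • μ
  rw [Measure.modularCharacterFun_eq_haarScalarFactor μ]
  exact Measure.isMulLeftInvariant_eq_smul_of_regular _ μ

theorem integral_mul_right {E : Type*} [NormedAddCommGroup E] [NormedSpace ℝ E]
    (μ : Measure G) [μ.IsHaarMeasure] [μ.Regular] (f : G → E) (g : G) :
    ∫ x, f (x * g) ∂μ = modChar g • ∫ x, f x ∂μ := by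
  have h := integral_map_equiv (μ := μ) (Homeomorph.mulRight g).toMeasurableEquiv f
  change ∫ x, f x ∂(Measure.map (· * g) μ) = ∫ x, f (x * g) ∂μ at h
  rw [← h, map_mul_right_eq_smul, integral_smul_nnreal_measure]
  rfl

theorem continuous_integral_mul_right (μ : Measure G) [IsFiniteMeasureOnCompacts μ] {f : G → ℝ}
    (hf : Continuous f) (hc : HasCompactSupport f) :
    Continuous fun y : G => ∫ x, f (x * y) ∂μ := by
  refine continuous_iff_continuousAt.2 fun y => ?_
  obtain ⟨V, hV, hy⟩ := exists_compact_mem_nhds y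
  refine ContinuousOn.continuousAt (s := V) ?_ hy
  refine continuousOn_integral_of_compact_support (hc.isCompact.mul hV.inv)
    (by fun_prop) fun p x hp hx => ?_
  by_contra h
  exact hx ⟨x * p, subset_tsupport _ h, p⁻¹, Set.inv_mem_inv.2 hp, by simp⟩

theorem continuous_modChar : Continuous (modChar : G → ℝ) := by
  obtain ⟨⟨g, g_cont⟩, g_comp, g_nonneg, g_one⟩ :
    ∃ g : C(G, ℝ), HasCompactSupport g ∧ 0 ≤ g ∧ g 1 ≠ 0 := exists_continuous_nonneg_pos 1
  have hg : 0 < ∫ x, g x ∂(Measure.haar : Measure G) :=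
    g_cont.integral_pos_of_hasCompactSupport_nonneg_nonzero g_comp g_nonneg g_one
  have h := (continuous_integral_mul_right (Measure.haar : Measure G) g_cont g_comp).div_const
    (∫ x, g x ∂(Measure.haar : Measure G))
  refine h.congr fun y => ?_
  rw [integral_mul_right, smul_eq_mul, mul_div_cancel_right₀ _ hg.ne']

/-- The substitution `x ↦ x⁻¹` for continuous functions of compact support. -/
theorem integral_inv_mul_modChar (μ : Measure G) [μ.IsHaarMeasure] [μ.Regular] {f : G → ℝ}
    (hf : Continuous f) (hc : HasCompactSupport f) :
    ∫ x, f x⁻¹ * modChar x ∂μ = ∫ x, f x ∂μ := by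
  obtain ⟨⟨g, g_cont⟩, g_comp, g_nonneg, g_one⟩ :
    ∃ g : C(G, ℝ), HasCompactSupport g ∧ 0 ≤ g ∧ g 1 ≠ 0 := exists_continuous_nonneg_pos 1
  have hg : 0 < ∫ x, g x ∂μ :=
    g_cont.integral_pos_of_hasCompactSupport_nonneg_nonzero g_comp g_nonneg g_one
  dsimp only [ContinuousMap.coe_mk] at *
  have hΔ : Continuous (modChar : G → ℝ) := continuous_modChar
  -- Both sides times `∫ g` are the integral of `g y * Δ(y) * f (x⁻¹ y) * Δ(x)⁻¹` over `G × G`.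
  have h1 : ∫ y, ∫ x, g y * (modChar y)⁻¹ * (f (x⁻¹ * y) * modChar x) ∂μ ∂μ =
      (∫ x, f x⁻¹ * modChar x ∂μ) * ∫ x, g x ∂μ := by
    rw [← integral_const_mul]
    congr 1 with y
    rw [integral_const_mul, ← integral_mul_left_eq_self _ y]
    have : ∀ x : G, f ((y * x)⁻¹ * y) * modChar (y * x) = modChar y * (f x⁻¹ * modChar x) := by
      intro x
      rw [modChar_mul]
      simp
      ring
    simp_rw [this]
    rw [integral_const_mul]
    field_simp [(modChar_pos y).ne']
  have h2 : ∫ x, ∫ z, (f z * (modChar z)⁻¹) * g (x * z) ∂μ ∂μ =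
      (∫ x, f x ∂μ) * ∫ x, g x ∂μ := by
    rw [integral_integral_swap_of_hasCompactSupport]
    · rw [← integral_mul_const]
      congr 1 with z
      rw [integral_const_mul, integral_mul_right, smul_eq_mul]
      field_simp [(modChar_pos z).ne']
    · have := fun z : G => (modChar_pos z).ne'
      simp only [Function.uncurry_def]
      fun_prop (disch := simp_all)
    · refine HasCompactSupport.intro ((g_comp.isCompact.mul hc.isCompact.inv).prod hc.isCompact) ?_
      rintro ⟨x, z⟩ h
      by_contra h0
      have hz : f z ≠ 0 := fun h => h0 (by simp [h])
      have hx : g (x * z) ≠ 0 := fun h => h0 (by simp [h])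
      exact h ⟨⟨x * z, subset_tsupport _ hx, z⁻¹, Set.inv_mem_inv.2 (subset_tsupport _ hz),
        by simp⟩, subset_tsupport _ hz⟩
  refine mul_right_cancel₀ hg.ne' ?_
  rw [← h1, ← h2, integral_integral_swap_of_hasCompactSupport]
  · congr 1 with x
    rw [← integral_mul_left_eq_self _ x]
    congr 1 with z
    rw [modChar_mul]
    simp
    field_simp [(modChar_pos z).ne', (modChar_pos x).ne']
  · have := fun z : G => (modChar_pos z).ne'
    simp only [Function.uncurry_def]
    fun_prop (disch := simp_all)
  · refine HasCompactSupport.intro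
      (g_comp.isCompact.prod (g_comp.isCompact.mul hc.isCompact.inv)) ?_
    rintro ⟨y, x⟩ h
    by_contra h0
    have hz : f (x⁻¹ * y) ≠ 0 := fun h => h0 (by simp [h])
    have hx : g y ≠ 0 := fun h => h0 (by simp [h])
    exact h ⟨subset_tsupport _ hx, y, subset_tsupport _ hx, (x⁻¹ * y)⁻¹,
      Set.inv_mem_inv.2 (subset_tsupport _ hz), by simp⟩

end Modular

/-! ### Translations and convolution on `L¹(G)` -/

section LOneBasics

variable {G : Type u} [Group G] [TopologicalSpace G] [IsTopologicalGroup G]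
  [LocallyCompactSpace G] [T2Space G] [MeasurableSpace G] [BorelSpace G]
  {μ : Measure G} [μ.IsHaarMeasure] [μ.Regular]

theorem integrable_cc (μ : Measure G) [IsFiniteMeasureOnCompacts μ] (f : C_c(G, ℝ)) :
    Integrable f μ :=
  f.continuous.integrable_of_hasCompactSupport f.hasCompactSupport

variable (μ) in
/-- The class of a compactly supported continuous function in `L¹(G)`. -/
def toLOne (f : C_c(G, ℝ)) : LOne μ := (integrable_cc μ f).toL1 f

theorem coeFn_toLOne (f : C_c(G, ℝ)) : toLOne μ f =ᵐ[μ] f := Integrable.coeFn_toL1 _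

/-- Density of compactly supported continuous functions in `L¹`, without a normality assumption on
the space. -/
theorem exists_cc_eLpNorm_sub_le (φ : LOne μ) {ε : ℝ≥0∞} (hε : ε ≠ 0) :
    ∃ f : G → ℝ, eLpNorm (⇑φ - f) 1 μ ≤ ε ∧ Continuous f ∧ HasCompactSupport f := by
  refine MemLp.induction_dense ENNReal.one_ne_top
    (fun f : G → ℝ => Continuous f ∧ HasCompactSupport f) ?_ ?_ ?_ (Lp.memLp φ) hε
  · intro c s hs hsμ ε hε
    obtain ⟨η, ηpos, hη⟩ : ∃ η : ℝ≥0, 0 < η ∧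
        ∀ s : Set G, μ s ≤ η → eLpNorm (s.indicator fun _x => c) 1 μ ≤ ε :=
      exists_eLpNorm_indicator_le ENNReal.one_ne_top c hε
    have h2 : ((η / 2 : ℝ≥0) : ℝ≥0∞) ≠ 0 := by simpa using ηpos.ne'
    obtain ⟨K, hKs, hK, hKμ⟩ := hs.exists_isCompact_sdiff_lt hsμ.ne h2
    obtain ⟨U, hKU, hU, hUμ⟩ := K.exists_isOpen_lt_add (μ := μ) hK.measure_lt_top.ne h2
    obtain ⟨f, f1, f0, f_comp, f01⟩ := exists_continuous_one_zero_of_isCompact hK hU.isClosed_compl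
      (Set.disjoint_compl_right_iff_subset.2 hKU)
    refine ⟨fun x => f x * c, ?_, by fun_prop, f_comp.mul_right⟩
    refine le_trans (eLpNorm_mono fun x => ?_) (hη ((U \ K) ∪ (s \ K)) ?_)
    · by_cases hxK : x ∈ K
      · have : f x = 1 := f1 hxK
        simp [this, hKs hxK]
      · by_cases hxU : x ∈ U
        · rw [Set.indicator_of_mem (show x ∈ U \ K ∪ s \ K from Or.inl ⟨hxU, hxK⟩)]
          by_cases hxs : x ∈ s
          · simp only [Pi.sub_apply, Set.indicator_of_mem hxs]
            rw [← sub_one_mul, norm_mul]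
            refine mul_le_of_le_one_left (norm_nonneg _) ?_
            rw [Real.norm_eq_abs, abs_le]
            constructor <;> linarith [(f01 x).1, (f01 x).2]
          · simp only [Pi.sub_apply, Set.indicator_of_notMem hxs, sub_zero]
            rw [norm_mul]
            refine mul_le_of_le_one_left (norm_nonneg _) ?_
            rw [Real.norm_eq_abs, abs_le]
            constructor <;> linarith [(f01 x).1, (f01 x).2]
        · have : f x = 0 := f0 hxU
          by_cases hxs : x ∈ s
          · rw [Set.indicator_of_mem (show x ∈ U \ K ∪ s \ K from Or.inr ⟨hxs, hxK⟩)]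
            simp [this, hxs]
          · simp [this, hxs]
    · refine (measure_union_le _ _).trans ?_
      have : μ (U \ K) ≤ (η / 2 : ℝ≥0) := by
        rw [measure_sdiff hKU hK.measurableSet.nullMeasurableSet hK.measure_lt_top.ne]
        exact tsub_le_iff_left.2 hUμ.le
      refine (add_le_add this hKμ.le).trans (le_of_eq ?_)
      rw [← ENNReal.coe_add, add_halves]
  · rintro f g ⟨hf, hfc⟩ ⟨hg, hgc⟩
    exact ⟨hf.add hg, hfc.add hgc⟩
  · rintro f ⟨hf, hfc⟩
    exact (hf.integrable_of_hasCompactSupport hfc).aestronglyMeasurable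

variable (μ) in
theorem denseRange_toLOne : DenseRange (toLOne μ) := by
  refine Metric.denseRange_iff.2 fun φ r hr => ?_
  obtain ⟨f, hle, hf, hc⟩ := exists_cc_eLpNorm_sub_le φ (ε := ENNReal.ofReal (r / 2))
    (by simpa using hr)
  refine ⟨⟨⟨f, hf⟩, hc⟩, lt_of_le_of_lt ?_ (half_lt_self hr)⟩
  rw [Lp.dist_def]
  refine ENNReal.toReal_le_of_le_ofReal (half_pos hr).le (le_trans (le_of_eq ?_) hle)
  refine eLpNorm_congr_ae ?_
  filter_upwards [coeFn_toLOne (μ := μ) ⟨⟨f, hf⟩, hc⟩] with x h2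
  rw [Pi.sub_apply, h2]
  rfl

theorem coeFn_translateLOne (g : G) (φ : LOne μ) :
    translateLOne μ g φ =ᵐ[μ] fun x => φ (g⁻¹ * x) :=
  DomMulAct.smul_Lp_ae_eq (DomMulAct.mk g⁻¹) φ

theorem norm_translateLOne (g : G) (φ : LOne μ) : ‖translateLOne μ g φ‖ = ‖φ‖ :=
  DomMulAct.norm_smul_Lp _ _

theorem translateLOne_mul (g h : G) (φ : LOne μ) :
    translateLOne μ (g * h) φ = translateLOne μ g (translateLOne μ h φ) := by
  simp only [translateLOne, mul_inv_rev, DomMulAct.mk_mul, mul_smul]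

theorem translateLOne_one (φ : LOne μ) : translateLOne μ 1 φ = φ := by
  simp [translateLOne]

variable (μ) in
/-- Left translation by `g` as a continuous linear map on `L¹(G)`. -/
def translateCLM (g : G) : LOne μ →L[ℝ] LOne μ :=
  LinearMap.mkContinuous
    { toFun := translateLOne μ g
      map_add' := fun a b => smul_add (DomMulAct.mk g⁻¹) a b
      map_smul' := fun c a => smul_comm (DomMulAct.mk g⁻¹) c a } 1
    fun φ => by rw [one_mul]; exact (norm_translateLOne g φ).le

theorem translateCLM_apply (g : G) (φ : LOne μ) : translateCLM μ g φ = translateLOne μ g φ := rfl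

theorem continuous_translateLOne (φ : LOne μ) : Continuous fun g : G => translateLOne μ g φ := by
  have : Fact ((1 : ℝ≥0∞) ≠ ∞) := ⟨ENNReal.one_ne_top⟩
  exact (DomMulAct.continuous_mk.comp continuous_inv).smul continuous_const

/-- Integrals of a continuous vector-valued function against an integrable function are Bochner
integrals although `G` need not be separable, since integrable functions are almost everywhere
limits of compactly supported continuous functions. -/
theorem aestronglyMeasurable_smul {E : Type*} [NormedAddCommGroup E] [NormedSpace ℝ E]
    (φ : LOne μ) {k : G → E} (hk : Continuous k) :
    AEStronglyMeasurable (fun y => φ y • k y) μ := by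
  obtain ⟨u, -, hu⟩ : ∃ u : ℕ → C_c(G, ℝ), (∀ n, ‖toLOne μ (u n) - φ‖ < 1 / (n + 1)) ∧
      Tendsto (fun n => toLOne μ (u n)) atTop (𝓝 φ) := by
    choose u hu using fun n : ℕ => Metric.denseRange_iff.1 (denseRange_toLOne μ) φ (1 / (n + 1))
      Nat.one_div_pos_of_nat
    refine ⟨u, fun n => by rw [← dist_eq_norm, dist_comm]; exact hu n, ?_⟩
    refine tendsto_iff_dist_tendsto_zero.2 (squeeze_zero (fun _ => dist_nonneg)
      (fun n => by rw [dist_comm]; exact (hu n).le) tendsto_one_div_add_atTop_nhds_zero_nat)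
  obtain ⟨ns, -, hns⟩ := (tendstoInMeasure_of_tendsto_Lp hu).exists_seq_tendsto_ae
  refine aestronglyMeasurable_of_tendsto_ae atTop (f := fun n y => u (ns n) y • k y)
    (fun n => ?_) ?_
  · exact (((u (ns n)).continuous.smul hk).stronglyMeasurable_of_hasCompactSupport
      (u (ns n)).hasCompactSupport.smul_right).aestronglyMeasurable
  · filter_upwards [hns, ae_all_iff.2 fun n => coeFn_toLOne (μ := μ) (u (ns n))] with y h1 h2
    refine Tendsto.smul_const (h1.congr fun n => h2 n) _

theorem integrable_smul {E : Type*} [NormedAddCommGroup E] [NormedSpace ℝ E]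
    (φ : LOne μ) {k : G → E} (hk : Continuous k) {C : ℝ} (hC : ∀ y, ‖k y‖ ≤ C) :
    Integrable (fun y => φ y • k y) μ := by
  refine ((L1.integrable_coeFn φ).norm.mul_const C).mono' (aestronglyMeasurable_smul φ hk)
    (ae_of_all _ fun y => ?_)
  rw [norm_smul]
  exact mul_le_mul_of_nonneg_left (hC y) (norm_nonneg _)

theorem norm_integral_smul_le {E : Type*} [NormedAddCommGroup E] [NormedSpace ℝ E]
    (φ : LOne μ) {k : G → E} {C : ℝ} (hC : ∀ y, ‖k y‖ ≤ C) :
    ‖∫ y, φ y • k y ∂μ‖ ≤ ‖φ‖ * C := by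
  rw [L1.norm_eq_integral_norm, ← integral_mul_const]
  refine norm_integral_le_of_norm_le ((L1.integrable_coeFn φ).norm.mul_const _)
    (ae_of_all _ fun y => ?_)
  rw [norm_smul]
  exact mul_le_mul_of_nonneg_left (hC y) (norm_nonneg _)

/-- The continuous linear map `φ ↦ ∫ φ(y) k(y) dy` on `L¹(G)` for bounded continuous `k`. -/
def integralCLM {E : Type*} [NormedAddCommGroup E] [NormedSpace ℝ E]
    {k : G → E} (hk : Continuous k) {C : ℝ} (hC : ∀ y, ‖k y‖ ≤ C) : LOne μ →L[ℝ] E :=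
  LinearMap.mkContinuous
    { toFun := fun φ => ∫ y, φ y • k y ∂μ
      map_add' := fun a b => by
        rw [← integral_add (integrable_smul a hk hC) (integrable_smul b hk hC)]
        refine integral_congr_ae ?_
        filter_upwards [Lp.coeFn_add a b] with y hy
        rw [hy, Pi.add_apply, add_smul]
      map_smul' := fun c a => by
        rw [RingHom.id_apply, ← integral_smul]
        refine integral_congr_ae ?_
        filter_upwards [Lp.coeFn_smul c a] with y hy
        rw [hy, Pi.smul_apply, smul_assoc] } C
    fun φ => by rw [mul_comm]; exact norm_integral_smul_le φ hC

/-- The continuous linear functional `φ ↦ ∫ φ(y) F(y) dy` on `L¹(G)` for bounded Borel `F`. -/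
def dualOf {F : G → ℝ} (hF : Measurable F) {C : ℝ} (hC : ∀ y, |F y| ≤ C) : LOne μ →L[ℝ] ℝ :=
  have hi : ∀ φ : LOne μ, Integrable (fun y => φ y * F y) μ := fun φ =>
    (L1.integrable_coeFn φ).mul_bdd (c := C) hF.aestronglyMeasurable (ae_of_all _ hC)
  LinearMap.mkContinuous
    { toFun := fun φ => ∫ y, φ y * F y ∂μ
      map_add' := fun a b => by
        rw [← integral_add (hi a) (hi b)]
        refine integral_congr_ae ?_
        filter_upwards [Lp.coeFn_add a b] with y hy
        rw [hy, Pi.add_apply, add_mul]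
      map_smul' := fun c a => by
        rw [RingHom.id_apply, smul_eq_mul, ← integral_const_mul]
        refine integral_congr_ae ?_
        filter_upwards [Lp.coeFn_smul c a] with y hy
        rw [hy, Pi.smul_apply, smul_eq_mul, mul_assoc] } C
    fun φ => by rw [mul_comm]; exact norm_integral_smul_le φ hC

theorem dualOf_apply {F : G → ℝ} (hF : Measurable F) {C : ℝ} (hC : ∀ y, |F y| ≤ C) (φ : LOne μ) :
    dualOf hF hC φ = ∫ y, φ y * F y ∂μ := rfl

theorem conv_eq_integralCLM (φ ψ : LOne μ) :
    conv μ φ ψ = integralCLM (continuous_translateLOne ψ)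
      (fun y => (norm_translateLOne y ψ).le) φ := rfl

theorem map_conv {E : Type*} [NormedAddCommGroup E] [NormedSpace ℝ E] [CompleteSpace E]
    (L : LOne μ →L[ℝ] E) (φ ψ : LOne μ) :
    L (conv μ φ ψ) = ∫ y, φ y • L (translateLOne μ y ψ) ∂μ := by
  rw [conv, ← L.integral_comp_comm (integrable_smul φ (continuous_translateLOne ψ)
    (fun y => (norm_translateLOne y ψ).le))]
  simp

theorem norm_conv_le (φ ψ : LOne μ) : ‖conv μ φ ψ‖ ≤ ‖φ‖ * ‖ψ‖ :=
  norm_integral_smul_le φ fun y => (norm_translateLOne y ψ).le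

variable (μ) in
/-- Convolution as a continuous bilinear map. -/
def convCLM : LOne μ →L[ℝ] LOne μ →L[ℝ] LOne μ :=
  LinearMap.mkContinuous₂
    (LinearMap.mk₂ ℝ (conv μ)
      (fun a b ψ => by simp only [conv_eq_integralCLM, map_add])
      (fun c a ψ => by simp only [conv_eq_integralCLM, map_smul])
      (fun a ψ ψ' => by
        simp only [conv]
        rw [← integral_add (integrable_smul a (continuous_translateLOne ψ)
          (fun y => (norm_translateLOne y ψ).le)) (integrable_smul a (continuous_translateLOne ψ')
          (fun y => (norm_translateLOne y ψ').le))]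
        simp only [← smul_add, ← translateCLM_apply, map_add])
      (fun c a ψ => by
        simp only [conv]
        rw [← integral_smul]
        simp only [← translateCLM_apply, map_smul, smul_comm c])) 1
    fun a b => by rw [one_mul]; exact norm_conv_le a b

theorem convCLM_apply (φ ψ : LOne μ) : convCLM μ φ ψ = conv μ φ ψ := rfl

/-! ### Right translations -/

theorem integrable_rightTranslate (g : G) (φ : LOne μ) :
    Integrable (fun x => modChar g * φ (x * g⁻¹)) μ := by
  refine Integrable.const_mul ?_ _
  have h : Integrable φ (Measure.map (· * g⁻¹) μ) := by
    rw [map_mul_right_eq_smul]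
    exact (L1.integrable_coeFn φ).smul_measure_nnreal
  exact h.comp_measurable (measurable_mul_const g⁻¹)

theorem ae_mul_right {p : G → Prop} (h : ∀ᵐ x ∂μ, p x) (g : G) : ∀ᵐ x ∂μ, p (x * g) := by
  have : ∀ᵐ x ∂(Measure.map (· * g) μ), p x := by
    rw [map_mul_right_eq_smul]
    exact (Measure.smul_absolutelyContinuous (c := (Measure.modularCharacter g : ℝ≥0))).ae_le h
  exact ae_of_ae_map (measurable_mul_const g).aemeasurable this

theorem integral_norm_rightTranslate (g : G) (φ : LOne μ) :
    ∫ x, ‖modChar g * φ (x * g⁻¹)‖ ∂μ = ‖φ‖ := by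
  simp_rw [norm_mul, Real.norm_of_nonneg (modChar_pos g).le]
  rw [integral_const_mul, integral_mul_right μ (fun x => ‖φ x‖), smul_eq_mul, ← mul_assoc,
    ← modChar_mul, mul_inv_cancel, modChar_one, one_mul, L1.norm_eq_integral_norm]

variable (μ) in
/-- The isometric right translation `(ρ_g φ)(x) = Δ(g)⁻¹ φ(x g⁻¹)` of `L¹(G)`, with `Δ` the
classical modular function. -/
def rightTranslate (g : G) : LOne μ →L[ℝ] LOne μ :=
  LinearMap.mkContinuous
    { toFun := fun φ => (integrable_rightTranslate g φ).toL1 _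
      map_add' := fun a b => by
        rw [← Integrable.toL1_add, Integrable.toL1_eq_toL1_iff]
        filter_upwards [ae_mul_right (Lp.coeFn_add a b) g⁻¹] with y hy
        rw [hy, Pi.add_apply, Pi.add_apply, mul_add]
      map_smul' := fun c a => by
        rw [RingHom.id_apply, ← Integrable.toL1_smul, Integrable.toL1_eq_toL1_iff]
        filter_upwards [ae_mul_right (Lp.coeFn_smul c a) g⁻¹] with y hy
        rw [hy, Pi.smul_apply, smul_eq_mul, smul_eq_mul]
        ring } 1
    fun φ => by
      rw [one_mul, ← integral_norm_rightTranslate g φ]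
      exact (L1.norm_of_fun_eq_integral_norm (integrable_rightTranslate g φ)).le

theorem coeFn_rightTranslate (g : G) (φ : LOne μ) :
    rightTranslate μ g φ =ᵐ[μ] fun x => modChar g * φ (x * g⁻¹) :=
  Integrable.coeFn_toL1 (integrable_rightTranslate g φ)

theorem norm_rightTranslate (g : G) (φ : LOne μ) : ‖rightTranslate μ g φ‖ = ‖φ‖ := by
  rw [← integral_norm_rightTranslate g φ]
  exact L1.norm_of_fun_eq_integral_norm (integrable_rightTranslate g φ)

theorem rightTranslate_mul (g h : G) (φ : LOne μ) :
    rightTranslate μ (h * g) φ = rightTranslate μ g (rightTranslate μ h φ) := by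
  refine Lp.ext ?_
  filter_upwards [coeFn_rightTranslate (h * g) φ, coeFn_rightTranslate g (rightTranslate μ h φ),
    ae_mul_right (coeFn_rightTranslate h φ) g⁻¹] with x h1 h2 h3
  rw [h1, h2, h3, modChar_mul, mul_inv_rev]
  simp only [mul_assoc]
  ring

theorem rightTranslate_one (φ : LOne μ) : rightTranslate μ 1 φ = φ := by
  refine Lp.ext ?_
  filter_upwards [coeFn_rightTranslate 1 φ] with x h1
  rw [h1, modChar_one]
  simp

/-- Substitution in the pairing of a right translate with any function. -/
theorem integral_rightTranslate_mul (g : G) (φ : LOne μ) (F : G → ℝ) :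
    ∫ x, rightTranslate μ g φ x * F x ∂μ = ∫ x, φ x * F (x * g) ∂μ := by
  have h := integral_mul_right μ (fun x => φ x * F (x * g)) g⁻¹
  rw [smul_eq_mul] at h
  rw [← one_mul (∫ x, φ x * F (x * g) ∂μ), ← modChar_one (G := G), ← mul_inv_cancel g, modChar_mul,
    mul_assoc, ← h, ← integral_const_mul]
  refine integral_congr_ae ?_
  filter_upwards [coeFn_rightTranslate g φ] with x hx
  rw [hx]
  simp only [inv_mul_cancel_right]
  ring

theorem integral_translateLOne_mul (g : G) (φ : LOne μ) (F : G → ℝ) :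
    ∫ x, translateLOne μ g φ x * F x ∂μ = ∫ x, φ x * F (g * x) ∂μ := by
  rw [← integral_mul_left_eq_self (fun x => translateLOne μ g φ x * F x) g]
  refine integral_congr_ae ?_
  have h := coeFn_translateLOne g φ
  have h' : ∀ᵐ x ∂μ, translateLOne μ g φ (g * x) = φ (g⁻¹ * (g * x)) :=
    (measurePreserving_mul_left μ g).quasiMeasurePreserving.ae h
  filter_upwards [h'] with x hx
  rw [hx, inv_mul_cancel_left]

theorem rightTranslate_translateLOne (g h : G) (φ : LOne μ) :
    rightTranslate μ g (translateLOne μ h φ) = translateLOne μ h (rightTranslate μ g φ) := by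
  refine Lp.ext ?_
  filter_upwards [coeFn_rightTranslate g (translateLOne μ h φ),
    ae_mul_right (coeFn_translateLOne h φ) g⁻¹, coeFn_translateLOne h (rightTranslate μ g φ),
    (measurePreserving_mul_left μ h⁻¹).quasiMeasurePreserving.ae (coeFn_rightTranslate g φ)]
    with x h1 h2 h3 h4
  rw [h1, h2, h3, h4, mul_assoc]

theorem continuous_rightTranslate (φ : LOne μ) : Continuous fun g : G => rightTranslate μ g φ := by
  -- By density it suffices to treat compactly supported continuous functions.
  have hcc : ∀ f : C_c(G, ℝ), Continuous fun g : G => rightTranslate μ g (toLOne μ f) := by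
    intro f
    refine continuous_iff_continuousAt.2 fun g₀ => ?_
    obtain ⟨V, hV, hg⟩ := exists_compact_mem_nhds g₀
    have hf := f.continuous
    have hΔ : Continuous (modChar : G → ℝ) := continuous_modChar
    have h : ContinuousOn (fun g : G => ∫ x, |modChar g * f (x * g⁻¹) -
        modChar g₀ * f (x * g₀⁻¹)| ∂μ) V := by
      refine continuousOn_integral_of_compact_support (f.hasCompactSupport.isCompact.mul hV)
        (by fun_prop) fun p x hp hx => ?_
      have hz : ∀ q ∈ V, f (x * q⁻¹) = 0 := by
        intro q hq
        by_contra h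
        exact hx ⟨x * q⁻¹, subset_tsupport _ h, q, hq, by simp⟩
      simp [hz p hp, hz g₀ (mem_of_mem_nhds hg)]
    have h' := (h.continuousAt hg).tendsto
    simp only [sub_self, abs_zero, integral_zero] at h'
    refine tendsto_iff_norm_sub_tendsto_zero.2 (h'.congr fun g => ?_)
    rw [L1.norm_eq_integral_norm]
    refine integral_congr_ae ?_
    filter_upwards [Lp.coeFn_sub (rightTranslate μ g (toLOne μ f))
      (rightTranslate μ g₀ (toLOne μ f)), coeFn_rightTranslate g (toLOne μ f),
      coeFn_rightTranslate g₀ (toLOne μ f), ae_mul_right (coeFn_toLOne (μ := μ) f) g⁻¹,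
      ae_mul_right (coeFn_toLOne (μ := μ) f) g₀⁻¹] with x h1 h2 h3 h4 h5
    rw [h1, Pi.sub_apply, h2, h3, h4, h5, Real.norm_eq_abs]
  refine continuous_iff_continuousAt.2 fun g₀ => Metric.continuousAt_iff'.2 fun ε hε => ?_
  obtain ⟨f, hf⟩ := Metric.denseRange_iff.1 (denseRange_toLOne μ) φ (ε / 3) (by positivity)
  filter_upwards [Metric.continuousAt_iff'.1 ((hcc f).continuousAt (x := g₀)) (ε / 3)
    (by positivity)] with g hg
  have e : ∀ g : G, dist (rightTranslate μ g φ) (rightTranslate μ g (toLOne μ f)) < ε / 3 := by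
    intro g
    rwa [dist_eq_norm, ← map_sub, norm_rightTranslate, ← dist_eq_norm]
  calc dist (rightTranslate μ g φ) (rightTranslate μ g₀ φ)
      ≤ dist (rightTranslate μ g φ) (rightTranslate μ g (toLOne μ f)) +
        dist (rightTranslate μ g (toLOne μ f)) (rightTranslate μ g₀ (toLOne μ f)) +
        dist (rightTranslate μ g₀ (toLOne μ f)) (rightTranslate μ g₀ φ) := dist_triangle4 _ _ _ _
    _ < ε / 3 + ε / 3 + ε / 3 := by
        refine add_lt_add (add_lt_add (e g) hg) ?_
        rw [dist_comm]; exact e g₀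
    _ = ε := by ring

variable (μ) in
/-- The bilinear map `(φ, ψ) ↦ ∫ ψ(y) ρ_y φ dy`, the second form of convolution. -/
def convRight : LOne μ →L[ℝ] LOne μ →L[ℝ] LOne μ :=
  LinearMap.mkContinuous₂
    (LinearMap.mk₂ ℝ (fun φ ψ => ∫ y, ψ y • rightTranslate μ y φ ∂μ)
      (fun a b ψ => by
        rw [← integral_add (integrable_smul ψ (continuous_rightTranslate a)
          (fun y => (norm_rightTranslate y a).le)) (integrable_smul ψ (continuous_rightTranslate b)
          (fun y => (norm_rightTranslate y b).le))]
        simp only [← smul_add, map_add])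
      (fun c a ψ => by
        rw [← integral_smul]
        simp only [map_smul, smul_comm c])
      (fun a ψ ψ' => map_add (integralCLM (continuous_rightTranslate a)
        (fun y => (norm_rightTranslate y a).le)) ψ ψ')
      (fun c a ψ => map_smul (integralCLM (continuous_rightTranslate a)
        (fun y => (norm_rightTranslate y a).le)) c ψ)) 1
    fun a b => by
      rw [one_mul, mul_comm]
      exact norm_integral_smul_le b fun y => (norm_rightTranslate y a).le

theorem convRight_apply (φ ψ : LOne μ) :
    convRight μ φ ψ = ∫ y, ψ y • rightTranslate μ y φ ∂μ := rfl

theorem setIntegral_conv_toLOne (f g : C_c(G, ℝ)) {s : Set G} (hs : MeasurableSet s) :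
    ∫ x in s, conv μ (toLOne μ f) (toLOne μ g) x ∂μ =
      ∫ x in s, ∫ y, f y * g (y⁻¹ * x) ∂μ ∂μ := by
  have hf := f.continuous
  have hg := g.continuous
  have hm : Measurable (s.indicator fun _ => (1 : ℝ)) := measurable_const.indicator hs
  have hb : ∀ y, |s.indicator (fun _ => (1 : ℝ)) y| ≤ 1 := fun y => by
    by_cases h : y ∈ s <;> simp [h]
  have key : ∀ k : G → ℝ, ∫ x in s, k x ∂μ = ∫ x, k x * s.indicator (fun _ => (1 : ℝ)) x ∂μ := by
    intro k
    rw [← integral_indicator hs]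
    congr 1 with x
    by_cases h : x ∈ s <;> simp [h]
  rw [integral_integral_swap_of_hasCompactSupport]
  · rw [key, ← dualOf_apply hm hb, map_conv]
    refine integral_congr_ae ?_
    filter_upwards [coeFn_toLOne (μ := μ) f] with y hy
    rw [hy, dualOf_apply, ← key, integral_const_mul, smul_eq_mul]
    congr 1
    refine setIntegral_congr_ae hs ?_
    filter_upwards [coeFn_translateLOne y (toLOne μ g),
      (measurePreserving_mul_left μ y⁻¹).quasiMeasurePreserving.ae (coeFn_toLOne (μ := μ) g)]
      with x h1 h2 _
    rw [h1, h2]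
  · simp only [Function.uncurry_def]
    fun_prop
  · refine HasCompactSupport.intro ((f.hasCompactSupport.isCompact.mul
      g.hasCompactSupport.isCompact).prod f.hasCompactSupport.isCompact) ?_
    rintro ⟨x, y⟩ h
    by_contra h0
    have h1 : f y ≠ 0 := fun h => h0 (by simp [h])
    have h2 : g (y⁻¹ * x) ≠ 0 := fun h => h0 (by simp [h])
    exact h ⟨⟨y, subset_tsupport _ h1, y⁻¹ * x, subset_tsupport _ h2, by simp⟩,
      subset_tsupport _ h1⟩

theorem setIntegral_convRight_toLOne (f g : C_c(G, ℝ)) {s : Set G} (hs : MeasurableSet s) :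
    ∫ x in s, convRight μ (toLOne μ f) (toLOne μ g) x ∂μ =
      ∫ x in s, ∫ y, g y * (modChar y * f (x * y⁻¹)) ∂μ ∂μ := by
  have hf := f.continuous
  have hg := g.continuous
  have hΔ : Continuous (modChar : G → ℝ) := continuous_modChar
  have hm : Measurable (s.indicator fun _ => (1 : ℝ)) := measurable_const.indicator hs
  have hb : ∀ y, |s.indicator (fun _ => (1 : ℝ)) y| ≤ 1 := fun y => by
    by_cases h : y ∈ s <;> simp [h]
  have key : ∀ k : G → ℝ, ∫ x in s, k x ∂μ = ∫ x, k x * s.indicator (fun _ => (1 : ℝ)) x ∂μ := by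
    intro k
    rw [← integral_indicator hs]
    congr 1 with x
    by_cases h : x ∈ s <;> simp [h]
  rw [integral_integral_swap_of_hasCompactSupport]
  · rw [key, ← dualOf_apply hm hb, convRight_apply, ← (dualOf hm hb).integral_comp_comm
      (integrable_smul _ (continuous_rightTranslate _) (fun y => (norm_rightTranslate y _).le))]
    refine integral_congr_ae ?_
    filter_upwards [coeFn_toLOne (μ := μ) g] with y hy
    rw [hy, map_smul, dualOf_apply, ← key, integral_const_mul, smul_eq_mul]
    congr 1
    refine setIntegral_congr_ae hs ?_
    filter_upwards [coeFn_rightTranslate y (toLOne μ f),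
      ae_mul_right (coeFn_toLOne (μ := μ) f) y⁻¹] with x h1 h2 _
    rw [h1, h2]
  · simp only [Function.uncurry_def]
    fun_prop
  · refine HasCompactSupport.intro ((f.hasCompactSupport.isCompact.mul
      g.hasCompactSupport.isCompact).prod g.hasCompactSupport.isCompact) ?_
    rintro ⟨x, y⟩ h
    by_contra h0
    have h1 : g y ≠ 0 := fun h => h0 (by simp [h])
    have h2 : f (x * y⁻¹) ≠ 0 := fun h => h0 (by simp [h])
    exact h ⟨⟨x * y⁻¹, subset_tsupport _ h2, y, subset_tsupport _ h1, by simp⟩,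
      subset_tsupport _ h1⟩

/-- Convolution is also the integral of the right translates of the first factor against the second
factor. -/
theorem conv_eq_convRight (φ ψ : LOne μ) : conv μ φ ψ = convRight μ φ ψ := by
  have hcc : ∀ f g : C_c(G, ℝ), convCLM μ (toLOne μ f) (toLOne μ g) =
      convRight μ (toLOne μ f) (toLOne μ g) := by
    intro f g
    refine Lp.ext (Integrable.ae_eq_of_forall_setIntegral_eq _ _ (L1.integrable_coeFn _)
      (L1.integrable_coeFn _) fun s hs _ => ?_)
    rw [convCLM_apply, setIntegral_conv_toLOne f g hs, setIntegral_convRight_toLOne f g hs]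
    congr 1 with x
    have hf := f.continuous
    have hg := g.continuous
    rw [← integral_mul_left_eq_self _ x]
    have hc : HasCompactSupport fun y => f (x * y) * g y⁻¹ :=
      HasCompactSupport.mul_right (f.hasCompactSupport.comp_homeomorph (Homeomorph.mulLeft x))
    refine Eq.trans (integral_congr_ae (ae_of_all _ fun y => ?_))
      ((integral_inv_mul_modChar μ (by fun_prop) hc).symm.trans
        (integral_congr_ae (ae_of_all _ fun y => ?_)))
    · simp
    · simp only [inv_inv]
      ring
  have h1 : ∀ g : C_c(G, ℝ), ∀ φ, convCLM μ φ (toLOne μ g) = convRight μ φ (toLOne μ g) := by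
    intro g
    refine congr_fun ((denseRange_toLOne μ).equalizer ?_ ?_ (funext fun f => hcc f g))
    · exact ((convCLM μ).flip (toLOne μ g)).continuous
    · exact ((convRight μ).flip (toLOne μ g)).continuous
  exact congr_fun ((denseRange_toLOne μ).equalizer (convCLM μ φ).continuous
    (convRight μ φ).continuous (funext fun g => h1 g φ)) ψ

theorem map_conv_right {E : Type*} [NormedAddCommGroup E] [NormedSpace ℝ E] [CompleteSpace E]
    (L : LOne μ →L[ℝ] E) (φ ψ : LOne μ) :
    L (conv μ φ ψ) = ∫ y, ψ y • L (rightTranslate μ y φ) ∂μ := by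
  rw [conv_eq_convRight, convRight_apply, ← L.integral_comp_comm (integrable_smul ψ
    (continuous_rightTranslate φ) (fun y => (norm_rightTranslate y φ).le))]
  simp

end LOneBasics

/-! ### Approximate identities -/

section Bump

variable {G : Type u} [Group G] [TopologicalSpace G] [IsTopologicalGroup G]
  [LocallyCompactSpace G] [T2Space G] [MeasurableSpace G] [BorelSpace G]
  {μ : Measure G} [μ.IsHaarMeasure] [μ.Regular]

variable (μ) in
/-- `w` is a continuous compactly supported probability density that vanishes off `U`. -/
structure IsBump (U : Set G) (w : C_c(G, ℝ)) : Prop where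
  nonneg : ∀ y, 0 ≤ w y
  integral_eq : ∫ y, w y ∂μ = 1
  eq_zero : ∀ y, y ∉ U → w y = 0

theorem exists_isBump {x₀ : G} {U : Set G} (hU : U ∈ 𝓝 x₀) : ∃ w, IsBump μ U w := by
  obtain ⟨V, hVU, hV, hx⟩ := mem_nhds_iff.1 hU
  obtain ⟨f, f1, f0, f_comp, f01⟩ := exists_continuous_one_zero_of_isCompact
    (isCompact_singleton (x := x₀)) hV.isClosed_compl
    (Set.disjoint_compl_right_iff_subset.2 (Set.singleton_subset_iff.2 hx))
  have hpos : 0 < ∫ y, f y ∂μ :=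
    f.continuous.integral_pos_of_hasCompactSupport_nonneg_nonzero f_comp (fun y => (f01 y).1)
      (x := x₀) (by rw [f1 rfl]; simp)
  refine ⟨⟨⟨fun y => f y / ∫ y, f y ∂μ, by fun_prop⟩, ?_⟩, ?_, ?_, ?_⟩
  · simp_rw [div_eq_mul_inv]
    exact f_comp.mul_right
  · exact fun y => div_nonneg (f01 y).1 hpos.le
  · change ∫ y, f y / ∫ y, f y ∂μ ∂μ = 1
    rw [integral_div, div_self hpos.ne']
  · intro y hy
    change f y / ∫ y, f y ∂μ = 0
    rw [show f y = 0 from f0 fun h => hy (hVU h), zero_div]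

variable (μ) in
/-- The filter of probability densities concentrating at `x₀`. -/
def bumpFilter (x₀ : G) : Filter C_c(G, ℝ) := (𝓝 x₀).lift' fun U => {w | IsBump μ U w}

theorem monotone_isBump : Monotone fun U : Set G => {w | IsBump μ U w} :=
  fun _ _ h _ hw => ⟨hw.1, hw.2, fun y hy => hw.3 y fun hy' => hy (h hy')⟩

instance (x₀ : G) : (bumpFilter μ x₀).NeBot :=
  (lift'_neBot_iff monotone_isBump).2 fun _ hU => exists_isBump hU

theorem eventually_isBump {x₀ : G} {U : Set G} (hU : U ∈ 𝓝 x₀) :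
    ∀ᶠ w in bumpFilter μ x₀, IsBump μ U w := mem_lift' hU

theorem IsBump.norm_toLOne {U : Set G} {w : C_c(G, ℝ)} (hw : IsBump μ U w) :
    ‖toLOne μ w‖ = 1 := by
  rw [← hw.integral_eq, L1.norm_eq_integral_norm]
  refine integral_congr_ae ?_
  filter_upwards [coeFn_toLOne (μ := μ) w] with y hy
  rw [hy, Real.norm_of_nonneg (hw.nonneg y)]

theorem IsBump.norm_integral_sub_le {E : Type*} [NormedAddCommGroup E] [NormedSpace ℝ E]
    [CompleteSpace E] {U : Set G} {w : C_c(G, ℝ)} (hw : IsBump μ U w) {k : G → E}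
    (hk : Continuous k) {a : E} {ε : ℝ} (hε : ∀ y ∈ U, ‖k y - a‖ ≤ ε) :
    ‖∫ y, toLOne μ w y • k y ∂μ - a‖ ≤ ε := by
  have h1 : ∫ y, toLOne μ w y • k y ∂μ - a = ∫ y, w y • (k y - a) ∂μ := by
    have hi : Integrable (fun y => w y • k y) μ :=
      (w.continuous.smul hk).integrable_of_hasCompactSupport w.hasCompactSupport.smul_right
    simp_rw [smul_sub]
    rw [integral_sub hi ((integrable_cc μ w).smul_const a), integral_smul_const, hw.integral_eq,
      one_smul]
    congr 1
    refine integral_congr_ae ?_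
    filter_upwards [coeFn_toLOne (μ := μ) w] with y hy
    rw [hy]
  rw [h1, ← one_mul ε, ← hw.integral_eq, ← integral_mul_const]
  refine norm_integral_le_of_norm_le ((integrable_cc μ w).mul_const ε) (ae_of_all _ fun y => ?_)
  rw [norm_smul, Real.norm_of_nonneg (hw.nonneg y)]
  by_cases hy : y ∈ U
  · exact mul_le_mul_of_nonneg_left (hε y hy) (hw.nonneg y)
  · simp [hw.eq_zero y hy]

theorem tendsto_integral_bump {E : Type*} [NormedAddCommGroup E] [NormedSpace ℝ E]
    [CompleteSpace E] {k : G → E} (hk : Continuous k) (x₀ : G) :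
    Tendsto (fun w => ∫ y, toLOne μ w y • k y ∂μ) (bumpFilter μ x₀) (𝓝 (k x₀)) := by
  refine Metric.tendsto_nhds.2 fun ε hε => ?_
  have hU := Metric.continuousAt_iff'.1 (hk.continuousAt (x := x₀)) (ε / 2) (half_pos hε)
  filter_upwards [eventually_isBump hU] with w hw
  rw [dist_eq_norm]
  refine (hw.norm_integral_sub_le hk fun y hy => ?_).trans_lt (half_lt_self hε)
  rw [← dist_eq_norm]
  exact le_of_lt hy

theorem tendsto_conv_left (ψ : LOne μ) :
    Tendsto (fun w => conv μ (toLOne μ w) ψ) (bumpFilter μ 1) (𝓝 ψ) := by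
  have h := tendsto_integral_bump (μ := μ) (continuous_translateLOne ψ) 1
  rwa [translateLOne_one] at h

theorem tendsto_conv_right (φ : LOne μ) :
    Tendsto (fun w => conv μ φ (toLOne μ w)) (bumpFilter μ 1) (𝓝 φ) := by
  have h := tendsto_integral_bump (μ := μ) (continuous_rightTranslate φ) 1
  rw [rightTranslate_one] at h
  exact h.congr fun w => by rw [conv_eq_convRight, convRight_apply]

end Bump

/-! ### Limits of functionals and invariant means -/

section Functionals

/-- A bounded family of functionals has a pointwise limit along some ultrafilter. -/
theorem exists_ultralimit {V ι : Type*} [SeminormedAddCommGroup V] [NormedSpace ℝ V]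
    (l : Filter ι) [l.NeBot] (m : ι → V →ₗ[ℝ] ℝ) (C : ℝ)
    (h : ∀ᶠ i in l, ∀ f, |m i f| ≤ C * ‖f‖) :
    ∃ (U : Ultrafilter ι) (M : V →ₗ[ℝ] ℝ), ↑U ≤ l ∧ (∀ f, |M f| ≤ C * ‖f‖) ∧
      ∀ f, Tendsto (fun i => m i f) U (𝓝 (M f)) := by
  have hU : ↑(Ultrafilter.of l) ≤ l := Ultrafilter.of_le l
  have hb : ∀ f, ∀ᶠ i in (Ultrafilter.of l : Filter ι), m i f ∈ Set.Icc (-(C * ‖f‖)) (C * ‖f‖) := by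
    intro f
    filter_upwards [hU h] with i hi
    exact abs_le.1 (hi f)
  have hl : ∀ f, ∃ a ∈ Set.Icc (-(C * ‖f‖)) (C * ‖f‖),
      Tendsto (fun i => m i f) (Ultrafilter.of l) (𝓝 a) := fun f =>
    isCompact_Icc.ultrafilter_le_nhds ((Ultrafilter.of l).map fun i => m i f)
      (le_principal_iff.2 (hb f))
  choose M hM hlim using hl
  refine ⟨Ultrafilter.of l, ⟨⟨M, fun a b => ?_⟩, fun c a => ?_⟩, hU, fun f => abs_le.2 (hM f), hlim⟩
  · refine tendsto_nhds_unique (hlim (a + b)) ?_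
    simp only [map_add]
    exact (hlim a).add (hlim b)
  · refine tendsto_nhds_unique (hlim (c • a)) ?_
    simp only [map_smul]
    exact (hlim a).const_smul c

variable {G : Type u} [Group G] [TopologicalSpace G] [IsTopologicalGroup G]

theorem inf_mem_Cbru {a b : G →ᵇ ℝ} (ha : a ∈ Cbru G) (hb : b ∈ Cbru G) : a ⊓ b ∈ Cbru G := by
  have h : Continuous fun g : G => translateCb g a ⊓ translateCb g b :=
    Continuous.inf (f := fun g : G => translateCb g a) ha hb
  exact h

theorem translateCbru_apply (g : G) (f : Cbru G) (x : G) :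
    (translateCbru g f : G →ᵇ ℝ) x = (f : G →ᵇ ℝ) (g⁻¹ * x) := rfl

theorem oneCbru_apply (x : G) : (oneCbru G : G →ᵇ ℝ) x = 1 := rfl

theorem Cbru.abs_apply_le (f : Cbru G) (x : G) : |(f : G →ᵇ ℝ) x| ≤ ‖f‖ :=
  (f : G →ᵇ ℝ).norm_coe_le_norm x

theorem Cbru.ext_apply {a b : Cbru G} (h : ∀ x, (a : G →ᵇ ℝ) x = (b : G →ᵇ ℝ) x) : a = b :=
  Subtype.ext (BoundedContinuousFunction.ext h)

theorem Cbru.map_sub (m : Cbru G →ₗ[ℝ] ℝ) (f g : Cbru G) : m (f - g) = m f - m g :=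
  _root_.map_sub m f g

theorem Cbru.map_neg (m : Cbru G →ₗ[ℝ] ℝ) (f : Cbru G) : m (-f) = -m f := _root_.map_neg m f

/-- The values of `m` on the order interval `[0, f]`. -/
def intervalValues (m : Cbru G →ₗ[ℝ] ℝ) (f : Cbru G) : Set ℝ :=
  m '' {g | ∀ x, 0 ≤ (g : G →ᵇ ℝ) x ∧ (g : G →ᵇ ℝ) x ≤ (f : G →ᵇ ℝ) x}

/-- The positive part of a bounded functional on the cone of non-negative functions. -/
def posPartOn (m : Cbru G →ₗ[ℝ] ℝ) (f : Cbru G) : ℝ := sSup (intervalValues m f)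

section PosPart

variable {m : Cbru G →ₗ[ℝ] ℝ} {C : ℝ} (hC : ∀ f, |m f| ≤ C * ‖f‖)

include hC

theorem bddAbove_intervalValues (f : Cbru G) : BddAbove (intervalValues m f) := by
  refine ⟨|C| * ‖f‖, ?_⟩
  rintro _ ⟨g, hg, rfl⟩
  have hgf : ‖g‖ ≤ ‖f‖ := by
    refine ((g : G →ᵇ ℝ).norm_le (norm_nonneg f)).2 fun x => ?_
    rw [Real.norm_of_nonneg (hg x).1]
    exact (hg x).2.trans ((le_abs_self _).trans (Cbru.abs_apply_le f x))
  calc m g ≤ |m g| := le_abs_self _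
    _ ≤ C * ‖g‖ := hC g
    _ ≤ |C| * ‖f‖ := mul_le_mul (le_abs_self C) hgf (norm_nonneg g) (abs_nonneg _)

theorem le_posPartOn {f g : Cbru G}
    (hg : ∀ x, 0 ≤ (g : G →ᵇ ℝ) x ∧ (g : G →ᵇ ℝ) x ≤ (f : G →ᵇ ℝ) x) : m g ≤ posPartOn m f :=
  le_csSup (bddAbove_intervalValues hC f) ⟨g, hg, rfl⟩

omit hC in
theorem posPartOn_le {f : Cbru G} (hf : ∀ x, 0 ≤ (f : G →ᵇ ℝ) x) {r : ℝ}
    (h : ∀ g : Cbru G, (∀ x, 0 ≤ (g : G →ᵇ ℝ) x ∧ (g : G →ᵇ ℝ) x ≤ (f : G →ᵇ ℝ) x) → m g ≤ r) :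
    posPartOn m f ≤ r :=
  csSup_le ⟨m 0, 0, fun x => ⟨le_rfl, hf x⟩, rfl⟩ (by rintro _ ⟨g, hg, rfl⟩; exact h g hg)

theorem posPartOn_nonneg {f : Cbru G} (hf : ∀ x, 0 ≤ (f : G →ᵇ ℝ) x) : 0 ≤ posPartOn m f := by
  have := le_posPartOn hC (f := f) (g := 0) fun x => ⟨le_rfl, hf x⟩
  simpa using this

theorem posPartOn_add {f g : Cbru G} (hf : ∀ x, 0 ≤ (f : G →ᵇ ℝ) x)
    (hg : ∀ x, 0 ≤ (g : G →ᵇ ℝ) x) : posPartOn m (f + g) = posPartOn m f + posPartOn m g := by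
  refine le_antisymm (posPartOn_le (fun x => add_nonneg (hf x) (hg x)) fun k hk => ?_) ?_
  · -- Riesz decomposition: `k = k ⊓ f + (k - k ⊓ f)`.
    let k₁ : Cbru G := ⟨(k : G →ᵇ ℝ) ⊓ f, inf_mem_Cbru k.2 f.2⟩
    have e : ∀ x, (k₁ : G →ᵇ ℝ) x = min ((k : G →ᵇ ℝ) x) ((f : G →ᵇ ℝ) x) := fun x => rfl
    have h1 : m k₁ ≤ posPartOn m f := le_posPartOn hC fun x => by
      rw [e]
      exact ⟨le_min (hk x).1 (hf x), min_le_right _ _⟩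
    have h2 : m (k - k₁) ≤ posPartOn m g := le_posPartOn hC fun x => by
      change 0 ≤ (k : G →ᵇ ℝ) x - (k₁ : G →ᵇ ℝ) x ∧ (k : G →ᵇ ℝ) x - (k₁ : G →ᵇ ℝ) x ≤ _
      rw [e]
      have hk2 : (k : G →ᵇ ℝ) x ≤ (f : G →ᵇ ℝ) x + (g : G →ᵇ ℝ) x := (hk x).2
      refine ⟨sub_nonneg.2 (min_le_left _ _), ?_⟩
      rcases min_cases ((k : G →ᵇ ℝ) x) ((f : G →ᵇ ℝ) x) with h | h
      · rw [h.1]; linarith [hg x]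
      · rw [h.1]; linarith
    rw [Cbru.map_sub] at h2
    linarith
  · rw [← le_sub_iff_add_le]
    refine posPartOn_le hf fun a ha => ?_
    rw [le_sub_comm]
    refine posPartOn_le hg fun b hb => ?_
    rw [le_sub_iff_add_le, add_comm, ← map_add]
    exact le_posPartOn hC fun x => ⟨add_nonneg (ha x).1 (hb x).1, add_le_add (ha x).2 (hb x).2⟩

theorem posPartOn_smul {c : ℝ} (hc : 0 ≤ c) {f : Cbru G} (hf : ∀ x, 0 ≤ (f : G →ᵇ ℝ) x) :
    posPartOn m (c • f) = c * posPartOn m f := by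
  have hle : ∀ {c : ℝ}, 0 < c → ∀ {f : Cbru G}, (∀ x, 0 ≤ (f : G →ᵇ ℝ) x) →
      c * posPartOn m f ≤ posPartOn m (c • f) := by
    intro c hc f hf
    rw [← le_div_iff₀' hc]
    refine posPartOn_le hf fun g hg => ?_
    rw [le_div_iff₀' hc, ← smul_eq_mul, ← map_smul]
    exact le_posPartOn hC fun x =>
      ⟨mul_nonneg hc.le (hg x).1, mul_le_mul_of_nonneg_left (hg x).2 hc.le⟩
  rcases hc.eq_or_lt with rfl | hc
  · rw [zero_smul, zero_mul]
    refine le_antisymm (posPartOn_le (fun x => le_rfl) fun g hg => ?_)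
      (posPartOn_nonneg hC fun x => le_rfl)
    rw [show g = 0 from Cbru.ext_apply fun x => le_antisymm (hg x).2 (hg x).1, map_zero]
  · refine le_antisymm ?_ (hle hc hf)
    have h := hle (inv_pos.2 hc) (f := c • f) fun x => mul_nonneg hc.le (hf x)
    rw [smul_smul, inv_mul_cancel₀ hc.ne', one_smul] at h
    rwa [inv_mul_le_iff₀ hc] at h

/-- A bounded `H`-invariant functional with value `1` at `1` yields an `H`-invariant mean: the
normalized positive part. -/
theorem exists_mean_of_functional {H : Subgroup G} (h1 : m (oneCbru G) = 1)
    (hH : IsLeftInvariant H m) : ∃ M : Cbru G →ₗ[ℝ] ℝ, IsMean M ∧ IsLeftInvariant H M := by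
  set e := oneCbru G with he
  have he0 : ∀ x, 0 ≤ (e : G →ᵇ ℝ) x := fun x => zero_le_one
  set P := posPartOn m with hP
  have hPe : 1 ≤ P e := h1 ▸ le_posPartOn hC fun x => ⟨he0 x, le_rfl⟩
  have hsh : ∀ (f : Cbru G) (c : ℝ), ‖f‖ ≤ c → ∀ x, 0 ≤ ((f + c • e : Cbru G) : G →ᵇ ℝ) x := by
    intro f c hc x
    change 0 ≤ (f : G →ᵇ ℝ) x + c * 1
    linarith [(abs_le.1 (Cbru.abs_apply_le f x)).1]
  -- The extension of `P` to all functions: shift by a constant into the cone.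
  set M : Cbru G → ℝ := fun f => P (f + ‖f‖ • e) - ‖f‖ * P e with hM
  have hMc : ∀ (f : Cbru G) (c : ℝ), (∀ x, 0 ≤ ((f + c • e : Cbru G) : G →ᵇ ℝ) x) →
      M f = P (f + c • e) - c * P e := by
    have key : ∀ (f : Cbru G) (c d : ℝ), (∀ x, 0 ≤ ((f + c • e : Cbru G) : G →ᵇ ℝ) x) → c ≤ d →
        P (f + c • e) - c * P e = P (f + d • e) - d * P e := by
      intro f c d hc hcd
      have : f + d • e = (f + c • e) + (d - c) • e := by
        rw [add_assoc, ← add_smul]; simp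
      rw [this, hP, posPartOn_add hC hc fun x => mul_nonneg (sub_nonneg.2 hcd) (he0 x),
        posPartOn_smul hC (sub_nonneg.2 hcd) he0]
      ring
    intro f c hc
    rcases le_total ‖f‖ c with h | h
    · exact key f _ _ (hsh f _ le_rfl) h
    · exact (key f _ _ hc h).symm
  have hadd : ∀ f g, M (f + g) = M f + M g := by
    intro f g
    have e1 : f + g + (‖f‖ + ‖g‖) • e = (f + ‖f‖ • e) + (g + ‖g‖ • e) := by
      rw [add_smul]; abel
    have h1 := hsh f _ le_rfl
    have h2 := hsh g _ le_rfl
    rw [hMc (f + g) (‖f‖ + ‖g‖) (by rw [e1]; exact fun x => add_nonneg (h1 x) (h2 x)), e1, hP,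
      posPartOn_add hC h1 h2, hM]
    ring
  have hsmul : ∀ (c : ℝ), 0 ≤ c → ∀ f, M (c • f) = c * M f := by
    intro c hc f
    have e1 : c • f + (c * ‖f‖) • e = c • (f + ‖f‖ • e) := by rw [smul_add, smul_smul]
    have h1 := hsh f _ le_rfl
    rw [hMc (c • f) (c * ‖f‖) (by rw [e1]; exact fun x => mul_nonneg hc (h1 x)), e1, hP,
      posPartOn_smul hC hc h1, hM]
    ring
  have hneg : ∀ f, M (-f) = -M f := by
    intro f
    have h0 : M 0 = 0 := by simpa using hsmul 0 le_rfl 0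
    have := hadd f (-f)
    rw [show f + -f = 0 from add_neg_cancel f, h0] at this
    linarith
  have hnonneg : ∀ f : Cbru G, (∀ x, 0 ≤ (f : G →ᵇ ℝ) x) → M f = P f := by
    intro f hf
    rw [hMc f 0 (by simpa using hf)]
    simp
  let L : Cbru G →ₗ[ℝ] ℝ :=
    { toFun := fun f => (P e)⁻¹ * M f
      map_add' := fun f g => by rw [hadd, mul_add]
      map_smul' := fun c f => by
        rw [RingHom.id_apply, smul_eq_mul]
        rcases le_total 0 c with hc | hc
        · rw [hsmul c hc]; ring
        · rw [show c • f = -((-c) • f) from Cbru.ext_apply fun x => by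
            change c * (f : G →ᵇ ℝ) x = -(-c * (f : G →ᵇ ℝ) x)
            ring, hneg, hsmul (-c) (neg_nonneg.2 hc)]
          ring }
  refine ⟨L, ⟨fun f hf => ?_, ?_⟩, fun h hh f => ?_⟩
  · change 0 ≤ (P e)⁻¹ * M f
    rw [hnonneg f hf]
    exact mul_nonneg (inv_nonneg.2 (by linarith)) (posPartOn_nonneg hC hf)
  · change (P e)⁻¹ * M e = 1
    rw [hnonneg e he0, inv_mul_cancel₀ (by linarith)]
  · change (P e)⁻¹ * M (translateCbru h f) = (P e)⁻¹ * M f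
    congr 1
    have hle : ∀ h ∈ H, ∀ f : Cbru G, (∀ x, 0 ≤ (f : G →ᵇ ℝ) x) →
        P f ≤ P (translateCbru h f) := by
      intro h hh f hf
      refine posPartOn_le hf fun g hg => ?_
      rw [← hH h hh g]
      exact le_posPartOn hC fun x => hg _
    have hP' : ∀ f : Cbru G, (∀ x, 0 ≤ (f : G →ᵇ ℝ) x) → P (translateCbru h f) = P f := by
      intro f hf
      refine le_antisymm ?_ (hle h hh f hf)
      refine (hle h⁻¹ (H.inv_mem hh) (translateCbru h f) fun x => hf _).trans (le_of_eq ?_)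
      congr 1
      exact Cbru.ext_apply fun x => by simp [translateCbru_apply]
    rw [hMc (translateCbru h f) ‖f‖ fun x => hsh f _ le_rfl (h⁻¹ * x)]
    change P (translateCbru h (f + ‖f‖ • e)) - _ = _
    rw [hP' _ (hsh f _ le_rfl)]

end PosPart

theorem IsMean.monotone {m : Cbru G →ₗ[ℝ] ℝ} (hm : IsMean m) {f g : Cbru G}
    (h : ∀ x, (f : G →ᵇ ℝ) x ≤ (g : G →ᵇ ℝ) x) : m f ≤ m g := by
  have := hm.nonneg (g - f) fun x => sub_nonneg.2 (h x)
  rw [Cbru.map_sub] at this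
  linarith

theorem IsMean.le_of_le {m : Cbru G →ₗ[ℝ] ℝ} (hm : IsMean m) {f : Cbru G} {c : ℝ}
    (h : ∀ x, (f : G →ᵇ ℝ) x ≤ c) : m f ≤ c := by
  have := hm.monotone (f := f) (g := c • oneCbru G) fun x => by
    change _ ≤ c * 1
    simpa using h x
  simpa [hm.map_one] using this

theorem IsMean.abs_le {m : Cbru G →ₗ[ℝ] ℝ} (hm : IsMean m) (f : Cbru G) : |m f| ≤ ‖f‖ := by
  refine abs_le'.2 ⟨hm.le_of_le fun x => (le_abs_self _).trans (Cbru.abs_apply_le f x), ?_⟩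
  rw [← Cbru.map_neg]
  exact hm.le_of_le fun x => (neg_le_abs _).trans (Cbru.abs_apply_le f x)

end Functionals

/-! ### Relative amenability and invariant means -/

section FixedPoint

variable {G : Type u} [Group G] [TopologicalSpace G] [IsTopologicalGroup G]

theorem continuous_translateCbru (f : Cbru G) : Continuous fun g : G => translateCbru g f :=
  Continuous.subtype_mk f.2 _

theorem translateCbru_mul (g h : G) (f : Cbru G) :
    translateCbru (g * h) f = translateCbru g (translateCbru h f) :=
  Cbru.ext_apply fun x => by simp [translateCbru_apply, mul_assoc]

theorem translateCbru_one (f : Cbru G) : translateCbru 1 f = f :=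
  Cbru.ext_apply fun x => by simp [translateCbru_apply]

/-- The action of `G` by translations on the index set of `ℝ ^ Cbru G`. The lift in the universe
is there because relative amenability quantifies over the spaces in universe `max u v`. -/
def translatePerm (g : G) : Equiv.Perm (ULift.{v} (Cbru G)) where
  toFun f := ⟨translateCbru g⁻¹ f.down⟩
  invFun f := ⟨translateCbru g f.down⟩
  left_inv f := by
    refine ULift.ext _ _ ?_
    change translateCbru g (translateCbru g⁻¹ f.down) = f.down
    rw [← translateCbru_mul, mul_inv_cancel, translateCbru_one]
  right_inv f := by
    refine ULift.ext _ _ ?_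
    change translateCbru g⁻¹ (translateCbru g f.down) = f.down
    rw [← translateCbru_mul, inv_mul_cancel, translateCbru_one]

/-- The representation of `G` on the space of all functions `Cbru G → ℝ`. -/
def translateRep : G →* ((ULift.{v} (Cbru G) → ℝ) ≃ᵃ[ℝ] (ULift.{v} (Cbru G) → ℝ)) where
  toFun g := (LinearEquiv.funCongrLeft ℝ ℝ (translatePerm g)).toAffineEquiv
  map_one' := by
    ext F f
    change F ⟨translateCbru 1⁻¹ f.down⟩ = F f
    rw [inv_one, translateCbru_one]
  map_mul' g h := by
    ext F f
    change F ⟨translateCbru (g * h)⁻¹ f.down⟩ = F ⟨translateCbru h⁻¹ (translateCbru g⁻¹ f.down)⟩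
    rw [mul_inv_rev, translateCbru_mul]

theorem translateRep_apply (g : G) (F : ULift.{v} (Cbru G) → ℝ) (f : ULift.{v} (Cbru G)) :
    translateRep g F f = F ⟨translateCbru g⁻¹ f.down⟩ := rfl

variable (G) in
/-- The means, as a subset of the product space `ℝ ^ Cbru G`. -/
def meanSet : Set (ULift.{v} (Cbru G) → ℝ) :=
  {F | ∃ m : Cbru G →ₗ[ℝ] ℝ, IsMean m ∧ ∀ f, F f = m f.down}

theorem isClosed_meanSet : IsClosed (meanSet.{u, v} G) := by
  have : meanSet.{u, v} G =
      {F | ∀ a b : Cbru G, F ⟨a + b⟩ = F ⟨a⟩ + F ⟨b⟩} ∩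
      {F | ∀ (c : ℝ) (a : Cbru G), F ⟨c • a⟩ = c * F ⟨a⟩} ∩
      {F | ∀ f : Cbru G, (∀ x, 0 ≤ (f : G →ᵇ ℝ) x) → 0 ≤ F ⟨f⟩} ∩ {F | F ⟨oneCbru G⟩ = 1} := by
    ext F
    constructor
    · rintro ⟨m, hm, hF⟩
      refine ⟨⟨⟨fun a b => ?_, fun c a => ?_⟩, fun f hf => ?_⟩, ?_⟩
      · simp [hF]
      · simp [hF]
      · rw [hF]; exact hm.nonneg f hf
      · change F ⟨oneCbru G⟩ = 1
        rw [hF]; exact hm.map_one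
    · rintro ⟨⟨⟨h1, h2⟩, h3⟩, h4⟩
      exact ⟨⟨⟨fun f => F ⟨f⟩, h1⟩, h2⟩, ⟨h3, h4⟩, fun f => rfl⟩
  rw [this]
  refine IsClosed.inter (IsClosed.inter (IsClosed.inter ?_ ?_) ?_) ?_
  · simp only [Set.ofPred_forall]
    exact isClosed_iInter fun a => isClosed_iInter fun b =>
      isClosed_eq (by fun_prop) (by fun_prop)
  · simp only [Set.ofPred_forall]
    exact isClosed_iInter fun a => isClosed_iInter fun b =>
      isClosed_eq (by fun_prop) (by fun_prop)
  · simp only [Set.ofPred_forall]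
    exact isClosed_iInter fun a => isClosed_iInter fun b =>
      isClosed_le (by fun_prop) (by fun_prop)
  · exact isClosed_eq (by fun_prop) (by fun_prop)

/-- The means form a convex compact `G`-space in the topology of pointwise convergence. The action
is jointly continuous since `Cbru G` consists of continuous vectors and means have norm one. -/
theorem isConvexCompactGSpace_meanSet :
    IsConvexCompactGSpace (translateRep (G := G)) (meanSet.{u, v} G) where
  nonempty := by
    refine ⟨fun f => (f.down : G →ᵇ ℝ) 1, ⟨⟨fun f => (f : G →ᵇ ℝ) 1, fun a b => rfl⟩,
      fun c a => rfl⟩, ⟨fun f hf => hf 1, rfl⟩, fun f => rfl⟩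
  convex := by
    rintro _ ⟨m, hm, hF⟩ _ ⟨n, hn, hF'⟩ a b ha hb hab
    refine ⟨a • m + b • n, ⟨fun f hf => ?_, ?_⟩, fun f => ?_⟩
    · exact add_nonneg (mul_nonneg ha (hm.nonneg f hf)) (mul_nonneg hb (hn.nonneg f hf))
    · simp [hm.map_one, hn.map_one, hab]
    · simp [hF, hF']
  isCompact := by
    refine (isCompact_univ_pi fun f : ULift.{v} (Cbru G) =>
      isCompact_Icc (a := -‖f.down‖) (b := ‖f.down‖)).of_isClosed_subset isClosed_meanSet ?_
    rintro F ⟨m, hm, hF⟩ f -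
    rw [hF]
    exact abs_le.1 (hm.abs_le f.down)
  mapsTo := by
    rintro g F ⟨m, hm, hF⟩
    refine ⟨⟨⟨fun f => m (translateCbru g⁻¹ f),
      fun a b => m.map_add (translateCbru g⁻¹ a) (translateCbru g⁻¹ b)⟩,
      fun c a => m.map_smul c (translateCbru g⁻¹ a)⟩,
      ⟨fun f hf => hm.nonneg _ fun x => hf _, hm.map_one⟩,
      fun f => hF _⟩
  continuousOn := by
    refine continuousOn_pi.2 fun f => ?_
    rintro ⟨g₀, F₀⟩ -
    refine tendsto_iff_dist_tendsto_zero.2 ?_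
    have h1 : Tendsto (fun p : G × (ULift.{v} (Cbru G) → ℝ) =>
        dist (translateCbru p.1⁻¹ f.down) (translateCbru g₀⁻¹ f.down) +
          |p.2 ⟨translateCbru g₀⁻¹ f.down⟩ - F₀ ⟨translateCbru g₀⁻¹ f.down⟩|)
        (𝓝 (g₀, F₀)) (𝓝 0) := by
      have hc : Continuous fun p : G × (ULift.{v} (Cbru G) → ℝ) =>
          dist (translateCbru p.1⁻¹ f.down) (translateCbru g₀⁻¹ f.down) +
          |p.2 ⟨translateCbru g₀⁻¹ f.down⟩ - F₀ ⟨translateCbru g₀⁻¹ f.down⟩| := by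
        have h := (continuous_translateCbru f.down).comp
          (continuous_fst (X := G) (Y := ULift.{v} (Cbru G) → ℝ)).inv
        exact (h.dist continuous_const).add (by fun_prop)
      have := hc.tendsto (g₀, F₀)
      simpa using this
    refine squeeze_zero' (Eventually.of_forall fun _ => dist_nonneg) ?_
      (h1.mono_left nhdsWithin_le_nhds)
    filter_upwards [self_mem_nhdsWithin] with p hp
    obtain ⟨m, hm, hF⟩ := hp.2
    rw [Real.dist_eq, translateRep_apply, translateRep_apply]
    refine (abs_sub_le _ (p.2 ⟨translateCbru g₀⁻¹ f.down⟩) _).trans (add_le_add_left ?_ _)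
    rw [hF, hF, ← Cbru.map_sub]
    exact (hm.abs_le _).trans (dist_eq_norm (translateCbru p.1⁻¹ f.down) _).ge

theorem exists_mean_of_relativelyAmenable {H : Subgroup G}
    (h : RelativelyAmenable.{u, v} G H) :
    ∃ m : Cbru G →ₗ[ℝ] ℝ, IsMean m ∧ IsLeftInvariant H m := by
  obtain ⟨F, ⟨m, hm, hF⟩, hfix⟩ := h _ translateRep (meanSet.{u, v} G) isConvexCompactGSpace_meanSet
  refine ⟨m, hm, fun k hk f => ?_⟩
  have := congr_fun (hfix k⁻¹ (H.inv_mem hk)) ⟨f⟩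
  rw [translateRep_apply, hF, hF, inv_inv] at this
  exact this

section Barycenter

variable {E : Type v} [AddCommGroup E] [Module ℝ E] [TopologicalSpace E]
  {ρ : G →* (E ≃ᵃ[ℝ] E)} {K : Set E} (hK : IsConvexCompactGSpace ρ K)

include hK

theorem IsConvexCompactGSpace.continuous_comp {a : E → ℝ} (ha : ContinuousOn a K) :
    Continuous fun p : G × K => a (ρ p.1 p.2) := by
  have h : Continuous fun p : G × K => ρ p.1 (p.2 : E) :=
    hK.continuousOn.comp_continuous (f := fun p : G × K => (p.1, (p.2 : E))) (by fun_prop)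
      fun p => ⟨trivial, p.2.2⟩
  exact ha.comp_continuous h fun p => hK.mapsTo p.1 p.2.2

/-- The function `g ↦ a (g x₀)` on `G` given by a function `a` that is continuous on `K`. -/
theorem IsConvexCompactGSpace.exists_orbitFun {a : E → ℝ} (ha : ContinuousOn a K) {x₀ : E}
    (hx₀ : x₀ ∈ K) : ∃ f : Cbru G, ∀ g, (f : G →ᵇ ℝ) g = a (ρ g x₀) := by
  have : CompactSpace K := isCompact_iff_compactSpace.1 hK.isCompact
  have hac := hK.continuous_comp ha
  let A : C(K, ℝ) := ⟨fun x => a x, ha.domRestrict⟩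
  have horb : Continuous fun g : G => (⟨ρ g x₀, hK.mapsTo g hx₀⟩ : K) := by
    refine Continuous.subtype_mk ?_ _
    exact hK.continuousOn.comp_continuous (f := fun g : G => (g, x₀)) (by fun_prop)
      fun p => ⟨trivial, hx₀⟩
  let o : C(G, K) := ⟨_, horb⟩
  let Φ : C(G, C(K, ℝ)) := ContinuousMap.curry ⟨fun p : G × K => a (ρ p.1⁻¹ p.2),
    hac.comp (f := fun p : G × K => (p.1⁻¹, p.2)) (by fun_prop)⟩
  refine ⟨⟨(BoundedContinuousFunction.mkOfCompact A).compContinuous o, ?_⟩, fun g => rfl⟩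
  have h2 : Continuous fun k : G =>
      (BoundedContinuousFunction.mkOfCompact (Φ k)).compContinuous o :=
    (BoundedContinuousFunction.continuous_compContinuous o).comp
      ((ContinuousMap.isometryEquivBoundedOfCompact K ℝ).continuous.comp Φ.continuous)
  refine h2.congr fun k => ?_
  ext g
  change a (ρ k⁻¹ (ρ g x₀)) = a (ρ (k⁻¹ * g) x₀)
  rw [map_mul]
  rfl

/-- A mean `m` on `Cbru G` has a barycenter in `K` with respect to the orbit map of `x₀`, for all
affine functions that are continuous on `K`. These need not be continuous on the whole space, which
matters because the affine maps `ρ g` are only assumed to be continuous on `K`. -/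
theorem IsConvexCompactGSpace.exists_barycenter [T2Space E] {m : Cbru G →ₗ[ℝ] ℝ} (hm : IsMean m)
    {x₀ : E} (hx₀ : x₀ ∈ K) :
    ∃ x ∈ K, ∀ a : E →ᵃ[ℝ] ℝ, ContinuousOn a K → ∀ f : Cbru G,
      (∀ g, (f : G →ᵇ ℝ) g = a (ρ g x₀)) → a x = m f := by
  have hex : ∀ a : {a : E →ᵃ[ℝ] ℝ // ContinuousOn a K}, ∃ f : Cbru G,
      ∀ g, (f : G →ᵇ ℝ) g = a.1 (ρ g x₀) := fun a => hK.exists_orbitFun a.2 hx₀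
  choose F hF using hex
  obtain ⟨x, hxK, hx⟩ : (K ∩ ⋂ a : {a : E →ᵃ[ℝ] ℝ // ContinuousOn a K},
      (K ∩ a.1 ⁻¹' {m (F a)})).Nonempty := by
    refine hK.isCompact.inter_iInter_nonempty _
      (fun a => a.2.preimage_isClosed_of_isClosed hK.isCompact.isClosed isClosed_singleton) ?_
    classical
    intro s
    let L : E →ᵃ[ℝ] (s → ℝ) := AffineMap.pi fun a => a.1.1
    by_cases hmem : (fun a : s => m (F a.1)) ∈ L '' K
    · obtain ⟨x, hxK, hx⟩ := hmem
      exact ⟨x, hxK, Set.mem_iInter₂.2 fun a ha => ⟨hxK, congr_fun hx ⟨a, ha⟩⟩⟩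
    · exfalso
      have hLK : IsCompact (L '' K) :=
        hK.isCompact.image_of_continuousOn (continuousOn_pi.2 fun a => a.1.2)
      obtain ⟨c, u, hcu, hu⟩ := geometric_hahn_banach_point_closed (hK.convex.affine_image L)
        hLK.isClosed hmem
      have hc : ∀ v : s → ℝ, c v = ∑ a, v a * c (fun b => if a = b then 1 else 0) := fun v => by
        simpa using LinearMap.pi_apply_eq_sum_univ (c : (s → ℝ) →ₗ[ℝ] ℝ) v
      have h1 : m (u • oneCbru G) ≤
          m (∑ a : s, c (fun b => if a = b then 1 else 0) • F a.1) := by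
        refine hm.monotone fun g => ?_
        have := hu (L (ρ g x₀)) ⟨_, hK.mapsTo g hx₀, rfl⟩
        rw [hc] at this
        have e1 : ((∑ a : s, c (fun b => if a = b then 1 else 0) • F a.1 : Cbru G) : G →ᵇ ℝ) g =
            ∑ a : s, c (fun b => if a = b then 1 else 0) * (F a.1 : G →ᵇ ℝ) g := by
          rw [Submodule.coe_sum, BoundedContinuousFunction.coe_sum, Finset.sum_apply]
          rfl
        rw [e1]
        change u * 1 ≤ _
        rw [mul_one]
        refine this.le.trans (le_of_eq (Finset.sum_congr rfl fun a _ => ?_))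
        rw [hF, mul_comm]
        rfl
      rw [map_sum, map_smul, hm.map_one, smul_eq_mul, mul_one] at h1
      rw [hc] at hcu
      refine absurd (hcu.trans_le h1) (not_lt.2 (le_of_eq (Finset.sum_congr rfl fun a _ => ?_)))
      rw [map_smul, smul_eq_mul, mul_comm]
  refine ⟨x, hxK, fun a ha f hf => ?_⟩
  have hfF : f = F ⟨a, ha⟩ := Cbru.ext_apply fun g => by rw [hf, hF]
  rw [hfF]
  exact (Set.mem_iInter.1 hx ⟨a, ha⟩).2

end Barycenter

/-- The barycenter of an orbit with respect to an `H`-invariant mean is fixed by `H`. -/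
theorem relativelyAmenable_of_exists_mean {H : Subgroup G}
    (h : ∃ m : Cbru G →ₗ[ℝ] ℝ, IsMean m ∧ IsLeftInvariant H m) :
    RelativelyAmenable.{u, v} G H := by
  obtain ⟨m, hm, hinv⟩ := h
  intro E _ _ _ _ _ _ _ ρ K hK
  obtain ⟨x₀, hx₀⟩ := hK.nonempty
  obtain ⟨x, hxK, hx⟩ := hK.exists_barycenter hm hx₀
  refine ⟨x, hxK, fun k hk => ?_⟩
  by_contra hne
  obtain ⟨l, hl⟩ := geometric_hahn_banach_point_point hne
  have hlK : ContinuousOn (l.toLinearMap.toAffineMap : E →ᵃ[ℝ] ℝ) K := l.continuous.continuousOn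
  have hlk : ContinuousOn (l.toLinearMap.toAffineMap.comp (ρ k : E →ᵃ[ℝ] E)) K := by
    rw [continuousOn_iff_continuous_domRestrict]
    exact (hK.continuous_comp hlK).comp (f := fun y : K => (k, y)) (by fun_prop)
  obtain ⟨f, hf⟩ := hK.exists_orbitFun hlK hx₀
  have h1 := hx _ hlK f hf
  have h2 := hx _ hlk (translateCbru k⁻¹ f) fun g => by
    rw [translateCbru_apply, hf, inv_inv, map_mul]
    rfl
  rw [hinv k⁻¹ (H.inv_mem hk), ← h1] at h2
  exact absurd h2 hl.ne

end FixedPoint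

/-! ### The pairing of `L¹(G)` with `L^∞` -/

section Pairing

variable {G : Type u} [Group G] [TopologicalSpace G] [IsTopologicalGroup G]
  [LocallyCompactSpace G] [T2Space G] [MeasurableSpace G] [BorelSpace G]
  {μ : Measure G} [μ.IsHaarMeasure] [μ.Regular]

section GSpace

variable {X : Type w} [MulAction G X] {x₀ : X}

theorem BoundedMeasurable.measurable_inv_smul_base (f : BoundedMeasurable (G := G) x₀) :
    Measurable fun y : G => f.1 (y⁻¹ • x₀) := by
  simpa using BoundedMeasurable.measurable_inv_smul f 1

/-- The pairing `(φ, f) ↦ ∫ φ(y) f(y⁻¹ x₀) dy`, that is, the value of `φ * f` at the base point. -/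
def BoundedMeasurable.pair : BoundedMeasurable (G := G) x₀ →ₗ[ℝ] (LOne μ →L[ℝ] ℝ) where
  toFun f := dualOf (BoundedMeasurable.measurable_inv_smul_base f)
    fun _ => BoundedMeasurable.abs_le f _
  map_add' a b := by
    ext φ
    change ∫ y, φ y * (a.1 (y⁻¹ • x₀) + b.1 (y⁻¹ • x₀)) ∂μ =
      ∫ y, φ y * a.1 (y⁻¹ • x₀) ∂μ + ∫ y, φ y * b.1 (y⁻¹ • x₀) ∂μ
    have h := fun f : BoundedMeasurable (G := G) x₀ => BoundedMeasurable.integrable_conv φ f 1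
    simp only [one_smul] at h
    rw [← integral_add (h a) (h b)]
    simp only [mul_add]
  map_smul' c a := by
    ext φ
    change ∫ y, φ y * (c * a.1 (y⁻¹ • x₀)) ∂μ = c * ∫ y, φ y * a.1 (y⁻¹ • x₀) ∂μ
    rw [← integral_const_mul]
    simp only [mul_left_comm]

theorem BoundedMeasurable.pair_apply (f : BoundedMeasurable (G := G) x₀) (φ : LOne μ) :
    BoundedMeasurable.pair f φ = ∫ y, φ y * f.1 (y⁻¹ • x₀) ∂μ := rfl

theorem BoundedMeasurable.pair_eq_zero_iff (f : BoundedMeasurable (G := G) x₀) :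
    BoundedMeasurable.pair (μ := μ) f = 0 ↔ f ∈ LocallyNullFun x₀ μ := by
  have hm : Measurable fun y : G => f.1 (y • x₀) := f.2
  constructor
  · intro h
    have hS : MeasurableSet {y : G | f.1 (y⁻¹ • x₀) ≠ 0} :=
      (BoundedMeasurable.measurable_inv_smul_base f) (measurableSet_singleton 0).compl
    have hl : LocallyNull μ {y : G | f.1 (y⁻¹ • x₀) ≠ 0} := by
      intro K hK
      -- Test against `f(y⁻¹ x₀)` on the compact set `K`.
      have hi : Integrable (K.indicator fun y => f.1 (y⁻¹ • x₀)) μ := by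
        refine (integrable_indicator_iff hK.measurableSet).2 ?_
        refine Measure.integrableOn_of_bounded (M := ‖f‖) hK.measure_lt_top.ne
          (BoundedMeasurable.measurable_inv_smul_base f).aestronglyMeasurable
          (ae_of_all _ fun _ => BoundedMeasurable.abs_le f _)
      have h0 : ∫ y, K.indicator (fun y => f.1 (y⁻¹ • x₀) ^ 2) y ∂μ = 0 := by
        have := DFunLike.congr_fun h (hi.toL1 _)
        rw [BoundedMeasurable.pair_apply] at this
        refine Eq.trans (integral_congr_ae ?_) this
        filter_upwards [hi.coeFn_toL1] with y hy
        rw [hy]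
        by_cases hyK : y ∈ K <;> simp [hyK, sq]
      rw [integral_eq_zero_iff_of_nonneg (fun y => Set.indicator_nonneg (fun _ _ => sq_nonneg _) y)]
        at h0
      · refine measure_mono_null ?_ h0
        rintro y ⟨hy, hyK⟩ h1
        have h2 : K.indicator (fun y => f.1 (y⁻¹ • x₀) ^ 2) y = 0 := h1
        rw [Set.indicator_of_mem hyK] at h2
        exact hy (pow_eq_zero_iff two_ne_zero |>.1 h2)
      · refine (integrable_indicator_iff hK.measurableSet).2 ?_
        refine Measure.integrableOn_of_bounded (M := ‖f‖ ^ 2) hK.measure_lt_top.ne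
          ((BoundedMeasurable.measurable_inv_smul_base f).pow_const 2).aestronglyMeasurable
          (ae_of_all _ fun _ => ?_)
        rw [norm_pow]
        exact pow_le_pow_left₀ (norm_nonneg _) (BoundedMeasurable.abs_le f _) 2
    have := hl.inv hS
    intro K hK
    convert this K hK using 4
    ext y
    simp
  · intro hf
    have hfn : LocallyNull μ {g : G | f.1 (g • x₀) ≠ 0} := hf
    have hms : MeasurableSet {g : G | f.1 (g • x₀) ≠ 0} := hm (measurableSet_singleton 0).compl
    ext φ
    rw [BoundedMeasurable.pair_apply]
    refine integral_eq_zero_of_ae ?_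
    filter_upwards [(hfn.inv hms).ae_eq_zero hms.inv φ] with y hy
    by_cases h : f.1 (y⁻¹ • x₀) = 0
    · simp [h]
    · simp [hy h]

/-- The pairing of `L¹(G)` with `L^∞`, as a map from `L^∞` to the dual of `L¹(G)`. -/
def LInfty.pair : LInfty x₀ μ →ₗ[ℝ] (LOne μ →L[ℝ] ℝ) :=
  (LocallyNullFun x₀ μ).liftQ BoundedMeasurable.pair
    fun f hf => (BoundedMeasurable.pair_eq_zero_iff f).2 hf

theorem LInfty.pair_mk (f : BoundedMeasurable (G := G) x₀) (φ : LOne μ) :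
    LInfty.pair (Submodule.Quotient.mk f : LInfty x₀ μ) φ = ∫ y, φ y * f.1 (y⁻¹ • x₀) ∂μ := rfl

theorem LInfty.pair_injective : Function.Injective (LInfty.pair : LInfty x₀ μ → _) := by
  refine (injective_iff_map_eq_zero _).2 fun F hF => ?_
  obtain ⟨f, rfl⟩ := Submodule.Quotient.mk_surjective _ F
  exact (Submodule.Quotient.mk_eq_zero _).2 ((BoundedMeasurable.pair_eq_zero_iff f).1 hF)

theorem LInfty.abs_pair_le (F : LInfty x₀ μ) (φ : LOne μ) : |LInfty.pair F φ| ≤ ‖F‖ * ‖φ‖ := by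
  refine le_of_forall_pos_le_add fun ε hε => ?_
  obtain ⟨f, rfl, hf⟩ := Submodule.Quotient.norm_mk_lt F
    (ε := ε / (‖φ‖ + 1)) (by positivity)
  refine (BoundedMeasurable.abs_integral_le φ f x₀).trans ?_
  rw [mul_comm]
  refine (mul_le_mul_of_nonneg_right hf.le (norm_nonneg φ)).trans ?_
  rw [add_mul]
  refine add_le_add le_rfl ?_
  rw [div_mul_eq_mul_div, div_le_iff₀ (by positivity)]
  nlinarith [norm_nonneg φ]

theorem LInfty.pair_translate (g : G) (F : LInfty x₀ μ) (φ : LOne μ) :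
    LInfty.pair (LInfty.translate x₀ μ g F) φ = LInfty.pair F (rightTranslate μ g φ) := by
  obtain ⟨f, rfl⟩ := Submodule.Quotient.mk_surjective _ F
  rw [LInfty.pair_mk, integral_rightTranslate_mul]
  change ∫ y, φ y * f.1 (g⁻¹ • y⁻¹ • x₀) ∂μ = _
  simp only [mul_inv_rev, mul_smul]

/-- The pairing is invariant under translation of the `L¹`-function by the stabilizer of the base
point. -/
theorem LInfty.pair_translateLOne {h : G} (hh : h • x₀ = x₀) (F : LInfty x₀ μ) (φ : LOne μ) :
    LInfty.pair F (translateLOne μ h φ) = LInfty.pair F φ := by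
  obtain ⟨f, rfl⟩ := Submodule.Quotient.mk_surjective _ F
  rw [LInfty.pair_mk, LInfty.pair_mk,
    integral_translateLOne_mul h φ fun y => f.1 (y⁻¹ • x₀)]
  have : h⁻¹ • x₀ = x₀ := by rw [inv_smul_eq_iff, hh]
  simp only [mul_inv_rev, mul_smul, this]

theorem LInfty.pair_one (φ : LOne μ) : LInfty.pair (LInfty.one x₀ μ) φ = ∫ y, φ y ∂μ := by
  change ∫ y, φ y * 1 ∂μ = _
  simp only [mul_one]

variable [MulAction.IsPretransitive G X]

theorem LInfty.pair_conv (ψ : LOne μ) (F : LInfty x₀ μ) (φ : LOne μ) :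
    LInfty.pair (LInfty.conv ψ F) φ = LInfty.pair F (RelAmen.conv μ φ ψ) := by
  obtain ⟨f, rfl⟩ := Submodule.Quotient.mk_surjective _ F
  rw [map_conv]
  change ∫ y, φ y * ∫ z, ψ z * f.1 (z⁻¹ • y⁻¹ • x₀) ∂μ ∂μ = _
  congr 1 with y
  rw [LInfty.pair_mk, integral_translateLOne_mul, smul_eq_mul]
  simp only [mul_inv_rev, mul_smul]

theorem LInfty.ext_conv {F F' : LInfty x₀ μ} (h : ∀ ψ, LInfty.conv ψ F = LInfty.conv ψ F') :
    F = F' := by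
  refine LInfty.pair_injective (ContinuousLinearMap.ext fun φ => ?_)
  have e : ∀ F : LInfty x₀ μ, Tendsto (fun w => LInfty.pair (LInfty.conv (toLOne μ w) F) φ)
      (bumpFilter μ 1) (𝓝 (LInfty.pair F φ)) := fun F => by
    simp only [LInfty.pair_conv]
    exact ((LInfty.pair F).continuous.tendsto φ).comp (tendsto_conv_right φ)
  refine tendsto_nhds_unique (e F) ?_
  simp only [h]
  exact e F'

theorem rightTranslate_conv (g : G) (φ ψ : LOne μ) :
    rightTranslate μ g (conv μ φ ψ) = conv μ φ (rightTranslate μ g ψ) := by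
  rw [map_conv]
  simp only [rightTranslate_translateLOne]
  rfl

theorem LInfty.conv_translate (g : G) (ψ : LOne μ) (F : LInfty x₀ μ) :
    LInfty.conv ψ (LInfty.translate x₀ μ g F) = LInfty.conv (rightTranslate μ g ψ) F := by
  refine LInfty.pair_injective (ContinuousLinearMap.ext fun φ => ?_)
  rw [LInfty.pair_conv, LInfty.pair_translate, rightTranslate_conv, LInfty.pair_conv]

end GSpace

variable {H : Subgroup G}

theorem IsLOneEquivariant.isEquivariant {α : LInftyGroup μ →L[ℝ] LInftyQuotient μ H}
    (hα : IsLOneEquivariant α) : IsEquivariant α := by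
  intro g F
  refine LInfty.ext_conv fun ψ => ?_
  rw [← hα, LInfty.conv_translate, LInfty.conv_translate, hα]

/-! ### From equivariant maps to invariant means -/

variable (μ) in
/-- The class of a right uniformly continuous function in `L^∞(G)`. -/
def Cbru.toLInfty : Cbru G →ₗ[ℝ] LInftyGroup μ :=
  (LocallyNullFun (1 : G) μ).mkQ ∘ₗ
    { toFun := fun f => BoundedMeasurable.of (1 : G) (f : G →ᵇ ℝ) ‖f‖ (Cbru.abs_apply_le f) (by
        have := (f : G →ᵇ ℝ).continuous.measurable
        simpa using this)
      map_add' := fun a b => rfl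
      map_smul' := fun c a => rfl }

theorem Cbru.norm_toLInfty_le (f : Cbru G) : ‖Cbru.toLInfty μ f‖ ≤ ‖f‖ := by
  refine (Submodule.Quotient.norm_mk_le _ _).trans ?_
  exact lp.norm_le_of_forall_le (norm_nonneg f) fun x => Cbru.abs_apply_le f x

theorem Cbru.translate_toLInfty (g : G) (f : Cbru G) :
    LInfty.translate _ μ g (Cbru.toLInfty μ f) = Cbru.toLInfty μ (translateCbru g f) := rfl

theorem Cbru.toLInfty_one : Cbru.toLInfty μ (oneCbru G) = LInfty.one _ μ := rfl

theorem norm_translateCbru_le (g : G) (f : Cbru G) : ‖translateCbru g f‖ ≤ ‖f‖ :=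
  ((translateCbru g f : Cbru G) : G →ᵇ ℝ).norm_le (norm_nonneg f) |>.2 fun x =>
    Cbru.abs_apply_le f (g⁻¹ * x)

theorem exists_bound_of_continuous {E F : Type*} [SeminormedAddCommGroup E] [NormedSpace ℝ E]
    [SeminormedAddCommGroup F] [NormedSpace ℝ F] (T : E → F)
    (hadd : ∀ x y, T (x + y) = T x + T y) (hsmul : ∀ (c : ℝ) x, T (c • x) = c • T x)
    (hT : Continuous T) : ∃ C : ℝ, 0 ≤ C ∧ ∀ x, ‖T x‖ ≤ C * ‖x‖ :=
  ⟨_, norm_nonneg _, (⟨⟨⟨T, hadd⟩, hsmul⟩, hT⟩ : E →L[ℝ] F).le_opNorm⟩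

theorem continuous_of_bound {E F : Type*} [SeminormedAddCommGroup E] [NormedSpace ℝ E]
    [SeminormedAddCommGroup F] [NormedSpace ℝ F] (T : E → F)
    (hadd : ∀ x y, T (x + y) = T x + T y) (hsmul : ∀ (c : ℝ) x, T (c • x) = c • T x)
    (C : ℝ) (hT : ∀ x, ‖T x‖ ≤ C * ‖x‖) : Continuous T :=
  (LinearMap.mkContinuous (⟨⟨T, hadd⟩, hsmul⟩ : E →ₗ[ℝ] F) C hT).continuous

/-- An equivariant unital map `P` from `Cbru G` to the left `H`-invariant functionals on `L¹(G)`
yields a bounded invariant functional on `Cbru G` with value `1` at `1`: a limit of the functionals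
`f ↦ P f w`, for probability densities `w` concentrating at `1`. For `h ∈ H` and
`u` concentrated near `1`, the number `P f (w * h u)` is close to `P (h f) w` uniformly in `w`,
since `f` is a continuous vector, and it tends to `P f (h u) = P f u`, which does not depend on `h`. -/
theorem exists_mean_of_equivariant_cbru (P : Cbru G →ₗ[ℝ] (LOne μ →L[ℝ] ℝ)) {A : ℝ} (hA0 : 0 ≤ A)
    (hA : ∀ f φ, |P f φ| ≤ A * ‖f‖ * ‖φ‖)
    (hP : ∀ g f φ, P (translateCbru g f) φ = P f (rightTranslate μ g φ))
    (hPH : ∀ h ∈ H, ∀ f φ, P f (translateLOne μ h φ) = P f φ)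
    (hP1 : ∀ φ, P (oneCbru G) φ = ∫ x, φ x ∂μ) :
    ∃ m : Cbru G →ₗ[ℝ] ℝ, IsMean m ∧ IsLeftInvariant H m := by
  let m : C_c(G, ℝ) → Cbru G →ₗ[ℝ] ℝ := fun w =>
    { toFun := fun f => P f (toLOne μ w)
      map_add' := fun a b => by rw [map_add]; rfl
      map_smul' := fun c a => by rw [map_smul]; rfl }
  have hm : ∀ w f, m w f = P f (toLOne μ w) := fun _ _ => rfl
  have hb : ∀ w, IsBump μ Set.univ w → ∀ f, |m w f| ≤ A * ‖f‖ := by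
    intro w hw f
    refine (hA f _).trans ?_
    rw [hw.norm_toLOne, mul_one]
  have hb' : ∀ᶠ w in bumpFilter μ (1 : G), ∀ f, |m w f| ≤ A * ‖f‖ := by
    filter_upwards [eventually_isBump univ_mem] with w hw using hb w hw
  obtain ⟨U, M, hU, hMb, hM⟩ : ∃ (U : Ultrafilter C_c(G, ℝ)) (M : Cbru G →ₗ[ℝ] ℝ),
      ↑U ≤ bumpFilter μ (1 : G) ∧ (∀ f, |M f| ≤ A * ‖f‖) ∧
        ∀ f, Tendsto (fun i => m i f) U (𝓝 (M f)) :=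
    exists_ultralimit (V := Cbru G) (bumpFilter μ (1 : G)) m A hb'
  have hM1 : M (oneCbru G) = 1 := by
    refine tendsto_nhds_unique (hM _) (tendsto_const_nhds.congr' ?_)
    filter_upwards [hU (eventually_isBump univ_mem)] with w hw
    rw [hm, hP1, ← hw.integral_eq]
    exact (integral_congr_ae (coeFn_toLOne w)).symm
  refine exists_mean_of_functional hMb hM1 fun h hh f => ?_
  -- Both `M f` and `M (h f)` are close to `P f u` for `u` concentrated near `1`.
  have key : ∀ ε > 0, ∀ u, IsBump μ {y | A * dist (translateCbru y f) f < ε} u → ∀ k ∈ H,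
      |P f (toLOne μ u) - M (translateCbru k f)| ≤ ε := by
    intro ε hε u hu k hk
    have hlim : Tendsto (fun w => P f (conv μ (toLOne μ w)
        (translateLOne μ k (toLOne μ u))) - m w (translateCbru k f)) U
        (𝓝 (P f (toLOne μ u) - M (translateCbru k f))) := by
      refine Tendsto.sub ?_ (hM _)
      rw [← hPH k hk f (toLOne μ u)]
      exact (((P f).continuous.tendsto _).comp (tendsto_conv_left _)).mono_left hU
    refine le_of_tendsto hlim.abs ?_
    filter_upwards [hU (eventually_isBump univ_mem)] with w hw
    have hFy : ∀ y, P f (rightTranslate μ y (toLOne μ w)) = m w (translateCbru y f) := by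
      intro y
      rw [hm, hP]
    rw [map_conv_right]
    simp only [hFy, smul_eq_mul]
    rw [integral_translateLOne_mul k (toLOne μ u) fun y => m w (translateCbru y f)]
    refine hu.norm_integral_sub_le (k := fun y => m w (translateCbru (k * y) f)) ?_ fun y hy => ?_
    · simp only [← hFy]
      exact (P f).continuous.comp
        ((continuous_rightTranslate _).comp (continuous_const_mul k))
    · rw [← Cbru.map_sub, translateCbru_mul]
      refine (hb w hw _).trans (le_trans ?_ (le_of_lt hy))
      refine mul_le_mul_of_nonneg_left ?_ hA0
      refine (norm_translateCbru_le k (translateCbru y f - f)).trans ?_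
      exact (dist_eq_norm (translateCbru y f) f).ge
  refine sub_eq_zero.1 (abs_eq_zero.1 (le_antisymm (le_of_forall_pos_le_add fun ε hε => ?_)
    (abs_nonneg _)))
  have hnhds : {y | A * dist (translateCbru y f) f < ε / 2} ∈ 𝓝 (1 : G) := by
    have hc : Continuous fun y : G => A * dist (translateCbru y f) f :=
      continuous_const.mul ((continuous_translateCbru f).dist continuous_const)
    refine hc.continuousAt.eventually_lt_const ?_
    change A * dist (translateCbru 1 f) f < ε / 2
    rw [translateCbru_one, dist_self, mul_zero]
    exact half_pos hε
  obtain ⟨u, hu⟩ := exists_isBump (μ := μ) hnhds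
  have h1 := key _ (half_pos hε) u hu h hh
  have h2 := key _ (half_pos hε) u hu 1 H.one_mem
  rw [translateCbru_one] at h2
  rw [abs_le] at h1 h2 ⊢
  constructor <;> linarith

theorem exists_mean_of_equivariant {α : LInftyGroup μ →L[ℝ] LInftyQuotient μ H}
    (hα : IsEquivariant α) (hα1 : IsUnital α) :
    ∃ m : Cbru G →ₗ[ℝ] ℝ, IsMean m ∧ IsLeftInvariant H m := by
  obtain ⟨A, hA0, hA⟩ : ∃ C : ℝ, 0 ≤ C ∧ ∀ F, ‖α F‖ ≤ C * ‖F‖ :=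
    exists_bound_of_continuous (fun F => α F) (map_add α) (map_smul α) α.continuous
  have hH : ∀ h ∈ H, h • ((1 : G) : G ⧸ H) = ((1 : G) : G ⧸ H) := by
    intro h hh
    change ((h * 1 : G) : G ⧸ H) = _
    rw [QuotientGroup.eq]
    simpa using hh
  let P : Cbru G → LOne μ →L[ℝ] ℝ := fun f => LInfty.pair (α (Cbru.toLInfty μ f))
  have hP : ∀ f, P f = LInfty.pair (α (Cbru.toLInfty μ f)) := fun _ => rfl
  refine exists_mean_of_equivariant_cbru
    { toFun := P
      map_add' := fun a b => by rw [hP, map_add, map_add, map_add]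
      map_smul' := fun c a => by rw [hP, map_smul, map_smul, map_smul, RingHom.id_apply] }
    hA0 (fun f φ => ?_) (fun g f φ => ?_) (fun h hh f φ => ?_) (fun φ => ?_)
  · refine (LInfty.abs_pair_le _ φ).trans (mul_le_mul_of_nonneg_right ?_ (norm_nonneg φ))
    exact (hA _).trans (mul_le_mul_of_nonneg_left (Cbru.norm_toLInfty_le f) hA0)
  · change P (translateCbru g f) φ = P f (rightTranslate μ g φ)
    rw [hP, hP, ← LInfty.pair_translate, ← hα, Cbru.translate_toLInfty]
  · exact LInfty.pair_translateLOne (hH h hh) _ φ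
  · change P (oneCbru G) φ = _
    rw [hP, Cbru.toLInfty_one, hα1, LInfty.pair_one]

end Pairing

/-! ### Almost everywhere limits of weakly convergent nets -/

section WeakLimits

variable {Ω : Type*} [MeasurableSpace Ω] {τ : Measure Ω} [IsFiniteMeasure τ]

/-- If a net in a convex set of uniformly bounded functions converges weakly in `L²` of a finite
measure, then some sequence in this set converges almost everywhere, to a function that
represents the weak limit: by Riesz there is an `L²`-function `F` representing the limit, and by
Hahn-Banach `F` is a norm limit of members of the convex set. -/
theorem exists_seq_ae_tendsto_of_weak {ι : Type*} {D : Set (Ω → ℝ)} (hD : Convex ℝ D) {C : ℝ}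
    (hm : ∀ f ∈ D, AEStronglyMeasurable f τ) (hC : ∀ f ∈ D, ∀ x, |f x| ≤ C)
    {l : Filter ι} [l.NeBot] {f : ι → Ω → ℝ} (hf : ∀ᶠ i in l, f i ∈ D) (Φ : Lp ℝ 2 τ →L[ℝ] ℝ)
    (hΦ : ∀ ψ : Lp ℝ 2 τ, Tendsto (fun i => ∫ x, ψ x * f i x ∂τ) l (𝓝 (Φ ψ))) :
    ∃ (F : Ω → ℝ) (u : ℕ → Ω → ℝ), (∀ n, u n ∈ D) ∧
      (∀ᵐ x ∂τ, Tendsto (fun n => u n x) atTop (𝓝 (F x))) ∧ ∀ ψ, Φ ψ = ∫ x, ψ x * F x ∂τ := by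
  set F : Lp ℝ 2 τ := (InnerProductSpace.toDual ℝ (Lp ℝ 2 τ)).symm Φ with hF
  have hinner : ∀ ψ φ : Lp ℝ 2 τ, inner ℝ ψ φ = ∫ x, φ x * ψ x ∂τ := by
    intro ψ φ
    rw [L2.inner_def]
    exact integral_congr_ae (ae_of_all _ fun x => by simp)
  have hFΦ : ∀ ψ, Φ ψ = ∫ x, ψ x * F x ∂τ := by
    intro ψ
    rw [← hinner, hF, InnerProductSpace.toDual_symm_apply]
  have hL2 : ∀ g ∈ D, MemLp g 2 τ := fun g hg => MemLp.of_bound (hm g hg) C (ae_of_all _ (hC g hg))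
  let K : Set (Lp ℝ 2 τ) := {ψ | ∃ g ∈ D, ψ =ᵐ[τ] g}
  have hK : Convex ℝ K := by
    rintro ψ ⟨g, hg, hψ⟩ ψ' ⟨g', hg', hψ'⟩ a b ha hb hab
    refine ⟨_, hD hg hg' ha hb hab, ?_⟩
    filter_upwards [Lp.coeFn_add (a • ψ) (b • ψ'), Lp.coeFn_smul a ψ, Lp.coeFn_smul b ψ', hψ, hψ']
      with x h1 h2 h3 h4 h5
    rw [h1, Pi.add_apply, h2, h3, Pi.smul_apply, Pi.smul_apply, h4, h5]
    rfl
  have hmem : F ∈ closure K := by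
    by_contra hcon
    obtain ⟨L, c, hLc, hcL⟩ := geometric_hahn_banach_closed_point hK.closure isClosed_closure hcon
    set v : Lp ℝ 2 τ := (InnerProductSpace.toDual ℝ (Lp ℝ 2 τ)).symm L with hv
    have hLv : ∀ ψ, L ψ = inner ℝ v ψ := fun ψ => by
      rw [hv, InnerProductSpace.toDual_symm_apply]
    have h1 : L F = Φ v := by
      rw [hLv, hinner, hFΦ]
      exact integral_congr_ae (ae_of_all _ fun x => mul_comm _ _)
    refine hcL.not_ge (h1 ▸ le_of_tendsto (hΦ v) ?_)
    filter_upwards [hf] with i hi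
    have h2 := hLc ((hL2 _ hi).toLp _) (subset_closure ⟨f i, hi, MemLp.coeFn_toLp _⟩)
    rw [hLv, hinner] at h2
    refine le_of_eq_of_le (integral_congr_ae ?_) h2.le
    filter_upwards [MemLp.coeFn_toLp (hL2 _ hi)] with x hx
    rw [hx, mul_comm]
  obtain ⟨k, hk, hkF⟩ := mem_closure_iff_seq_limit.1 hmem
  obtain ⟨ns, -, hns⟩ := (tendstoInMeasure_of_tendsto_Lp hkF).exists_seq_tendsto_ae
  choose u hu hku using hk
  refine ⟨F, fun n => u (ns n), fun n => hu _, ?_, hFΦ⟩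
  filter_upwards [hns, ae_all_iff.2 hku] with x h1 h2
  simpa only [h2] using h1

variable (τ) in
/-- The inclusion of `L²` in `L¹` for a finite measure. -/
def inclTwoOne : Lp ℝ 2 τ →L[ℝ] Lp ℝ 1 τ :=
  have h : ∀ ψ : Lp ℝ 2 τ, MemLp ψ 1 τ := fun ψ => (Lp.memLp ψ).mono_exponent one_le_two
  LinearMap.mkContinuous
    { toFun := fun ψ => (h ψ).toLp ψ
      map_add' := fun a b => by
        rw [← MemLp.toLp_add, MemLp.toLp_eq_toLp_iff]
        exact Lp.coeFn_add a b
      map_smul' := fun c a => by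
        rw [RingHom.id_apply, ← MemLp.toLp_const_smul, MemLp.toLp_eq_toLp_iff]
        exact Lp.coeFn_smul c a }
    (τ Set.univ ^ (1 / (1 : ℝ≥0∞).toReal - 1 / (2 : ℝ≥0∞).toReal)).toReal fun ψ => by
      change ‖(h ψ).toLp ψ‖ ≤ _
      rw [Lp.norm_toLp, mul_comm, Lp.norm_def, ← ENNReal.toReal_mul]
      refine ENNReal.toReal_mono (ENNReal.mul_ne_top (Lp.eLpNorm_ne_top ψ)
        (ENNReal.rpow_ne_top_of_nonneg (by norm_num) (measure_ne_top τ _)))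
        (eLpNorm_le_eLpNorm_mul_rpow_measure_univ one_le_two (Lp.aestronglyMeasurable ψ))

theorem coeFn_inclTwoOne (ψ : Lp ℝ 2 τ) : inclTwoOne τ ψ =ᵐ[τ] ψ :=
  MemLp.coeFn_toLp ((Lp.memLp ψ).mono_exponent one_le_two)

theorem denseRange_inclTwoOne : DenseRange (inclTwoOne τ) := by
  intro φ
  refine Lp.induction ENNReal.one_ne_top (fun φ => φ ∈ closure (Set.range (inclTwoOne τ)))
    ?_ ?_ isClosed_closure φ
  · intro c s hs hμs
    refine subset_closure ⟨indicatorConstLp 2 hs hμs.ne c, ?_⟩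
    rw [Lp.simpleFunc.coe_indicatorConst]
    refine Lp.ext ?_
    filter_upwards [coeFn_inclTwoOne (indicatorConstLp 2 hs hμs.ne c),
      indicatorConstLp_coeFn (p := 2) (hs := hs) (hμs := hμs.ne) (c := c),
      indicatorConstLp_coeFn (p := 1) (hs := hs) (hμs := hμs.ne) (c := c)] with x h1 h2 h3
    rw [h1, h2, h3]
  · intro f g hf hg _ h1 h2
    exact (LinearMap.range (inclTwoOne τ).toLinearMap).topologicalClosure.add_mem h1 h2

end WeakLimits

/-! ### Representing invariant functionals on `L¹(G)` by invariant functions -/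

section Representation

variable {G : Type u} [Group G] [TopologicalSpace G] [IsTopologicalGroup G]
  [LocallyCompactSpace G] [T2Space G] [MeasurableSpace G] [BorelSpace G]
  {μ : Measure G} [μ.IsHaarMeasure] [μ.Regular]

/-- Continuous functions on `G` that are invariant under left translation by `H` and have values in
`[a, b]`. -/
def invariantFunctions (H : Subgroup G) (a b : ℝ) : Set (G → ℝ) :=
  {f | Continuous f ∧ (∀ h ∈ H, ∀ x, f (h * x) = f x) ∧ ∀ x, f x ∈ Set.Icc a b}

theorem convex_invariantFunctions (H : Subgroup G) (a b : ℝ) :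
    Convex ℝ (invariantFunctions H a b) := by
  rintro f ⟨hf, hfH, hfab⟩ g ⟨hg, hgH, hgab⟩ s t hs ht hst
  refine ⟨(hf.const_smul s).add (hg.const_smul t), fun h hh x => ?_, fun x =>
    convex_Icc a b (hfab x) (hgab x) hs ht hst⟩
  simp [hfH h hh, hgH h hh]

theorem abs_le_of_mem_Icc {a b t : ℝ} (h : t ∈ Set.Icc a b) : |t| ≤ max |a| |b| := by
  rw [abs_le]
  have h1 := neg_abs_le a
  have h2 := le_abs_self b
  have h3 := le_max_left |a| |b|
  have h4 := le_max_right |a| |b|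
  exact ⟨by linarith [h.1], by linarith [h.2]⟩

theorem limsup_mem_Icc {a b : ℝ} {u : ℕ → ℝ} (hu : ∀ n, u n ∈ Set.Icc a b) :
    limsup u atTop ∈ Set.Icc a b := by
  have h1 : IsBoundedUnder (· ≤ ·) atTop u := isBoundedUnder_of ⟨b, fun n => (hu n).2⟩
  have h2 : IsBoundedUnder (· ≥ ·) atTop u := isBoundedUnder_of ⟨a, fun n => (hu n).1⟩
  exact ⟨le_limsup_of_frequently_le (Eventually.frequently (.of_forall fun n => (hu n).1)) h1,
    limsup_le_of_le h2.isCoboundedUnder_le (.of_forall fun n => (hu n).2)⟩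

/-- On a set `S` of `σ`-finite measure, a left `H`-invariant functional on `L¹(G)` is integration
against an upper limit of a sequence of continuous left `H`-invariant functions. These come from
the functions `x ↦ Λ (x w)`, which converge weakly to `Λ` for `w` concentrating at `1`, since
`∫ φ(x) Λ (x w) dx = Λ (φ * w)`. A positive density makes the measure on `S` finite. -/
theorem exists_seq_represents {H : Subgroup G} {a b : ℝ} (Λ : LOne μ →L[ℝ] ℝ)
    (hΛ : ∀ h ∈ H, ∀ φ, Λ (translateLOne μ h φ) = Λ φ)
    (hab : ∀ w, IsBump μ Set.univ w → ∀ x, Λ (translateLOne μ x (toLOne μ w)) ∈ Set.Icc a b)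
    {S : Set G} (hS : MeasurableSet S) [SigmaFinite (μ.restrict S)] :
    ∃ u : ℕ → G → ℝ, (∀ n, u n ∈ invariantFunctions H a b) ∧
      ∀ φ : LOne μ, (∀ᵐ x ∂μ, x ∉ S → φ x = 0) →
        Λ φ = ∫ x, φ x * limsup (fun n => u n x) atTop ∂μ := by
  obtain ⟨θ₀, hθ₀, hθ₀m, hθ₀int⟩ :=
    exists_pos_lintegral_lt_of_sigmaFinite (μ.restrict S) (ε := 1) one_ne_zero
  let θ : G → ℝ≥0 := S.indicator θ₀
  have hθ : Measurable θ := hθ₀m.indicator hS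
  let τ : Measure G := μ.withDensity fun x => θ x
  have : IsFiniteMeasure τ := by
    refine isFiniteMeasure_withDensity
      (ne_of_lt (lt_of_eq_of_lt ?_ (hθ₀int.trans ENNReal.one_lt_top)))
    rw [← lintegral_indicator hS]
    refine lintegral_congr fun x => ?_
    by_cases hx : x ∈ S <;> simp [θ, hx]
  -- `W` identifies `L¹` of the finite measure `τ` with the functions in `L¹(G)` supported in `S`.
  let W : Lp ℝ 1 τ →ₗᵢ[ℝ] LOne μ := withDensitySMulLI μ hθ
  have hW : ∀ ψ : Lp ℝ 1 τ, W ψ =ᵐ[μ] fun x => θ x • ψ x := fun ψ =>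
    (memL1_smul_of_L1_withDensity hθ ψ).coeFn_toLp
  have hWint : ∀ (ψ : Lp ℝ 2 τ) (g : G → ℝ),
      ∫ x, ψ x * g x ∂τ = ∫ x, W (inclTwoOne τ ψ) x * g x ∂μ := by
    intro ψ g
    have h1 : ∫ x, ψ x * g x ∂τ = ∫ x, inclTwoOne τ ψ x * g x ∂τ :=
      integral_congr_ae ((coeFn_inclTwoOne ψ).mono fun x hx => by simp only [hx])
    rw [h1, integral_withDensity_eq_integral_smul hθ]
    refine integral_congr_ae ((hW (inclTwoOne τ ψ)).mono fun x hx => ?_)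
    simp only [hx, smul_mul_assoc]
  let Φ : Lp ℝ 2 τ →L[ℝ] ℝ := (Λ.comp W.toContinuousLinearMap).comp (inclTwoOne τ)
  have hΦ : ∀ ψ, Φ ψ = Λ (W (inclTwoOne τ ψ)) := fun _ => rfl
  let f : C_c(G, ℝ) → G → ℝ := fun w x => Λ (translateLOne μ x (toLOne μ w))
  have hfD : ∀ᶠ w in bumpFilter μ (1 : G), f w ∈ invariantFunctions H a b := by
    filter_upwards [eventually_isBump univ_mem] with w hw
    refine ⟨Λ.continuous.comp (continuous_translateLOne _), fun h hh x => ?_, hab w hw⟩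
    change Λ (translateLOne μ (h * x) (toLOne μ w)) = _
    rw [translateLOne_mul, hΛ h hh]
  obtain ⟨F, u, huD, huF, hF⟩ := exists_seq_ae_tendsto_of_weak (τ := τ)
    (convex_invariantFunctions H a b) (C := max |a| |b|)
    (fun g hg => hg.1.measurable.aestronglyMeasurable)
    (fun g hg x => abs_le_of_mem_Icc (hg.2.2 x)) hfD Φ (fun ψ => by
      have h := (Λ.continuous.tendsto _).comp (tendsto_conv_right (W (inclTwoOne τ ψ)))
      refine h.congr fun w => ?_
      rw [Function.comp_apply, map_conv, hWint]
      rfl)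
  refine ⟨u, huD, ?_⟩
  have hlm : Measurable fun x => limsup (fun n => u n x) atTop :=
    Measurable.limsup fun n => (huD n).1.measurable
  have hlb : ∀ x, |limsup (fun n => u n x) atTop| ≤ max |a| |b| := fun x =>
    abs_le_of_mem_Icc (limsup_mem_Icc fun n => (huD n).2.2 x)
  have key : ∀ ψ : Lp ℝ 1 τ, Λ (W ψ) = dualOf hlm hlb (W ψ) := by
    refine fun ψ => denseRange_inclTwoOne.induction_on ψ
      (isClosed_eq (Λ.continuous.comp W.continuous) ((dualOf hlm hlb).continuous.comp W.continuous))
      fun ψ => ?_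
    rw [← hΦ, hF, dualOf_apply, ← hWint]
    refine integral_congr_ae (huF.mono fun x hx => ?_)
    simp only [hx.limsup_eq]
  intro φ hφ
  have hθφ : (fun x => θ x • ((θ x : ℝ)⁻¹ * φ x)) =ᵐ[μ] φ := by
    filter_upwards [hφ] with x hx
    by_cases hxS : x ∈ S
    · have : (θ x : ℝ) ≠ 0 := by simpa [θ, hxS] using (hθ₀ x).ne'
      rw [NNReal.smul_def, smul_eq_mul, mul_inv_cancel_left₀ this]
    · simp [hx hxS]
  have hint : Integrable (fun x => (θ x : ℝ)⁻¹ * φ x) τ :=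
    (integrable_withDensity_iff_integrable_smul hθ).2
      ((L1.integrable_coeFn φ).congr hθφ.symm)
  have hWφ : W (hint.toL1 _) = φ := by
    refine Lp.ext ?_
    have h1 := (ae_withDensity_iff hθ.coe_nnreal_ennreal).1 (Integrable.coeFn_toL1 hint)
    filter_upwards [hW (hint.toL1 _), hθφ, h1] with x h2 h3 h4
    rw [h2, ← h3]
    rcases eq_or_ne (θ x) 0 with h0 | h0
    · simp [h0]
    · rw [h4 (by simpa using h0)]
  have := key (hint.toL1 _)
  rwa [hWφ] at this

open scoped Pointwise in
variable (G) in
theorem exists_isOpen_subgroup_sigmaCompact :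
    ∃ G₀ : Subgroup G, IsOpen (G₀ : Set G) ∧ IsSigmaCompact (G₀ : Set G) := by
  obtain ⟨K, hK, hK1⟩ := exists_compact_mem_nhds (1 : G)
  let V : Set G := K ∪ K⁻¹
  have hV : IsCompact V := hK.union hK.inv
  have hVinv : V⁻¹ = V := by simp [V, Set.union_comm]
  let G₀ : Subgroup G :=
    { carrier := ⋃ n : ℕ, V ^ n
      mul_mem' := fun {x y} hx hy => by
        obtain ⟨n, hn⟩ := Set.mem_iUnion.1 hx
        obtain ⟨m, hm⟩ := Set.mem_iUnion.1 hy
        exact Set.mem_iUnion.2 ⟨n + m, by rw [pow_add]; exact Set.mul_mem_mul hn hm⟩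
      one_mem' := Set.mem_iUnion.2 ⟨0, by simp⟩
      inv_mem' := fun {x} hx => by
        obtain ⟨n, hn⟩ := Set.mem_iUnion.1 hx
        refine Set.mem_iUnion.2 ⟨n, ?_⟩
        rw [← hVinv, inv_pow]
        simpa using hn }
  refine ⟨G₀, Subgroup.isOpen_of_mem_nhds G₀ (g := 1) ?_, ?_⟩
  · refine mem_of_superset hK1 fun x hx => Set.mem_iUnion.2 ⟨1, ?_⟩
    rw [pow_one]
    exact Or.inl hx
  · refine isSigmaCompact_iUnion_of_isCompact _ fun n => ?_
    induction n with
    | zero => simp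
    | succ n ih => rw [pow_succ]; exact ih.mul hV

theorem sigmaFinite_restrict_of_isSigmaCompact {S : Set G} (hS : IsSigmaCompact S) :
    SigmaFinite (μ.restrict S) := by
  obtain ⟨K, hK, rfl⟩ := hS
  have h : ∀ n, μ.restrict (⋃ n, K n) (K n ∪ (⋃ n, K n)ᶜ) < ∞ := by
    intro n
    refine lt_of_le_of_lt (measure_union_le _ _) (ENNReal.add_lt_top.2 ⟨?_, ?_⟩)
    · exact (Measure.restrict_apply_le _ _).trans_lt (hK n).measure_lt_top
    · rw [Measure.restrict_apply' (MeasurableSet.iUnion fun n => (hK n).measurableSet),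
        Set.compl_inter_self, measure_empty]
      exact ENNReal.zero_lt_top
  exact ⟨⟨⟨fun n => K n ∪ (⋃ n, K n)ᶜ, fun _ => trivial, h, by
    rw [← Set.iUnion_union, Set.union_compl_self]⟩⟩⟩

/-- A left `H`-invariant functional on `L¹(G)` is integration against a bounded Borel function that
is left `H`-invariant everywhere. For an open `σ`-compact subgroup `G₀`, the sequences of
`exists_seq_represents` are chosen for one left coset `g G₀` in each double coset `H g G₀` and
glued; the glued functions are continuous as the double cosets are open. -/
theorem exists_invariant_representative {H : Subgroup G} {a b : ℝ} (Λ : LOne μ →L[ℝ] ℝ)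
    (hΛ : ∀ h ∈ H, ∀ φ, Λ (translateLOne μ h φ) = Λ φ)
    (hab : ∀ w, IsBump μ Set.univ w → ∀ x, Λ (translateLOne μ x (toLOne μ w)) ∈ Set.Icc a b) :
    ∃ f : G → ℝ, Measurable f ∧ (∀ x, f x ∈ Set.Icc a b) ∧ (∀ h ∈ H, ∀ x, f (h * x) = f x) ∧
      ∀ φ : LOne μ, Λ φ = ∫ x, φ x * f x ∂μ := by
  obtain ⟨G₀, hG₀, hG₀c⟩ := exists_isOpen_subgroup_sigmaCompact G
  let S : G → Set G := fun g => (fun x => g⁻¹ * x) ⁻¹' (G₀ : Set G)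
  have hSo : ∀ g, IsOpen (S g) := fun g => hG₀.preimage (continuous_const_mul g⁻¹)
  have hSc : ∀ g, IsSigmaCompact (S g) := fun g => by
    have : S g = (fun x => g * x) '' (G₀ : Set G) := by
      ext x
      simp [S]
    rw [this]
    exact hG₀c.image (continuous_const_mul g)
  have hSσ : ∀ g, SigmaFinite (μ.restrict (S g)) := fun g =>
    sigmaFinite_restrict_of_isSigmaCompact (hSc g)
  choose u huD hu using fun g => exists_seq_represents Λ hΛ hab (hSo g).measurableSet
  -- `r x` is the chosen representative of the double coset of `x`.
  let r : G → G := fun x =>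
    (Quotient.mk (DoubleCoset.setoid (H : Set G) G₀) x).out
  have hr : ∀ x, ∃ h ∈ H, ∃ k ∈ G₀, x = h * r x * k := fun x =>
    DoubleCoset.rel_iff.1 (Quotient.exact (Quotient.out_eq (Quotient.mk _ x)))
  have hrx : ∀ x, ∀ h ∈ H, ∀ k ∈ G₀, r (h * x * k) = r x := fun x h hh k hk => by
    have : Quotient.mk (DoubleCoset.setoid (H : Set G) G₀) x =
      Quotient.mk (DoubleCoset.setoid (H : Set G) G₀) (h * x * k) :=
      Quotient.sound (DoubleCoset.rel_iff.2 ⟨h, hh, k, hk, rfl⟩)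
    simp only [r, this]
  have hrS : ∀ x, ∀ y ∈ S x, r y = r x := fun x y hy => by
    simpa using hrx x 1 H.one_mem (x⁻¹ * y) hy
  let f : G → ℝ := fun x => limsup (fun n => u (r x) n x) atTop
  have hcont : ∀ n, Continuous fun x => u (r x) n x := fun n => by
    refine continuous_iff_continuousAt.2 fun x => ?_
    refine (huD (r x) n).1.continuousAt.congr ?_
    filter_upwards [(hSo x).mem_nhds (by simp [S, G₀.one_mem])] with y hy
    rw [hrS x y hy]
  have hfm : Measurable f := Measurable.limsup fun n => (hcont n).measurable
  have hfab : ∀ x, f x ∈ Set.Icc a b := fun x => limsup_mem_Icc fun n => (huD _ n).2.2 x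
  have hfH : ∀ h ∈ H, ∀ x, f (h * x) = f x := fun h hh x => by
    have h1 : r (h * x) = r x := by simpa using hrx x h hh 1 G₀.one_mem
    simp only [f, h1, (huD _ _).2.1 h hh]
  refine ⟨f, hfm, hfab, hfH, ?_⟩
  let L := dualOf hfm (μ := μ) fun x => abs_le_of_mem_Icc (hfab x)
  have hL : ∀ φ, L φ = ∫ x, φ x * f x ∂μ := fun _ => rfl
  have hcoset : ∀ g, ∀ φ : LOne μ, (∀ᵐ x ∂μ, x ∉ S g → φ x = 0) → Λ φ = L φ := by
    intro g φ hφ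
    obtain ⟨h, hh, k, hk, hg⟩ := hr g
    have h1 : ∀ᵐ x ∂μ, x ∉ S (r g) → translateLOne μ h⁻¹ φ x = 0 := by
      filter_upwards [coeFn_translateLOne h⁻¹ φ,
        (measurePreserving_mul_left μ h).quasiMeasurePreserving.ae hφ] with x h2 h3 hx
      rw [h2, inv_inv]
      refine h3 fun hmem => hx ?_
      have h4 : g⁻¹ * (h * x) ∈ G₀ := hmem
      have h5 : (r g)⁻¹ * x = k * (g⁻¹ * (h * x)) := by
        nth_rewrite 2 [hg]
        group
      change (r g)⁻¹ * x ∈ G₀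
      rw [h5]
      exact G₀.mul_mem hk h4
    have hrr : r (r g) = r g := by
      have := hrx (r g) h hh k hk
      rw [← hg] at this
      exact this.symm
    rw [← hΛ h⁻¹ (H.inv_mem hh), hu (r g) _ h1]
    have h2 : ∫ x, translateLOne μ h⁻¹ φ x * limsup (fun n => u (r g) n x) atTop ∂μ =
        ∫ x, translateLOne μ h⁻¹ φ x * f x ∂μ := by
      refine integral_congr_ae ?_
      filter_upwards [h1] with x hx
      by_cases hxS : x ∈ S (r g)
      · simp only [f, hrS _ x hxS, hrr]
      · simp only [hx hxS, zero_mul]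
    rw [h2, integral_translateLOne_mul, hL]
    simp only [hfH h⁻¹ (H.inv_mem hh)]
  have hcompact : ∀ K : Set G, IsCompact K → ∃ T, K ⊆ T ∧ MeasurableSet T ∧
      ∀ φ : LOne μ, (∀ᵐ x ∂μ, x ∉ T → φ x = 0) → Λ φ = L φ := by
    intro K hK
    refine hK.induction_on ⟨∅, subset_rfl, .empty, fun φ hφ => ?_⟩
      (fun s t hst ⟨T, hT, h⟩ => ⟨T, hst.trans hT, h⟩) ?_ fun x _ =>
      ⟨S x, mem_nhdsWithin_of_mem_nhds ((hSo x).mem_nhds (by simp [S, G₀.one_mem])), S x,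
        subset_rfl, (hSo x).measurableSet, hcoset x⟩
    · have : φ = 0 := (Lp.eq_zero_iff_ae_eq_zero).2 (by
        filter_upwards [hφ] with x hx using hx (Set.notMem_empty x))
      rw [this, map_zero, map_zero]
    · rintro s t ⟨T, hsT, hTm, hT⟩ ⟨T', htT', hTm', hT'⟩
      refine ⟨T ∪ T', Set.union_subset_union hsT htT', hTm.union hTm', fun φ hφ => ?_⟩
      have hi := L1.integrable_coeFn φ
      have hdec : φ = (hi.indicator hTm).toL1 _ + (hi.indicator hTm.compl).toL1 _ := by
        refine Lp.ext ?_
        filter_upwards [Lp.coeFn_add ((hi.indicator hTm).toL1 _) ((hi.indicator hTm.compl).toL1 _),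
          (hi.indicator hTm).coeFn_toL1, (hi.indicator hTm.compl).coeFn_toL1] with x h1 h2 h3
        rw [h1, Pi.add_apply, h2, h3, ← Pi.add_apply, Set.indicator_self_add_compl]
      rw [hdec, map_add, map_add, hT _ ?_, hT' _ ?_]
      · filter_upwards [(hi.indicator hTm.compl).coeFn_toL1, hφ] with x h1 h2 hx
        rw [h1]
        by_cases hxT : x ∈ T
        · simp [hxT]
        · simp [h2 (by simp [hxT, hx])]
      · filter_upwards [(hi.indicator hTm).coeFn_toL1] with x h1 hx
        rw [h1, Set.indicator_of_notMem hx]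
  intro φ
  rw [← hL]
  refine (denseRange_toLOne μ).induction_on φ (isClosed_eq Λ.continuous L.continuous) fun g => ?_
  obtain ⟨T, hKT, -, hT⟩ := hcompact _ g.hasCompactSupport
  refine hT _ ((coeFn_toLOne g).mono fun x hx hxT => ?_)
  rw [hx]
  exact image_eq_zero_of_notMem_tsupport fun h => hxT (hKT h)

end Representation

/-! ### Coefficients of the translation representations on `L¹(G)` -/

section Coefficients

variable {G : Type u} [Group G] [TopologicalSpace G] [IsTopologicalGroup G]
  [LocallyCompactSpace G] [T2Space G] [MeasurableSpace G] [BorelSpace G]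
  {μ : Measure G} [μ.IsHaarMeasure] [μ.Regular]

theorem norm_apply_le_of_isometric (L : LOne μ →L[ℝ] ℝ) {T : G → LOne μ →L[ℝ] LOne μ}
    (hn : ∀ g φ, ‖T g φ‖ = ‖φ‖) (φ : LOne μ) (x : G) : ‖L (T x φ)‖ ≤ ‖L‖ * ‖φ‖ :=
  hn x φ ▸ L.le_opNorm (T x φ)

/-- The coefficients `x ↦ L (T x φ)` of a strongly continuous isometric anti-representation `T` of
`G` on `L¹(G)`, as right uniformly continuous functions. -/
def coefficient (L : LOne μ →L[ℝ] ℝ) (T : G → LOne μ →L[ℝ] LOne μ)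
    (hT : ∀ g x φ, T (g * x) φ = T x (T g φ)) (hn : ∀ g φ, ‖T g φ‖ = ‖φ‖)
    (hc : ∀ φ, Continuous fun g => T g φ) : LOne μ →ₗ[ℝ] Cbru G where
  toFun φ := ⟨BoundedContinuousFunction.ofNormedAddCommGroup (fun x => L (T x φ))
      (L.continuous.comp (hc φ)) (‖L‖ * ‖φ‖) (norm_apply_le_of_isometric L hn φ), by
    refine continuous_iff_continuousAt.2 fun g₀ => ?_
    have h : Tendsto (fun g : G => ‖L‖ * ‖T g⁻¹ φ - T g₀⁻¹ φ‖) (𝓝 g₀) (𝓝 0) := by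
      have : Continuous fun g : G => ‖L‖ * ‖T g⁻¹ φ - T g₀⁻¹ φ‖ :=
        continuous_const.mul ((((hc φ).comp continuous_inv).sub continuous_const).norm)
      simpa using this.tendsto g₀
    refine tendsto_iff_dist_tendsto_zero.2 (squeeze_zero (fun _ => dist_nonneg) (fun g => ?_) h)
    refine (BoundedContinuousFunction.dist_le (by positivity)).2 fun x => ?_
    change dist (L (T (g⁻¹ * x) φ)) (L (T (g₀⁻¹ * x) φ)) ≤ _
    rw [hT, hT, dist_eq_norm, ← map_sub, ← map_sub]
    exact norm_apply_le_of_isometric L hn _ x⟩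
  map_add' a b := Cbru.ext_apply fun x => by
    change L (T x (a + b)) = L (T x a) + L (T x b)
    rw [map_add, map_add]
  map_smul' c a := Cbru.ext_apply fun x => by
    change L (T x (c • a)) = c * L (T x a)
    rw [map_smul, map_smul, smul_eq_mul]

variable (L : LOne μ →L[ℝ] ℝ)

/-- The functions `x ↦ L (x⁻¹ φ)`. -/
def leftCoefficient : LOne μ →ₗ[ℝ] Cbru G :=
  coefficient L (fun x => translateCLM μ x⁻¹)
    (fun g x φ => by simp only [translateCLM_apply, mul_inv_rev, translateLOne_mul])
    (fun g φ => norm_translateLOne _ φ)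
    (fun φ => (continuous_translateLOne φ).comp continuous_inv)

/-- The functions `x ↦ L (ρ x φ)`, for the right translation `ρ`. -/
def rightCoefficient : LOne μ →ₗ[ℝ] Cbru G :=
  coefficient L (rightTranslate μ) (fun g x φ => rightTranslate_mul x g φ) norm_rightTranslate
    continuous_rightTranslate

theorem leftCoefficient_apply (φ : LOne μ) (x : G) :
    (leftCoefficient L φ : G →ᵇ ℝ) x = L (translateLOne μ x⁻¹ φ) := rfl

theorem rightCoefficient_apply (φ : LOne μ) (x : G) :
    (rightCoefficient L φ : G →ᵇ ℝ) x = L (rightTranslate μ x φ) := rfl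

theorem Cbru.norm_le {f : Cbru G} {C : ℝ} (hC : 0 ≤ C) (h : ∀ x, ‖(f : G →ᵇ ℝ) x‖ ≤ C) :
    ‖f‖ ≤ C :=
  ((f : G →ᵇ ℝ).norm_le hC).2 h

theorem norm_leftCoefficient_le (φ : LOne μ) : ‖leftCoefficient L φ‖ ≤ ‖L‖ * ‖φ‖ :=
  Cbru.norm_le (by positivity) fun x => by
    rw [leftCoefficient_apply, ← norm_translateLOne x⁻¹ φ]
    exact L.le_opNorm _

theorem norm_rightCoefficient_le (φ : LOne μ) : ‖rightCoefficient L φ‖ ≤ ‖L‖ * ‖φ‖ :=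
  Cbru.norm_le (by positivity) fun x => by
    rw [rightCoefficient_apply, ← norm_rightTranslate x φ]
    exact L.le_opNorm _

theorem translateCbru_leftCoefficient (g : G) (φ : LOne μ) :
    translateCbru g (leftCoefficient L φ) = leftCoefficient L (translateLOne μ g φ) :=
  Cbru.ext_apply fun x => by
    rw [translateCbru_apply, leftCoefficient_apply, leftCoefficient_apply, mul_inv_rev, inv_inv,
      translateLOne_mul]

theorem translateCbru_rightCoefficient (g : G) (φ : LOne μ) :
    translateCbru g (rightCoefficient L φ) = rightCoefficient L (rightTranslate μ g⁻¹ φ) :=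
  Cbru.ext_apply fun x => by
    rw [translateCbru_apply, rightCoefficient_apply, rightCoefficient_apply, rightTranslate_mul]

/-- The functional `φ ↦ m (x ↦ L (x⁻¹ φ))` on `L¹(G)`. -/
def meanLeft {m : Cbru G →ₗ[ℝ] ℝ} (hm : IsMean m) : LOne μ →L[ℝ] ℝ :=
  LinearMap.mkContinuous (m ∘ₗ leftCoefficient L) ‖L‖ fun φ =>
    (hm.abs_le _).trans (norm_leftCoefficient_le L φ)

/-- The functional `φ ↦ m (x ↦ L (ρ x φ))` on `L¹(G)`. -/
def meanRight {m : Cbru G →ₗ[ℝ] ℝ} (hm : IsMean m) : LOne μ →L[ℝ] ℝ :=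
  LinearMap.mkContinuous (m ∘ₗ rightCoefficient L) ‖L‖ fun φ =>
    (hm.abs_le _).trans (norm_rightCoefficient_le L φ)

variable {L} {m : Cbru G →ₗ[ℝ] ℝ} (hm : IsMean m)

theorem meanLeft_apply (φ : LOne μ) : meanLeft L hm φ = m (leftCoefficient L φ) := rfl

theorem meanRight_apply (φ : LOne μ) : meanRight L hm φ = m (rightCoefficient L φ) := rfl

theorem translateLOne_conv (g : G) (φ ψ : LOne μ) :
    translateLOne μ g (conv μ φ ψ) = conv μ (translateLOne μ g φ) ψ := by
  refine (SeparatingDual.eq_iff_forall_dual_eq (R := ℝ)).2 fun L => ?_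
  have h := map_conv (L.comp (translateCLM μ g)) φ ψ
  simp only [ContinuousLinearMap.comp_apply, translateCLM_apply] at h
  rw [h, map_conv]
  simp only [smul_eq_mul]
  rw [integral_translateLOne_mul g φ fun y => L (translateLOne μ y ψ)]
  simp only [translateLOne_mul]

end Coefficients

/-! ### From invariant means to positive equivariant maps -/

section Maps

variable {G : Type u} [Group G] [TopologicalSpace G] [IsTopologicalGroup G]
  [LocallyCompactSpace G] [T2Space G] [MeasurableSpace G] [BorelSpace G]
  {μ : Measure G} [μ.IsHaarMeasure] [μ.Regular] {H : Subgroup G}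

/-- The class in `L^∞(G ⧸ H)` of `g H ↦ f g⁻¹`, for a left `H`-invariant function `f`. -/
theorem exists_quotient_class {f : G → ℝ} (hf : Measurable f) {C : ℝ} (hC : ∀ x, |f x| ≤ C)
    (hfH : ∀ h ∈ H, ∀ x, f (h * x) = f x) :
    ∃ F : LInftyQuotient μ H, ‖F‖ ≤ C ∧ ((∀ x, 0 ≤ f x) → LInfty.IsNonneg _ μ F) ∧
      ∀ φ : LOne μ, LInfty.pair F φ = ∫ x, φ x * f x ∂μ := by
  let q : G ⧸ H → ℝ := Quotient.lift (fun g : G => f g⁻¹) fun a b hab => by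
    have h1 : a⁻¹ * b ∈ H := QuotientGroup.leftRel_apply.1 hab
    have := hfH _ h1 b⁻¹
    simpa using this
  have hq : ∀ g : G, q (g • ((1 : G) : G ⧸ H)) = f g⁻¹ := fun g => by
    change f (g * 1)⁻¹ = _
    rw [mul_one]
  have hqC : ∀ x, |q x| ≤ C := fun x => by
    obtain ⟨g, rfl⟩ := QuotientGroup.mk_surjective x
    exact hC _
  have hqm : Measurable fun g : G => q (g • ((1 : G) : G ⧸ H)) := by
    simp only [hq]
    exact hf.comp measurable_inv
  refine ⟨Submodule.Quotient.mk (BoundedMeasurable.of _ q C hqC hqm), ?_, fun h0 => ⟨_, rfl, ?_⟩,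
    fun φ => ?_⟩
  · refine (Submodule.Quotient.norm_mk_le _ _).trans ?_
    exact lp.norm_le_of_forall_le ((abs_nonneg _).trans (hC 1)) hqC
  · intro x
    obtain ⟨g, rfl⟩ := QuotientGroup.mk_surjective x
    exact h0 _
  · rw [LInfty.pair_mk]
    change ∫ y, φ y * q (y⁻¹ • ((1 : G) : G ⧸ H)) ∂μ = _
    simp only [hq, inv_inv]

theorem norm_pair_le {X : Type w} [MulAction G X] {x₀ : X} (F : LInfty x₀ μ) :
    ‖LInfty.pair F‖ ≤ ‖F‖ :=
  ContinuousLinearMap.opNorm_le_bound _ (norm_nonneg F) (LInfty.abs_pair_le F)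

/-- A left invariant mean `m` turns `F` in `L^∞(G)` into the left `H`-invariant functional
`φ ↦ m (φ * F)` on `L¹(G)`, hence into an element of `L^∞(G ⧸ H)`. -/
theorem exists_class_of_mean {m : Cbru G →ₗ[ℝ] ℝ} (hm : IsMean m) (hH : IsLeftInvariant H m)
    (F : LInftyGroup μ) :
    ∃ F' : LInftyQuotient μ H, LInfty.pair F' = meanLeft (LInfty.pair F) hm ∧ ‖F'‖ ≤ ‖F‖ ∧
      (LInfty.IsNonneg _ μ F → LInfty.IsNonneg _ μ F') := by
  set Λ := meanLeft (LInfty.pair F) hm with hΛ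
  have hinv : ∀ h ∈ H, ∀ φ, Λ (translateLOne μ h φ) = Λ φ := fun h hh φ => by
    rw [hΛ, meanLeft_apply, meanLeft_apply, ← translateCbru_leftCoefficient, hH h hh]
  have hbd : ∀ w, IsBump μ Set.univ w → ∀ x, |Λ (translateLOne μ x (toLOne μ w))| ≤ ‖F‖ := by
    intro w hw x
    refine (hm.abs_le _).trans ((norm_leftCoefficient_le _ _).trans ?_)
    rw [norm_translateLOne, hw.norm_toLOne, mul_one]
    exact norm_pair_le F
  obtain ⟨f, hf, hfab, hfH, hfΛ⟩ := exists_invariant_representative Λ hinv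
    fun w hw x => abs_le.1 (hbd w hw x)
  obtain ⟨F', hF'n, -, hF'⟩ := exists_quotient_class (μ := μ) hf (fun x => abs_le.2 (hfab x)) hfH
  have hpair : LInfty.pair F' = Λ := ContinuousLinearMap.ext fun φ => by rw [hF', hfΛ]
  refine ⟨F', hpair, hF'n, ?_⟩
  rintro ⟨g, hg, hg0⟩
  -- For non-negative `F` there is also a non-negative representative of `Λ`.
  obtain ⟨f₁, hf₁, hf₁ab, hf₁H, hf₁Λ⟩ := exists_invariant_representative (a := 0) Λ hinv
    fun w hw x => by
      refine ⟨hm.nonneg _ fun y => ?_, (abs_le.1 (hbd w hw x)).2⟩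
      rw [leftCoefficient_apply, ← translateLOne_mul, ← hg, LInfty.pair_mk]
      refine integral_nonneg_of_ae ?_
      filter_upwards [coeFn_translateLOne (y⁻¹ * x) (toLOne μ w),
        (measurePreserving_mul_left μ (y⁻¹ * x)⁻¹).quasiMeasurePreserving.ae
          (coeFn_toLOne (μ := μ) w)] with z h1 h2
      rw [h1, h2]
      exact mul_nonneg (hw.nonneg _) (hg0 _)
  obtain ⟨F₁, -, hF₁0, hF₁⟩ := exists_quotient_class (μ := μ) hf₁
    (fun x => abs_le.2 ⟨(neg_nonpos.2 (norm_nonneg F)).trans (hf₁ab x).1, (hf₁ab x).2⟩) hf₁H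
  have : F' = F₁ := LInfty.pair_injective (hpair.trans (ContinuousLinearMap.ext fun φ => by
    rw [hF₁, hf₁Λ]))
  rw [this]
  exact hF₁0 fun x => (hf₁ab x).1

theorem norm_one_le {X : Type w} [MulAction G X] (x₀ : X) : ‖LInfty.one x₀ μ‖ ≤ 1 := by
  refine (Submodule.Quotient.norm_mk_le _ _).trans ?_
  exact lp.norm_le_of_forall_le zero_le_one fun x => by
    change |(1 : ℝ)| ≤ 1
    simp

theorem one_le_norm_one {X : Type w} [MulAction G X] (x₀ : X) : 1 ≤ ‖LInfty.one x₀ μ‖ := by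
  obtain ⟨w, hw⟩ := exists_isBump (μ := μ) (univ_mem (f := 𝓝 (1 : G)))
  have h := LInfty.abs_pair_le (LInfty.one x₀ μ) (toLOne μ w)
  rw [LInfty.pair_one, hw.norm_toLOne, mul_one, integral_congr_ae (coeFn_toLOne w), hw.integral_eq,
    abs_one] at h
  exact h

/-- The classes given by `exists_class_of_mean` depend linearly on `F` and commute with convolution,
since the pairing with `L¹(G)` determines them. -/
theorem exists_equivariant_of_mean
    (h : ∃ m : Cbru G →ₗ[ℝ] ℝ, IsMean m ∧ IsLeftInvariant H m) :
    ∃ α : LInftyGroup μ →L[ℝ] LInftyQuotient μ H,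
      IsLOneEquivariant α ∧ IsUnital α ∧ IsPositiveMap α ∧ ‖α‖ = 1 := by
  obtain ⟨m, hm, hH⟩ := h
  choose α hα hαn hα0 using exists_class_of_mean (μ := μ) hm hH
  have hpair : ∀ F φ, LInfty.pair (α F) φ = m (leftCoefficient (LInfty.pair F) φ) := fun F φ => by
    rw [hα, meanLeft_apply]
  have hadd : ∀ F F', α (F + F') = α F + α F' := fun F F' => by
    refine LInfty.pair_injective (ContinuousLinearMap.ext fun φ => ?_)
    rw [map_add, add_apply, hpair, hpair, hpair, ← map_add]
    refine congrArg m (Cbru.ext_apply fun x => ?_)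
    rw [leftCoefficient_apply, map_add]
    rfl
  have hsmul : ∀ (c : ℝ) F, α (c • F) = c • α F := fun c F => by
    refine LInfty.pair_injective (ContinuousLinearMap.ext fun φ => ?_)
    rw [map_smul, smul_apply, hpair, hpair, ← map_smul]
    refine congrArg m (Cbru.ext_apply fun x => ?_)
    rw [leftCoefficient_apply, map_smul]
    rfl
  have hone : α (LInfty.one _ μ) = LInfty.one _ μ := by
    refine LInfty.pair_injective (ContinuousLinearMap.ext fun φ => ?_)
    rw [hpair, LInfty.pair_one, ← mul_one (∫ y, φ y ∂μ), ← hm.map_one, ← smul_eq_mul, ← map_smul]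
    refine congrArg m (Cbru.ext_apply fun x => ?_)
    rw [leftCoefficient_apply, LInfty.pair_one]
    have := integral_translateLOne_mul x⁻¹ φ fun _ => 1
    simp only [mul_one] at this
    rw [this]
    exact (mul_one _).symm
  let β : LInftyGroup μ →L[ℝ] LInftyQuotient μ H :=
    ⟨⟨⟨α, hadd⟩, hsmul⟩, continuous_of_bound α hadd hsmul 1 fun F => by simpa using hαn F⟩
  refine ⟨β, fun ψ F => ?_, hone, hα0, ?_⟩
  · change α _ = LInfty.conv ψ (α F)
    refine LInfty.pair_injective (ContinuousLinearMap.ext fun φ => ?_)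
    rw [hpair, LInfty.pair_conv, hpair]
    refine congrArg m (Cbru.ext_apply fun x => ?_)
    rw [leftCoefficient_apply, leftCoefficient_apply, LInfty.pair_conv, translateLOne_conv]
  · have hnorm : ‖β‖ = sInf {c : ℝ | 0 ≤ c ∧ ∀ F, ‖β F‖ ≤ c * ‖F‖} := rfl
    rw [hnorm]
    refine IsLeast.csInf_eq ⟨⟨zero_le_one, fun F => (hαn F).trans_eq (one_mul _).symm⟩, ?_⟩
    rintro c ⟨hc, h⟩
    calc (1 : ℝ) ≤ ‖β (LInfty.one _ μ)‖ := (one_le_norm_one _).trans_eq (congrArg _ hone.symm)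
      _ ≤ c * ‖LInfty.one (1 : G) μ‖ := h _
      _ ≤ c * 1 := mul_le_mul_of_nonneg_left (norm_one_le _) hc
      _ = c := mul_one c

end Maps

/-! ### Integration over the fibres `x H` -/

section Fibres

variable {G : Type u} [Group G] [TopologicalSpace G] [IsTopologicalGroup G]
  [LocallyCompactSpace G] [T2Space G] [MeasurableSpace G] [BorelSpace G]
  {μ : Measure G} [μ.IsHaarMeasure] [μ.Regular]
  {H : Subgroup G} (hH : IsClosed (H : Set G)) (ν : Measure H) [ν.IsHaarMeasure] [ν.Regular]

/-- The quotient of the modular characters of `H` and `G`, the weight in the definition of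
`fibreIntegral`. -/
def fibreWeight [LocallyCompactSpace H] (h : H) : ℝ := modChar h / modChar (h : G)

section Weight

variable [LocallyCompactSpace H]

theorem fibreWeight_pos (h : H) : 0 < fibreWeight h := div_pos (modChar_pos _) (modChar_pos _)

theorem fibreWeight_mul (h k : H) : fibreWeight (h * k) = fibreWeight h * fibreWeight k := by
  simp only [fibreWeight, modChar_mul, Subgroup.coe_mul]
  rw [mul_div_mul_comm]

theorem continuous_fibreWeight : Continuous (fibreWeight : H → ℝ) :=
  continuous_modChar.div (continuous_modChar.comp continuous_subtype_val)
    fun h => (modChar_pos (h : G)).ne'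

end Weight

include hH in
theorem isCompact_setOf_mul_mem {K L : Set G} (hK : IsCompact K) (hL : IsCompact L) :
    IsCompact {h : H | ∃ x ∈ K, x * h ∈ L} := by
  have hc : IsCompact ((fun p : G × G => p.1⁻¹ * p.2) '' (K ×ˢ L)) :=
    (hK.prod hL).image (by fun_prop)
  have : {h : H | ∃ x ∈ K, x * h ∈ L} =
      Subtype.val ⁻¹' ((fun p : G × G => p.1⁻¹ * p.2) '' (K ×ˢ L)) := by
    ext h
    constructor
    · rintro ⟨x, hx, hxh⟩
      exact ⟨(x, x * h), ⟨hx, hxh⟩, by simp⟩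
    · rintro ⟨⟨x, y⟩, ⟨hx, hy⟩, hxy⟩
      refine ⟨x, hx, ?_⟩
      rw [← hxy]
      simpa using hy
  rw [this]
  exact hH.isClosedEmbedding_subtypeVal.isCompact_preimage hc

include hH in
theorem hasCompactSupport_fibre (q : C_c(G, ℝ)) (k : H → ℝ) (x : G) :
    HasCompactSupport fun h : H => q (x * h) * k h := by
  refine HasCompactSupport.intro
    (isCompact_setOf_mul_mem hH isCompact_singleton q.hasCompactSupport.isCompact (K := {x})) ?_
  intro h hh
  rw [image_eq_zero_of_notMem_tsupport fun hq => hh ⟨x, rfl, hq⟩, zero_mul]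

include hH in
theorem integrable_fibre (q : C_c(G, ℝ)) {k : H → ℝ} (hk : Continuous k) (x : G) :
    Integrable (fun h : H => q (x * h) * k h) ν := by
  have := q.continuous
  exact Continuous.integrable_of_hasCompactSupport (by fun_prop) (hasCompactSupport_fibre hH q k x)

include hH in
theorem continuous_integral_fibre (q : C_c(G, ℝ)) {k : H → ℝ} (hk : Continuous k) :
    Continuous fun x => ∫ h : H, q (x * h) * k h ∂ν := by
  refine continuous_iff_continuousAt.2 fun x₀ => ?_
  obtain ⟨V, hV, hVx⟩ := exists_compact_mem_nhds x₀
  have hq := q.continuous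
  refine (continuousOn_integral_of_compact_support (s := V)
    (isCompact_setOf_mul_mem hH hV q.hasCompactSupport.isCompact) ?_ ?_).continuousAt hVx
  · refine Continuous.continuousOn ?_
    simp only [Function.uncurry_def]
    fun_prop
  · intro x h hx hh
    rw [image_eq_zero_of_notMem_tsupport fun hq => hh ⟨x, hx, hq⟩, zero_mul]

/-- The sum `∫_H q(xh) dh` of `q` over the fibre `x H`. -/
def fibreSum (q : C_c(G, ℝ)) (x : G) : ℝ := ∫ h : H, q (x * h) ∂ν

/-- The weighted sum of `q` over the fibre `x H`, as in `fibreIntegral`. -/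
def fibreWeightedSum [LocallyCompactSpace H] (q : C_c(G, ℝ)) (x : G) : ℝ :=
  ∫ h : H, q (x * h) * fibreWeight h ∂ν

include hH in
theorem continuous_fibreSum (q : C_c(G, ℝ)) : Continuous (fibreSum ν q) := by
  have := continuous_integral_fibre hH ν q (continuous_const (y := (1 : ℝ)))
  simp only [mul_one] at this
  exact this

theorem fibreSum_mul (q : C_c(G, ℝ)) (x : G) (h : H) : fibreSum ν q (x * h) = fibreSum ν q x := by
  have := integral_mul_left_eq_self (μ := ν) (fun k : H => q (x * k)) h
  simpa only [fibreSum, mul_assoc, Subgroup.coe_mul] using this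

include hH in
theorem exists_abs_fibreSum_le (q : C_c(G, ℝ)) : ∃ M : ℝ, 0 ≤ M ∧ ∀ x, |fibreSum ν q x| ≤ M := by
  obtain ⟨M, hM⟩ := (q.hasCompactSupport.isCompact.image
    (continuous_fibreSum hH ν q).abs).bddAbove
  refine ⟨max M 0, le_max_right _ _, fun x => ?_⟩
  by_cases hx : ∃ h : H, x * h ∈ tsupport q
  · obtain ⟨h, hh⟩ := hx
    rw [← fibreSum_mul ν q x h]
    exact (hM ⟨_, hh, rfl⟩).trans (le_max_left _ _)
  · have : fibreSum ν q x = 0 := by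
      refine integral_eq_zero_of_ae (ae_of_all _ fun h => ?_)
      exact image_eq_zero_of_notMem_tsupport fun hq => hx ⟨h, hq⟩
    simp [this]

variable [LocallyCompactSpace H]

include hH in
theorem continuous_fibreWeightedSum (q : C_c(G, ℝ)) : Continuous (fibreWeightedSum ν q) :=
  continuous_integral_fibre hH ν q continuous_fibreWeight

include hH in
/-- The adjunction between the weighted sums `T` and the sums `S` over fibres:
`∫ χ · T f = ∫ f · S χ`. -/
theorem integral_mul_fibreWeightedSum (χ f : C_c(G, ℝ)) :
    ∫ x, χ x * fibreWeightedSum ν f x ∂μ = ∫ y, f y * fibreSum ν χ y ∂μ := by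
  have hχ := χ.continuous
  have hf := f.continuous
  have hw : Continuous (fibreWeight : H → ℝ) := continuous_fibreWeight
  have hm : Continuous (modChar : H → ℝ) := continuous_modChar
  have hχc := χ.hasCompactSupport.isCompact
  have hfc := f.hasCompactSupport.isCompact
  calc ∫ x, χ x * fibreWeightedSum ν f x ∂μ
      = ∫ x, ∫ h : H, χ x * (f (x * h) * fibreWeight h) ∂ν ∂μ := by
        simp only [fibreWeightedSum, integral_const_mul]
    _ = ∫ h : H, ∫ x, χ x * (f (x * h) * fibreWeight h) ∂μ ∂ν := by
        refine integral_integral_swap_of_hasCompactSupport ?_ ?_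
        · simp only [Function.uncurry_def]
          fun_prop
        · refine HasCompactSupport.intro (hχc.prod (isCompact_setOf_mul_mem hH hχc hfc)) ?_
          rintro ⟨x, h⟩ hxh
          simp only [Function.uncurry_apply_pair]
          by_cases hx : x ∈ tsupport χ
          · rw [image_eq_zero_of_notMem_tsupport (f := f)
              fun hq => hxh ⟨hx, x, hx, hq⟩, zero_mul, mul_zero]
          · rw [image_eq_zero_of_notMem_tsupport hx, zero_mul]
    _ = ∫ h : H, ∫ y, f y * (χ (y * ((h⁻¹ : H) : G)) * modChar h) ∂μ ∂ν := by
        refine integral_congr_ae (ae_of_all _ fun h => ?_)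
        have h1 := integral_mul_right μ (fun y => f y * (χ (y * ((h⁻¹ : H) : G)) * fibreWeight h))
          (h : G)
        simp only [Subgroup.coe_inv, mul_inv_cancel_right] at h1
        calc ∫ x, χ x * (f (x * h) * fibreWeight h) ∂μ
            = ∫ x, f (x * h) * (χ x * fibreWeight h) ∂μ := by
              simp only [mul_left_comm]
          _ = modChar (h : G) * ∫ y, f y * (χ (y * (h : G)⁻¹) * fibreWeight h) ∂μ := h1
          _ = _ := by
              rw [← integral_const_mul]
              refine integral_congr_ae (ae_of_all _ fun y => ?_)
              have := (modChar_pos (h : G)).ne'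
              simp only [fibreWeight, Subgroup.coe_inv]
              field_simp
    _ = ∫ y, ∫ h : H, f y * (χ (y * ((h⁻¹ : H) : G)) * modChar h) ∂ν ∂μ := by
        refine integral_integral_swap_of_hasCompactSupport ?_ ?_
        · simp only [Function.uncurry_def]
          fun_prop
        · refine HasCompactSupport.intro
            ((isCompact_setOf_mul_mem hH hfc hχc).inv.prod hfc) ?_
          rintro ⟨h, y⟩ hhy
          simp only [Function.uncurry_apply_pair]
          by_cases hy : y ∈ tsupport f
          · rw [image_eq_zero_of_notMem_tsupport (f := χ)
              fun hq => hhy ⟨⟨y, hy, hq⟩, hy⟩, zero_mul, mul_zero]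
          · rw [image_eq_zero_of_notMem_tsupport hy, zero_mul]
    _ = ∫ y, f y * fibreSum ν χ y ∂μ := by
        refine integral_congr_ae (ae_of_all _ fun y => ?_)
        simp only [integral_const_mul]
        congr 1
        have hc := hasCompactSupport_fibre hH χ (fun _ => 1) y
        simp only [mul_one] at hc
        exact integral_inv_mul_modChar ν (f := fun h : H => χ (y * h)) (by fun_prop) hc

end Fibres

/-! ### Null sets and fibres -/

section NullFibres

variable {G : Type u} [Group G] [TopologicalSpace G] [IsTopologicalGroup G]
  [LocallyCompactSpace G] [T2Space G] [MeasurableSpace G] [BorelSpace G]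
  {μ : Measure G} [μ.IsHaarMeasure] [μ.Regular]
  {H : Subgroup G} (hH : IsClosed (H : Set G)) (ν : Measure H) [ν.IsHaarMeasure] [ν.Regular]

/-- Weighted inner regularity of open sets: the parts of an open set where the weight is bounded
and bounded away from zero are open. -/
theorem exists_isCompact_lt_setLIntegral {Y : Type*} [TopologicalSpace Y] [T2Space Y]
    [MeasurableSpace Y] [BorelSpace Y] {ν : Measure Y} [ν.Regular] {k : Y → ℝ≥0}
    (hk : Continuous k) (hk0 : ∀ y, 0 < k y) {V : Set Y} (hV : IsOpen V) {t : ℝ≥0}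
    (ht : (t : ℝ≥0∞) < ∫⁻ y in V, k y ∂ν) :
    ∃ C ⊆ V, IsCompact C ∧ (t : ℝ≥0∞) < ∫⁻ y in C, k y ∂ν := by
  let W : ℕ → Set Y := fun n => V ∩ {y : Y | ((n : ℝ≥0) + 1)⁻¹ < k y ∧ k y < (n : ℝ≥0) + 1}
  have hWo : ∀ n, IsOpen (W n) := fun n => by
    have h1 : IsOpen {y | ((n : ℝ≥0) + 1)⁻¹ < k y} := isOpen_lt continuous_const hk
    have h2 : IsOpen {y | k y < (n : ℝ≥0) + 1} := isOpen_lt hk continuous_const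
    exact hV.inter (h1.inter h2)
  have hWmono : Monotone W := by
    rintro n m hnm y ⟨hyV, h1, h2⟩
    have hnm' : (n : ℝ≥0) ≤ m := by exact_mod_cast hnm
    exact ⟨hyV, lt_of_le_of_lt (by gcongr) h1, h2.trans_le (by gcongr)⟩
  have hWV : ⋃ n, W n = V := by
    refine Set.Subset.antisymm (Set.iUnion_subset fun n => Set.inter_subset_left) fun y hy => ?_
    obtain ⟨n, hn⟩ := exists_nat_gt (max (k y) (k y)⁻¹)
    have hn1 : k y < n + 1 := ((le_max_left _ _).trans_lt hn).trans (lt_add_one _)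
    have hn2 : (k y)⁻¹ < n + 1 := ((le_max_right _ _).trans_lt hn).trans (lt_add_one _)
    exact Set.mem_iUnion.2 ⟨n, hy, inv_lt_of_inv_lt₀ (hk0 y) hn2, hn1⟩
  obtain ⟨n, hn⟩ : ∃ n, (t : ℝ≥0∞) < ∫⁻ y in W n, k y ∂ν := by
    rw [← hWV, setLIntegral_iUnion_of_directed _ hWmono.directed_le] at ht
    exact lt_iSup_iff.1 ht
  have hn0 : ((n : ℝ≥0) + 1) ≠ 0 := by positivity
  by_cases hfin : ν (W n) = ∞
  · obtain ⟨C, hCW, hC, hCt⟩ := (hWo n).exists_lt_isCompact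
      (r := ((t * (n + 1) : ℝ≥0) : ℝ≥0∞)) (by rw [hfin]; exact ENNReal.coe_lt_top)
    refine ⟨C, hCW.trans Set.inter_subset_left, hC, ?_⟩
    calc (t : ℝ≥0∞) = (((n : ℝ≥0) + 1)⁻¹ : ℝ≥0) * ((t * (n + 1) : ℝ≥0) : ℝ≥0∞) := by
          rw [← ENNReal.coe_mul]
          congr 1
          field_simp
      _ < (((n : ℝ≥0) + 1)⁻¹ : ℝ≥0) * ν C :=
          ENNReal.mul_lt_mul_right (by simp) ENNReal.coe_ne_top hCt
      _ = ∫⁻ _ in C, (((n : ℝ≥0) + 1)⁻¹ : ℝ≥0) ∂ν := by rw [setLIntegral_const]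
      _ ≤ ∫⁻ y in C, k y ∂ν :=
          setLIntegral_mono hk.measurable.coe_nnreal_ennreal fun y hy =>
            ENNReal.coe_le_coe.2 (hCW hy).2.1.le
  · have hlt : ∫⁻ y in W n, k y ∂ν ≠ ∞ := by
      refine ne_of_lt (lt_of_le_of_lt (setLIntegral_mono (g := fun _ => ((n + 1 : ℝ≥0) : ℝ≥0∞))
        measurable_const fun y hy => ENNReal.coe_le_coe.2 hy.2.2.le) ?_)
      rw [setLIntegral_const]
      exact ENNReal.mul_lt_top ENNReal.coe_lt_top (lt_top_iff_ne_top.2 hfin)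
    obtain ⟨δ, hδ, hδt⟩ := exists_pos_setLIntegral_lt_of_measure_lt
      (μ := ν.restrict (W n)) (f := fun y => (k y : ℝ≥0∞)) hlt
      (ε := ∫⁻ y in W n, k y ∂ν - t) (tsub_pos_of_lt hn).ne'
    obtain ⟨C, hCW, hC, hCδ⟩ := (hWo n).measurableSet.exists_isCompact_sdiff_lt hfin hδ.ne'
    refine ⟨C, hCW.trans Set.inter_subset_left, hC, ?_⟩
    have h1 : ∫⁻ y in W n \ C, k y ∂ν < ∫⁻ y in W n, k y ∂ν - t := by
      have := hδt (W n \ C) (by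
        refine lt_of_le_of_lt (Measure.restrict_apply_le _ _) hCδ)
      rwa [Measure.restrict_restrict_of_subset Set.sdiff_subset] at this
    have h2 := lintegral_union_le (μ := ν) (fun y => (k y : ℝ≥0∞)) C (W n \ C)
    rw [Set.union_sdiff_cancel hCW] at h2
    by_contra hcon
    push Not at hcon
    have h3 : ∫⁻ y in W n, k y ∂ν < t + (∫⁻ y in W n, k y ∂ν - t) := by
      refine h2.trans_lt ?_
      exact ENNReal.add_lt_add_of_le_of_lt (ne_top_of_le_ne_top ENNReal.coe_ne_top hcon) hcon h1
    rw [add_tsub_cancel_of_le hn.le] at h3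
    exact lt_irrefl _ h3

variable [LocallyCompactSpace H]

include hH in
/-- The weighted measure of the fibres of an open set `U` exceeds `t` only on a small part of a
compact set `K`, by the adjunction formula applied to compactly supported continuous functions
below the indicator function of `U`. -/
theorem measure_setOf_lt_fibre_le {K : Set G} (hK : IsCompact K) :
    ∃ M : ℝ≥0, ∀ (t : ℝ≥0) (U : Set G), IsOpen U → μ U ≠ ∞ →
      t * μ {x ∈ K | (t : ℝ≥0∞) < ∫⁻ h in {h : H | x * h ∈ U}, ENNReal.ofReal (fibreWeight h) ∂ν} ≤
        M * μ U := by
  obtain ⟨χ, χ1, -, χc, χ01⟩ := exists_continuous_one_zero_of_isCompact hK isClosed_empty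
    (Set.disjoint_empty K)
  let χ' : C_c(G, ℝ) := ⟨χ, χc⟩
  obtain ⟨M, hM0, hM⟩ := exists_abs_fibreSum_le hH ν χ'
  refine ⟨M.toNNReal, fun t U hU hUfin => ?_⟩
  let P : C_c(G, ℝ) → Prop := fun f => ∀ x, 0 ≤ f x ∧ f x ≤ U.indicator 1 x
  have hint : ∀ (f : C_c(G, ℝ)) (x : G), Integrable (fun h : H => f (x * h) * fibreWeight h) ν :=
    fun f x => integrable_fibre hH ν f continuous_fibreWeight x
  -- The integral of a function `f` in `P` is bounded on compact sets where the sums are large.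
  have hP : ∀ f, P f → ∀ C ⊆ K, IsCompact C → (∀ x ∈ C, (t : ℝ) < fibreWeightedSum ν f x) →
      t * μ C ≤ M.toNNReal * μ U := by
    intro f hf C hCK hC hCt
    have hT0 : ∀ x, 0 ≤ fibreWeightedSum ν f x := fun x =>
      integral_nonneg fun h => mul_nonneg (hf _).1 (fibreWeight_pos h).le
    have h1 : t * μ.real C ≤ ∫ x, χ' x * fibreWeightedSum ν f x ∂μ := by
      have h2 : ∫ x, C.indicator (fun _ => (t : ℝ)) x ∂μ = t * μ.real C := by
        rw [integral_indicator hC.measurableSet, setIntegral_const, smul_eq_mul, mul_comm]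
      rw [← h2]
      refine integral_mono ((integrable_indicator_iff hC.measurableSet).2
        (integrableOn_const hC.measure_lt_top.ne)) ?_ fun x => ?_
      · exact Continuous.integrable_of_hasCompactSupport
          (χ.continuous.mul (continuous_fibreWeightedSum hH ν f)) χc.mul_right
      · by_cases hx : x ∈ C
        · have : χ x = 1 := χ1 (hCK hx)
          change _ ≤ χ x * _
          rw [Set.indicator_of_mem hx, this, one_mul]
          exact (hCt x hx).le
        · rw [Set.indicator_of_notMem hx]
          exact mul_nonneg (χ01 x).1 (hT0 x)
    have h3 : ∫ x, χ' x * fibreWeightedSum ν f x ∂μ ≤ M * μ.real U := by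
      rw [integral_mul_fibreWeightedSum hH]
      have h2 : ∫ x, U.indicator (fun _ => M) x ∂μ = M * μ.real U := by
        rw [integral_indicator hU.measurableSet, setIntegral_const, smul_eq_mul, mul_comm]
      rw [← h2]
      refine integral_mono (Continuous.integrable_of_hasCompactSupport
        (f.continuous.mul (continuous_fibreSum hH ν χ')) f.hasCompactSupport.mul_right)
        ((integrable_indicator_iff hU.measurableSet).2 (integrableOn_const hUfin)) fun x => ?_
      have h4 := hf x
      by_cases hx : x ∈ U
      · simp only [Set.indicator_of_mem hx, Pi.one_apply] at h4 ⊢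
        exact (mul_le_mul_of_nonneg_left ((le_abs_self _).trans (hM x)) h4.1).trans
          (mul_le_of_le_one_left hM0 h4.2)
      · simp only [Set.indicator_of_notMem hx] at h4 ⊢
        rw [le_antisymm h4.2 h4.1, zero_mul]
    have h5 := ENNReal.ofReal_le_ofReal (h1.trans h3)
    rwa [ENNReal.ofReal_mul t.coe_nonneg, ENNReal.ofReal_mul hM0,
      ofReal_measureReal hC.measure_lt_top.ne, ofReal_measureReal hUfin,
      ENNReal.ofReal_coe_nnreal] at h5
  -- The set `A` is the union of the open sets `{x | t < T f x}` over the functions `f` in `P`, so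
  -- that a compact subset is covered by one of them.
  set A : Set G := {x | (t : ℝ≥0∞) <
    ∫⁻ h in {h : H | x * h ∈ U}, ENNReal.ofReal (fibreWeight h) ∂ν} with hA
  have hTlint : ∀ f, P f → ∀ x, ENNReal.ofReal (fibreWeightedSum ν f x) =
      ∫⁻ h : H, ENNReal.ofReal (f (x * h) * fibreWeight h) ∂ν := fun f hf x =>
    ofReal_integral_eq_lintegral_ofReal (hint f x)
      (ae_of_all _ fun h => mul_nonneg (hf _).1 (fibreWeight_pos h).le)
  have hw : Continuous fun h : H => (fibreWeight h).toNNReal :=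
    continuous_real_toNNReal.comp continuous_fibreWeight
  have hUx : ∀ x : G, IsOpen {h : H | x * h ∈ U} := fun x =>
    hU.preimage (continuous_const.mul continuous_subtype_val)
  have hAP : ∀ x ∈ A, ∃ f, P f ∧ (t : ℝ) < fibreWeightedSum ν f x := by
    intro x hx
    obtain ⟨C, hCU, hC, hCt⟩ := exists_isCompact_lt_setLIntegral hw
      (fun h => Real.toNNReal_pos.2 (fibreWeight_pos h)) (hUx x) hx
    obtain ⟨f, f1, f0, fc, f01⟩ := exists_continuous_one_zero_of_isCompact
      (hC.image (continuous_const.mul continuous_subtype_val : Continuous fun h : H => x * (h : G)))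
      hU.isClosed_compl (Set.disjoint_compl_right_iff_subset.2 (by
        rintro _ ⟨h, hh, rfl⟩
        exact hCU hh))
    have hf : P ⟨f, fc⟩ := fun y => ⟨(f01 y).1, by
      by_cases hy : y ∈ U
      · rw [Set.indicator_of_mem hy]
        exact (f01 y).2
      · rw [Set.indicator_of_notMem hy]
        exact (f0 hy).le⟩
    refine ⟨⟨f, fc⟩, hf, ?_⟩
    rw [← ENNReal.ofReal_lt_ofReal_iff_of_nonneg t.coe_nonneg, ENNReal.ofReal_coe_nnreal,
      hTlint _ hf]
    refine hCt.trans_le ?_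
    rw [← lintegral_indicator hC.measurableSet]
    refine lintegral_mono fun h => ?_
    by_cases hh : h ∈ C
    · have : f (x * h) = 1 := f1 ⟨h, hh, rfl⟩
      rw [Set.indicator_of_mem hh]
      change _ ≤ ENNReal.ofReal (f (x * h) * fibreWeight h)
      rw [this, one_mul]
      exact le_rfl
    · rw [Set.indicator_of_notMem hh]
      exact zero_le
  have hPA : ∀ f, P f → ∀ x, (t : ℝ) < fibreWeightedSum ν f x → x ∈ A := by
    intro f hf x hx
    rw [← ENNReal.ofReal_lt_ofReal_iff_of_nonneg t.coe_nonneg, ENNReal.ofReal_coe_nnreal,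
      hTlint _ hf] at hx
    refine hx.trans_le ?_
    rw [← lintegral_indicator (hUx x).measurableSet]
    refine lintegral_mono fun h => ?_
    have h4 := (hf (x * h)).2
    by_cases hh : x * (h : G) ∈ U
    · rw [Set.indicator_of_mem (show h ∈ {h : H | x * h ∈ U} from hh)]
      rw [Set.indicator_of_mem hh] at h4
      exact ENNReal.ofReal_le_ofReal (mul_le_of_le_one_left (fibreWeight_pos h).le h4)
    · rw [Set.indicator_of_notMem hh] at h4
      rw [ENNReal.ofReal_of_nonpos (mul_nonpos_of_nonpos_of_nonneg h4 (fibreWeight_pos h).le)]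
      exact zero_le
  have hAo : IsOpen A := by
    refine isOpen_iff_mem_nhds.2 fun x hx => ?_
    obtain ⟨f, hf, hfx⟩ := hAP x hx
    filter_upwards [(continuous_fibreWeightedSum hH ν f).continuousAt.eventually_const_lt hfx]
      with y hy
    exact hPA f hf y hy
  have hmeas : MeasurableSet (K ∩ A) := hK.measurableSet.inter hAo.measurableSet
  change t * μ (K ∩ A) ≤ _
  rw [hmeas.measure_eq_iSup_isCompact_of_ne_top
    (measure_inter_ne_top_of_left_ne_top hK.measure_lt_top.ne)]
  simp only [ENNReal.mul_iSup]
  refine iSup_le fun C => iSup_le fun hCKA => iSup_le fun hC => ?_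
  obtain ⟨f, hf, hfC⟩ : ∃ f, P f ∧ ∀ x ∈ C, (t : ℝ) < fibreWeightedSum ν f x := by
    refine hC.induction_on (p := fun s => ∃ f, P f ∧ ∀ x ∈ s, (t : ℝ) < fibreWeightedSum ν f x)
      ?_ ?_ ?_ ?_
    · exact ⟨0, fun x => ⟨le_rfl, Set.indicator_nonneg (fun _ _ => zero_le_one) x⟩, fun x hx =>
        absurd hx (Set.notMem_empty x)⟩
    · rintro s s' hss ⟨f, hf, h⟩
      exact ⟨f, hf, fun x hx => h x (hss hx)⟩
    · rintro s s' ⟨f, hf, h⟩ ⟨f', hf', h'⟩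
      let g : C_c(G, ℝ) := ⟨⟨fun x => max (f x) (f' x), f.continuous.max f'.continuous⟩,
        HasCompactSupport.intro (f.hasCompactSupport.isCompact.union f'.hasCompactSupport.isCompact)
          fun x hx => by
            change max (f x) (f' x) = 0
            rw [image_eq_zero_of_notMem_tsupport fun h => hx (Or.inl h),
              image_eq_zero_of_notMem_tsupport fun h => hx (Or.inr h), max_self]⟩
      refine ⟨g, fun x => ⟨(hf x).1.trans (le_max_left _ _), max_le (hf x).2 (hf' x).2⟩, ?_⟩
      rintro x (hx | hx)
      · refine (h x hx).trans_le (integral_mono (hint f x) (hint g x) fun k => ?_)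
        exact mul_le_mul_of_nonneg_right (le_max_left _ _) (fibreWeight_pos k).le
      · refine (h' x hx).trans_le (integral_mono (hint f' x) (hint g x) fun k => ?_)
        exact mul_le_mul_of_nonneg_right (le_max_right _ _) (fibreWeight_pos k).le
    · intro x hx
      obtain ⟨f, hf, hfx⟩ := hAP x (hCKA hx).2
      exact ⟨_, mem_nhdsWithin_of_mem_nhds
        ((continuous_fibreWeightedSum hH ν f).continuousAt.eventually_const_lt hfx), f, hf,
        fun y hy => hy⟩
  exact hP f hf C (hCKA.trans Set.inter_subset_left) hC hfC

include hH in
/-- A null set meets the fibres `x H` in null sets, except for a locally null set of `x`. -/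
theorem locallyNull_setOf_fibre {N : Set G} (hN : μ N = 0) :
    LocallyNull μ {x | ν {h : H | x * h ∈ N} ≠ 0} := by
  intro K hK
  obtain ⟨M, hM⟩ := measure_setOf_lt_fibre_le (μ := μ) hH ν hK
  set N' := toMeasurable μ N with hN'
  have hN'0 : μ N' = 0 := by rw [hN', measure_toMeasurable, hN]
  let B : ℕ → Set G := fun n => {x ∈ K | (((n : ℝ≥0) + 1)⁻¹ : ℝ≥0) <
    ∫⁻ h in {h : H | x * h ∈ N'}, ENNReal.ofReal (fibreWeight h) ∂ν}
  have hB : ∀ n, μ (B n) = 0 := by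
    intro n
    have hn0 : ((((n : ℝ≥0) + 1)⁻¹ : ℝ≥0) : ℝ≥0∞) ≠ 0 := by simp
    have hle : (((n : ℝ≥0) + 1)⁻¹ : ℝ≥0) * μ (B n) ≤ 0 := by
      refine le_of_forall_pos_le_add fun ε hε => ?_
      rw [zero_add]
      obtain ⟨U, hNU, hU, hUε⟩ := N'.exists_isOpen_lt_of_lt (μ := μ) (ε / (M + 1)) (by
        rw [hN'0]
        exact ENNReal.div_pos hε.ne' (by simp))
      refine le_trans ?_ ((hM ((n : ℝ≥0) + 1)⁻¹ U hU (hUε.trans_le le_top).ne).trans ?_)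
      · refine mul_le_mul_right (measure_mono ?_) _
        rintro x ⟨hxK, hx⟩
        exact ⟨hxK, hx.trans_le (lintegral_mono_set fun h hh => hNU hh)⟩
      · calc (M : ℝ≥0∞) * μ U ≤ (M + 1) * (ε / (M + 1)) := by
              gcongr
              exact le_self_add
          _ ≤ ε := ENNReal.mul_div_le
    simpa [hn0] using hle
  refine measure_mono_null ?_ (measure_iUnion_null hB)
  rintro x ⟨hx, hxK⟩
  have hpos : 0 < ∫⁻ h in {h : H | x * h ∈ N'}, ENNReal.ofReal (fibreWeight h) ∂ν := by
    refine (setLIntegral_pos_iff (continuous_fibreWeight.measurable.ennreal_ofReal)).2 ?_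
    refine pos_iff_ne_zero.2 fun h0 => hx (measure_mono_null ?_ h0)
    exact fun h hh => Set.mem_inter (ENNReal.ofReal_pos.2 (fibreWeight_pos h)).ne'
      (subset_toMeasurable μ N hh)
  obtain ⟨n, hn⟩ := ENNReal.exists_inv_nat_lt hpos.ne'
  refine Set.mem_iUnion.2 ⟨n, hxK, lt_of_le_of_lt ?_ hn⟩
  rw [ENNReal.coe_inv (by positivity)]
  exact ENNReal.inv_le_inv.2 (by push_cast; exact le_self_add)

end NullFibres

/-! ### The annihilator of `J¹(G, H)` -/

section Annihilator

variable {G : Type u} [Group G] [TopologicalSpace G] [IsTopologicalGroup G]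
  [LocallyCompactSpace G] [T2Space G] [MeasurableSpace G] [BorelSpace G]
  {μ : Measure G} [μ.IsHaarMeasure] [μ.Regular]
  {H : Subgroup G} (hH : IsClosed (H : Set G)) (ν : Measure H) [ν.IsHaarMeasure] [ν.Regular]
  [LocallyCompactSpace H]

theorem fibreIntegral_eq (φ : LOne μ) (x : G) :
    fibreIntegral μ ν hH φ x = ∫ h : H, φ (x * h) * fibreWeight h ∂ν := rfl

/-- Right translation by elements of `H` does not change the integrals over the fibres `x H`. -/
theorem rightTranslate_sub_mem_JOne (q : C_c(G, ℝ)) (h : H) :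
    rightTranslate μ (h : G)⁻¹ (toLOne μ q) - toLOne μ q ∈ JOne μ ν hH := by
  set φ := rightTranslate μ (h : G)⁻¹ (toLOne μ q) - toLOne μ q with hφ
  have hae : ∀ᵐ x ∂μ, φ x = modChar (h : G)⁻¹ * q (x * h) - q x := by
    filter_upwards [Lp.coeFn_sub (rightTranslate μ (h : G)⁻¹ (toLOne μ q)) (toLOne μ q),
      coeFn_rightTranslate (h : G)⁻¹ (toLOne μ q), coeFn_toLOne (μ := μ) q,
      ae_mul_right (coeFn_toLOne (μ := μ) q) (h : G)] with x h1 h2 h3 h4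
    rw [h1, Pi.sub_apply, h2, h3, inv_inv, h4]
  intro K hK
  refine measure_mono_null ?_ (locallyNull_setOf_fibre hH ν hae K hK)
  rintro x ⟨hx, hxK⟩
  refine ⟨fun h0 => hx ?_, hxK⟩
  have hq := fun x => integrable_fibre hH ν q (continuous_fibreWeight (H := H)) x
  -- The substitution `k ↦ k h` in the integral over the fibre.
  have hsub : ∫ k : H, q (x * k * h) * fibreWeight k ∂ν =
      modChar (h : G) * fibreWeightedSum ν q x := by
    have h1 := integral_mul_right ν (fun k : H => q (x * k) * fibreWeight k) h
    simp only [Subgroup.coe_mul, fibreWeight_mul, ← mul_assoc, integral_mul_const,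
      smul_eq_mul] at h1
    rw [← mul_right_cancel_iff_of_pos (fibreWeight_pos h), h1, fibreWeightedSum]
    have := (modChar_pos (h : G)).ne'
    simp only [fibreWeight]
    field_simp
  have hqh : Integrable (fun k : H => q (x * k * h) * fibreWeight k) ν := by
    have hc : HasCompactSupport fun y => q (y * h) :=
      q.hasCompactSupport.comp_homeomorph (Homeomorph.mulRight (h : G))
    exact integrable_fibre hH ν ⟨⟨fun y => q (y * h), by fun_prop⟩, hc⟩ continuous_fibreWeight x
  have h0' : ∀ᵐ k : H ∂ν, φ (x * k) = modChar (h : G)⁻¹ * q (x * k * h) - q (x * k) := h0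
  calc fibreIntegral μ ν hH φ x
      = ∫ k : H, (modChar (h : G)⁻¹ * (q (x * k * h) * fibreWeight k) -
          q (x * k) * fibreWeight k) ∂ν := by
        rw [fibreIntegral_eq]
        refine integral_congr_ae (h0'.mono fun k hk => ?_)
        simp only [hk]
        ring
    _ = 0 := by
        rw [integral_sub (hqh.const_mul _) (hq x), integral_const_mul, hsub, ← mul_assoc,
          ← modChar_mul, inv_mul_cancel, modChar_one, one_mul, fibreWeightedSum, sub_self]

/-- The fibre integral of the limit of a sequence that converges almost everywhere. Only a bound by
the sum of the consecutive differences is needed, and this holds trivially where this sum is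
infinite. -/
theorem enorm_fibreWeightedSum_le {φ : LOne μ} {g d : ℕ → C_c(G, ℝ)}
    (hd : ∀ n x, d n x = |g (n + 1) x - g n x|) {x : G}
    (hx : ∀ᵐ h : H ∂ν, Tendsto (fun n => g n (x * h)) atTop (𝓝 (φ (x * h))))
    (hφ : fibreIntegral μ ν hH φ x = 0) :
    ‖fibreWeightedSum ν (g 0) x‖ₑ ≤ ∑' n, ENNReal.ofReal (fibreWeightedSum ν (d n) x) := by
  rcases eq_or_ne (∑' n, ENNReal.ofReal (fibreWeightedSum ν (d n) x)) ∞ with htop | htop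
  · rw [htop]
    exact le_top
  have hi := fun (f : C_c(G, ℝ)) => integrable_fibre hH ν f (continuous_fibreWeight (H := H)) x
  have hle : ∫⁻ h : H, ‖g 0 (x * h) * fibreWeight h - φ (x * h) * fibreWeight h‖ₑ ∂ν ≤
      ∑' n, ENNReal.ofReal (fibreWeightedSum ν (d n) x) := by
    calc ∫⁻ h : H, ‖g 0 (x * h) * fibreWeight h - φ (x * h) * fibreWeight h‖ₑ ∂ν
        ≤ ∫⁻ h : H, ∑' n, ENNReal.ofReal (d n (x * h) * fibreWeight h) ∂ν := by
          refine lintegral_mono_ae (hx.mono fun h hh => ?_)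
          rw [← edist_eq_enorm_sub]
          refine edist_le_tsum_of_edist_le_of_tendsto₀ (f := fun n => g n (x * h) * fibreWeight h)
            _ (fun n => ?_) (hh.mul_const _)
          rw [edist_comm, edist_eq_enorm_sub, ← sub_mul, Real.enorm_eq_ofReal_abs, abs_mul,
            abs_of_pos (fibreWeight_pos h), hd]
      _ = ∑' n, ∫⁻ h : H, ENNReal.ofReal (d n (x * h) * fibreWeight h) ∂ν :=
          lintegral_tsum fun n => (hi (d n)).aestronglyMeasurable.aemeasurable.ennreal_ofReal
      _ = _ := by
          refine tsum_congr fun n => ?_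
          refine (ofReal_integral_eq_lintegral_ofReal (hi (d n)) (ae_of_all _ fun h => ?_)).symm
          refine mul_nonneg ?_ (fibreWeight_pos h).le
          rw [hd]
          exact abs_nonneg _
  have hm : AEStronglyMeasurable (fun h : H => φ (x * h) * fibreWeight h) ν := by
    refine Measurable.aestronglyMeasurable (Measurable.mul ?_ continuous_fibreWeight.measurable)
    exact (Lp.stronglyMeasurable φ).measurable.comp (measurable_subtype_coe.const_mul x)
  have hint : Integrable (fun h : H => g 0 (x * h) * fibreWeight h - φ (x * h) * fibreWeight h) ν :=
    ⟨(hi (g 0)).aestronglyMeasurable.sub hm, hle.trans_lt (lt_top_iff_ne_top.2 htop)⟩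
  have hφi : Integrable (fun h : H => φ (x * h) * fibreWeight h) ν :=
    ((hi (g 0)).sub hint).congr (ae_of_all _ fun h => sub_sub_cancel _ _)
  have heq : fibreWeightedSum ν (g 0) x =
      ∫ h : H, (g 0 (x * h) * fibreWeight h - φ (x * h) * fibreWeight h) ∂ν := by
    rw [integral_sub (hi (g 0)) hφi, ← fibreIntegral_eq hH, hφ, sub_zero, fibreWeightedSum]
  rw [heq]
  exact (enorm_integral_le_lintegral_enorm _).trans hle

/-- A function in `J¹(G, H)` is approximated by compactly supported continuous functions with small
weighted fibre sums: for a rapidly convergent sequence `g n`, the fibre sum of `g 0` is bounded by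
those of the differences `|g (n + 1) - g n|`, whose integrals against `q` are controlled by the
adjunction formula. -/
theorem exists_cc_of_mem_JOne {φ : LOne μ} (hφ : φ ∈ JOne μ ν hH) {q : C_c(G, ℝ)}
    (hq : ∀ x, 0 ≤ q x) {M : ℝ} (hM : ∀ x, |fibreSum ν q x| ≤ M) {ε : ℝ} (hε : 0 < ε) :
    ∃ g : C_c(G, ℝ), ‖toLOne μ g - φ‖ ≤ ε ∧ ∫ x, q x * |fibreWeightedSum ν g x| ∂μ ≤ 4 * M * ε := by
  have hM0 : 0 ≤ M := (abs_nonneg _).trans (hM 1)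
  have hεn : ∀ n : ℕ, 0 < ε * (1 / 2) ^ n := fun n => by positivity
  choose g hg using fun n : ℕ => Metric.denseRange_iff.1 (denseRange_toLOne μ) φ _ (hεn n)
  have hgn : ∀ n, ‖toLOne μ (g n) - φ‖ ≤ ε * (1 / 2) ^ n := fun n => by
    rw [norm_sub_rev, ← dist_eq_norm]
    exact (hg n).le
  have hgae : ∀ n, ∀ᵐ x ∂μ, (toLOne μ (g n) - φ) x = g n x - φ x := fun n => by
    filter_upwards [Lp.coeFn_sub (toLOne μ (g n)) φ, coeFn_toLOne (μ := μ) (g n)] with x h1 h2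
    rw [h1, Pi.sub_apply, h2]
  have hconv : ∀ᵐ x ∂μ, Tendsto (fun n => g n x) atTop (𝓝 (φ x)) := by
    have h1 : ∫⁻ x, ∑' n, ‖(toLOne μ (g n) - φ) x‖ₑ ∂μ ≠ ∞ := by
      rw [lintegral_tsum fun n => (Lp.aestronglyMeasurable _).enorm]
      have h2 : ∀ n, ∫⁻ x, ‖(toLOne μ (g n) - φ) x‖ₑ ∂μ ≤ ENNReal.ofReal (ε * (1 / 2) ^ n) := by
        intro n
        rw [← eLpNorm_one_eq_lintegral_enorm, ← Lp.enorm_def, ← ofReal_norm]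
        exact ENNReal.ofReal_le_ofReal (hgn n)
      refine ne_top_of_le_ne_top ?_ (ENNReal.tsum_le_tsum h2)
      rw [← ENNReal.ofReal_tsum_of_nonneg (fun n => (hεn n).le)
        (summable_geometric_two.mul_left ε)]
      exact ENNReal.ofReal_ne_top
    filter_upwards [ae_lt_top' (AEMeasurable.tsum fun n =>
      (Lp.aestronglyMeasurable (toLOne μ (g n) - φ)).enorm) h1, ae_all_iff.2 hgae] with x h2 h3
    have h4 := ENNReal.tendsto_atTop_zero_of_tsum_ne_top h2.ne
    refine tendsto_iff_edist_tendsto_0.2 (h4.congr fun n => ?_)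
    rw [h3, edist_eq_enorm_sub]
  let d : ℕ → C_c(G, ℝ) := fun n => ⟨⟨fun x => |g (n + 1) x - g n x|, by fun_prop⟩,
    HasCompactSupport.intro ((g (n + 1)).hasCompactSupport.isCompact.union
      (g n).hasCompactSupport.isCompact) fun x hx => by
        change |g (n + 1) x - g n x| = 0
        rw [image_eq_zero_of_notMem_tsupport fun h => hx (Or.inl h),
          image_eq_zero_of_notMem_tsupport fun h => hx (Or.inr h), sub_self, abs_zero]⟩
  have hd : ∀ n x, d n x = |g (n + 1) x - g n x| := fun _ _ => rfl
  have hd0 : ∀ n x, 0 ≤ d n x := fun n x => abs_nonneg _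
  have hdint : ∀ n, ∫ x, d n x ∂μ ≤ 2 * ε * (1 / 2) ^ n := by
    intro n
    have h1 : ∫ x, d n x ∂μ = ‖toLOne μ (g (n + 1)) - toLOne μ (g n)‖ := by
      rw [L1.norm_eq_integral_norm]
      refine integral_congr_ae ?_
      filter_upwards [Lp.coeFn_sub (toLOne μ (g (n + 1))) (toLOne μ (g n)),
        coeFn_toLOne (μ := μ) (g n), coeFn_toLOne (μ := μ) (g (n + 1))] with x h1 h2 h3
      rw [h1, Pi.sub_apply, h2, h3, hd, Real.norm_eq_abs]
    have h2 : toLOne μ (g (n + 1)) - toLOne μ (g n) =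
        (toLOne μ (g (n + 1)) - φ) - (toLOne μ (g n) - φ) := (sub_sub_sub_cancel_right _ _ _).symm
    rw [h1, h2]
    refine (norm_sub_le _ _).trans ((add_le_add (hgn (n + 1)) (hgn n)).trans ?_)
    rw [pow_succ]
    nlinarith [hεn n]
  have hT0 : ∀ n x, 0 ≤ fibreWeightedSum ν (d n) x := fun n x =>
    integral_nonneg fun h => mul_nonneg (hd0 n _) (fibreWeight_pos h).le
  have hqT : ∀ f : C_c(G, ℝ), Integrable (fun x => q x * fibreWeightedSum ν f x) μ := fun f =>
    Continuous.integrable_of_hasCompactSupport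
      (q.continuous.mul (continuous_fibreWeightedSum hH ν f)) q.hasCompactSupport.mul_right
  refine ⟨g 0, by simpa using hgn 0, ?_⟩
  have key : ∫⁻ x, ENNReal.ofReal (q x * |fibreWeightedSum ν (g 0) x|) ∂μ ≤
      ENNReal.ofReal (4 * M * ε) := by
    calc ∫⁻ x, ENNReal.ofReal (q x * |fibreWeightedSum ν (g 0) x|) ∂μ
        ≤ ∫⁻ x, ∑' n, ENNReal.ofReal (q x * fibreWeightedSum ν (d n) x) ∂μ := by
          have h1 := locallyNull_setOf_fibre hH ν hconv _ q.hasCompactSupport.isCompact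
          have h2 := hφ _ q.hasCompactSupport.isCompact
          refine lintegral_mono_ae ?_
          filter_upwards [measure_eq_zero_iff_ae_notMem.1 h1, measure_eq_zero_iff_ae_notMem.1 h2]
            with x h3 h4
          by_cases hx : x ∈ tsupport q
          · have h5 := enorm_fibreWeightedSum_le hH ν hd (φ := φ) (x := x)
              (by by_contra h; exact h3 ⟨h, hx⟩) (by by_contra h; exact h4 ⟨h, hx⟩)
            simp only [ENNReal.ofReal_mul (hq x)]
            rw [ENNReal.tsum_mul_left, ← Real.enorm_eq_ofReal_abs]
            exact mul_le_mul_right h5 _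
          · rw [image_eq_zero_of_notMem_tsupport hx, zero_mul, ENNReal.ofReal_zero]
            exact zero_le
      _ = ∑' n, ∫⁻ x, ENNReal.ofReal (q x * fibreWeightedSum ν (d n) x) ∂μ :=
          lintegral_tsum fun n => (hqT (d n)).aestronglyMeasurable.aemeasurable.ennreal_ofReal
      _ ≤ ∑' n : ℕ, ENNReal.ofReal (2 * M * ε * (1 / 2) ^ n) := by
          refine ENNReal.tsum_le_tsum fun n => ?_
          rw [← ofReal_integral_eq_lintegral_ofReal (hqT (d n))
            (ae_of_all _ fun x => mul_nonneg (hq x) (hT0 n x)), integral_mul_fibreWeightedSum hH]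
          refine ENNReal.ofReal_le_ofReal ?_
          calc ∫ y, d n y * fibreSum ν q y ∂μ ≤ ∫ y, d n y * M ∂μ := by
                refine integral_mono (Continuous.integrable_of_hasCompactSupport
                  ((d n).continuous.mul (continuous_fibreSum hH ν q))
                  (d n).hasCompactSupport.mul_right) ((integrable_cc μ (d n)).mul_const M)
                  fun y => mul_le_mul_of_nonneg_left ((le_abs_self _).trans (hM y)) (hd0 n y)
            _ = (∫ y, d n y ∂μ) * M := integral_mul_const _ _
            _ ≤ 2 * ε * (1 / 2) ^ n * M := mul_le_mul_of_nonneg_right (hdint n) hM0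
            _ = 2 * M * ε * (1 / 2) ^ n := by ring
      _ = ENNReal.ofReal (4 * M * ε) := by
          rw [← ENNReal.ofReal_tsum_of_nonneg (fun n => by positivity)
            (summable_geometric_two.mul_left _), tsum_mul_left, tsum_geometric_two]
          congr 1
          ring
  rw [← ofReal_integral_eq_lintegral_ofReal _
    (ae_of_all _ fun x => mul_nonneg (hq x) (abs_nonneg _))] at key
  · exact (ENNReal.ofReal_le_ofReal_iff (by positivity)).1 key
  · exact Continuous.integrable_of_hasCompactSupport
      (q.continuous.mul (continuous_fibreWeightedSum hH ν _).abs) q.hasCompactSupport.mul_right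

include hH in
/-- The denominator in the usual normalization `q / S q` is replaced by a maximum with a lower bound
of `S q` on `K`, so that the quotient is continuous everywhere. -/
theorem exists_fibreSum_eq_one {K : Set G} (hK : IsCompact K) :
    ∃ q : C_c(G, ℝ), (∀ x, 0 ≤ q x) ∧ (∀ x ∈ K, fibreSum ν q x = 1) ∧
      ∀ x, fibreSum ν q x ∈ Set.Icc (0 : ℝ) 1 := by
  obtain ⟨χ, χ1, -, χc, χ01⟩ := exists_continuous_one_zero_of_isCompact hK isClosed_empty
    (Set.disjoint_empty K)
  let q₀ : C_c(G, ℝ) := ⟨χ, χc⟩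
  have hS := continuous_fibreSum hH ν q₀
  have hS0 : ∀ x, 0 ≤ fibreSum ν q₀ x := fun x => integral_nonneg fun h => (χ01 _).1
  have hSpos : ∀ x ∈ K, 0 < fibreSum ν q₀ x := by
    intro x hx
    have hc := hasCompactSupport_fibre hH q₀ (fun _ => 1) x
    simp only [mul_one] at hc
    have : Continuous fun h : H => q₀ (x * h) := by
      have := q₀.continuous
      fun_prop
    refine this.integral_pos_of_hasCompactSupport_nonneg_nonzero hc (fun h => (χ01 _).1) (x := 1) ?_
    change χ (x * 1) ≠ 0
    rw [mul_one, χ1 hx]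
    exact one_ne_zero
  obtain ⟨c, hc, hcK⟩ : ∃ c > 0, ∀ x ∈ K, c ≤ fibreSum ν q₀ x := by
    rcases K.eq_empty_or_nonempty with rfl | hne
    · exact ⟨1, one_pos, fun x hx => absurd hx (Set.notMem_empty x)⟩
    · obtain ⟨x₀, hx₀, hmin⟩ := hK.exists_isMinOn hne hS.continuousOn
      exact ⟨_, hSpos x₀ hx₀, fun x hx => hmin hx⟩
  have hmax : ∀ x, 0 < max (fibreSum ν q₀ x) c := fun x => lt_max_of_lt_right hc
  let q : C_c(G, ℝ) := ⟨⟨fun x => q₀ x * (max (fibreSum ν q₀ x) c)⁻¹,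
    q₀.continuous.mul ((hS.max continuous_const).inv₀ fun x => (hmax x).ne')⟩,
    q₀.hasCompactSupport.mul_right⟩
  have hq : ∀ x, fibreSum ν q x = fibreSum ν q₀ x * (max (fibreSum ν q₀ x) c)⁻¹ := by
    intro x
    change ∫ h : H, q₀ (x * h) * (max (fibreSum ν q₀ (x * h)) c)⁻¹ ∂ν = _
    simp only [fibreSum_mul, integral_mul_const]
    rfl
  refine ⟨q, fun x => mul_nonneg (χ01 x).1 (inv_nonneg.2 (hmax x).le), fun x hx => ?_, fun x => ?_⟩
  · rw [hq, max_eq_left (hcK x hx), mul_inv_cancel₀ (hSpos x hx).ne']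
  · rw [hq, ← div_eq_mul_inv]
    exact ⟨div_nonneg (hS0 x) (hmax x).le, div_le_one_of_le₀ (le_max_left _ _) (hmax x).le⟩

theorem abs_dualOf_le {F : G → ℝ} (hF : Measurable F) {C : ℝ} (hC : ∀ y, |F y| ≤ C) (φ : LOne μ) :
    |dualOf hF hC φ| ≤ C * ‖φ‖ := by
  have := norm_integral_smul_le (k := F) φ hC
  rwa [mul_comm] at this

/-- Bounded continuous right `H`-invariant functions annihilate `J¹(G, H)`. With the adjunction
formula, `∫ φ · f · S q = ∫ q · f · T φ` vanishes for `φ` in `J¹(G, H)`, and `S q` can be made equal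
to `1` on large compact sets. -/
theorem integral_mul_eq_zero_of_mem_JOne {φ : LOne μ} (hφ : φ ∈ JOne μ ν hH) {f : G → ℝ}
    (hf : Continuous f) {F : ℝ} (hF : ∀ x, |f x| ≤ F) (hfH : ∀ x, ∀ h : H, f (x * h) = f x) :
    ∫ x, φ x * f x ∂μ = 0 := by
  have hF0 : 0 ≤ F := (abs_nonneg _).trans (hF 1)
  have step : ∀ q : C_c(G, ℝ), (∀ x, 0 ≤ q x) → ∫ x, φ x * (f x * fibreSum ν q x) ∂μ = 0 := by
    intro q hq
    obtain ⟨M, hM0, hM⟩ := exists_abs_fibreSum_le hH ν q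
    have hcont : Continuous fun x => f x * fibreSum ν q x := hf.mul (continuous_fibreSum hH ν q)
    have hbound : ∀ x, |f x * fibreSum ν q x| ≤ F * M := fun x => by
      rw [abs_mul]
      exact mul_le_mul (hF x) (hM x) (abs_nonneg _) hF0
    let L : LOne μ →L[ℝ] ℝ := dualOf hcont.measurable hbound
    have hL : ∀ ψ, |L ψ| ≤ F * M * ‖ψ‖ := abs_dualOf_le _ _
    change L φ = 0
    refine abs_eq_zero.1 (le_antisymm (le_of_forall_pos_le_add fun δ hδ => ?_) (abs_nonneg _))
    obtain ⟨ε, hε, hεδ⟩ : ∃ ε > 0, 5 * (F * M) * ε ≤ δ := by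
      refine ⟨δ / (5 * (F * M) + 1), by positivity, ?_⟩
      rw [mul_div_assoc', div_le_iff₀ (by positivity)]
      nlinarith
    obtain ⟨g, hg, hgT⟩ := exists_cc_of_mem_JOne hH ν hφ hq hM hε
    have h1 : |L (toLOne μ g)| ≤ 4 * (F * M) * ε := by
      let χ : C_c(G, ℝ) := ⟨⟨fun x => q x * f x, q.continuous.mul hf⟩,
        q.hasCompactSupport.mul_right⟩
      have hχ : ∀ x, fibreSum ν χ x = f x * fibreSum ν q x := by
        intro x
        change ∫ h : H, q (x * h) * f (x * h) ∂ν = _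
        simp only [hfH, integral_mul_const]
        rw [mul_comm, fibreSum]
      have h2 : L (toLOne μ g) = ∫ x, χ x * fibreWeightedSum ν g x ∂μ := by
        rw [integral_mul_fibreWeightedSum hH]
        refine integral_congr_ae ((coeFn_toLOne g).mono fun x hx => ?_)
        simp only [hx, hχ]
      rw [h2, ← Real.norm_eq_abs]
      refine (norm_integral_le_integral_norm _).trans ?_
      calc ∫ x, ‖χ x * fibreWeightedSum ν g x‖ ∂μ
          ≤ ∫ x, F * (q x * |fibreWeightedSum ν g x|) ∂μ := by
            refine integral_mono_of_nonneg (ae_of_all _ fun x => norm_nonneg _)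
              (Integrable.const_mul (Continuous.integrable_of_hasCompactSupport
                (q.continuous.mul (continuous_fibreWeightedSum hH ν g).abs)
                q.hasCompactSupport.mul_right) F) (ae_of_all _ fun x => ?_)
            change |q x * f x * fibreWeightedSum ν g x| ≤ F * (q x * |fibreWeightedSum ν g x|)
            rw [abs_mul, abs_mul, abs_of_nonneg (hq x), mul_comm (q x), mul_assoc]
            exact mul_le_mul_of_nonneg_right (hF x) (mul_nonneg (hq x) (abs_nonneg _))
        _ ≤ F * (4 * M * ε) := by
            rw [integral_const_mul]
            exact mul_le_mul_of_nonneg_left hgT hF0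
        _ = 4 * (F * M) * ε := by ring
    have h2 : |L (toLOne μ g - φ)| ≤ F * M * ε :=
      (hL _).trans (mul_le_mul_of_nonneg_left hg (mul_nonneg hF0 hM0))
    rw [map_sub] at h2
    rw [abs_le] at h1 h2 ⊢
    constructor <;> linarith
  refine abs_eq_zero.1 (le_antisymm (le_of_forall_pos_le_add fun δ hδ => ?_) (abs_nonneg _))
  obtain ⟨ε, hε, hεδ⟩ : ∃ ε > 0, F * ε ≤ δ := by
    refine ⟨δ / (F + 1), by positivity, ?_⟩
    rw [mul_div_assoc', div_le_iff₀ (by positivity)]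
    nlinarith
  obtain ⟨g, hg⟩ := Metric.denseRange_iff.1 (denseRange_toLOne μ) φ ε hε
  obtain ⟨q, hq0, hq1, hq01⟩ := exists_fibreSum_eq_one hH ν g.hasCompactSupport.isCompact
  have hSq := continuous_fibreSum hH ν q
  have hcont : Continuous fun x => f x * (1 - fibreSum ν q x) := hf.mul (continuous_const.sub hSq)
  have hbound : ∀ x, |f x * (1 - fibreSum ν q x)| ≤ F := fun x => by
    rw [abs_mul, abs_of_nonneg (sub_nonneg.2 (hq01 x).2)]
    have := (hq01 x).1
    exact (mul_le_mul_of_nonneg_right (hF x) (sub_nonneg.2 (hq01 x).2)).trans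
      (mul_le_of_le_one_right hF0 (by linarith))
  let L : LOne μ →L[ℝ] ℝ := dualOf hcont.measurable hbound
  have h1 : L φ = ∫ x, φ x * f x ∂μ := by
    have hφi := L1.integrable_coeFn φ
    have i1 : Integrable (fun x => φ x * f x) μ :=
      hφi.mul_bdd hf.measurable.aestronglyMeasurable (ae_of_all _ hF)
    have i2 : Integrable (fun x => φ x * (f x * fibreSum ν q x)) μ :=
      hφi.mul_bdd (c := F) (hf.mul hSq).measurable.aestronglyMeasurable (ae_of_all _ fun x => by
        rw [norm_mul, Real.norm_of_nonneg (hq01 x).1]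
        exact (mul_le_mul_of_nonneg_right (hF x) (hq01 x).1).trans
          (mul_le_of_le_one_right hF0 (hq01 x).2))
    change ∫ x, φ x * (f x * (1 - fibreSum ν q x)) ∂μ = _
    simp only [mul_sub, mul_one]
    rw [integral_sub i1 i2, step q hq0, sub_zero]
  have h2 : L (toLOne μ g) = 0 := by
    refine integral_eq_zero_of_ae ((coeFn_toLOne g).mono fun x hx => ?_)
    change toLOne μ g x * (f x * (1 - fibreSum ν q x)) = 0
    rw [hx]
    by_cases hxg : x ∈ tsupport g
    · rw [hq1 x hxg, sub_self, mul_zero, mul_zero]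
    · rw [image_eq_zero_of_notMem_tsupport hxg, zero_mul]
  rw [zero_add, ← h1, ← sub_zero (L φ), ← h2, ← map_sub]
  refine (abs_dualOf_le _ _ _).trans (le_trans ?_ hεδ)
  rw [← dist_eq_norm]
  exact mul_le_mul_of_nonneg_left hg.le hF0

end Annihilator

/-! ### Approximate identities and invariant means -/

section ApproxIdentity

variable {G : Type u} [Group G] [TopologicalSpace G] [IsTopologicalGroup G]
  [LocallyCompactSpace G] [T2Space G] [MeasurableSpace G] [BorelSpace G]
  {μ : Measure G} [μ.IsHaarMeasure] [μ.Regular]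
  {H : Subgroup G} {hH : IsClosed (H : Set G)} {ν : Measure H} [ν.IsHaarMeasure] [ν.Regular]

variable (μ) in
/-- Integration against a function in `Cbru G`, as a functional on `L¹(G)`. -/
def Cbru.dual (f : Cbru G) : LOne μ →L[ℝ] ℝ :=
  dualOf (f : G →ᵇ ℝ).continuous.measurable (Cbru.abs_apply_le f)

theorem Cbru.dual_apply (f : Cbru G) (φ : LOne μ) :
    Cbru.dual μ f φ = ∫ y, φ y * (f : G →ᵇ ℝ) y ∂μ := rfl

/-- Averaging left translates of `f` over a neighbourhood where they are close to `f` changes `f`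
only slightly. -/
theorem norm_rightCoefficient_dual_sub_le {f : Cbru G} {ε : ℝ} {q : C_c(G, ℝ)}
    (hq : IsBump μ {y | dist (translateCbru y⁻¹ f) f < ε} q) (hε : 0 ≤ ε) :
    ‖rightCoefficient (Cbru.dual μ f) (toLOne μ q) - f‖ ≤ ε := by
  refine Cbru.norm_le hε fun x => ?_
  change ‖Cbru.dual μ f (rightTranslate μ x (toLOne μ q)) - (f : G →ᵇ ℝ) x‖ ≤ ε
  rw [Cbru.dual_apply, integral_rightTranslate_mul]
  refine hq.norm_integral_sub_le (k := fun y => (f : G →ᵇ ℝ) (y * x))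
    ((f : G →ᵇ ℝ).continuous.comp (continuous_mul_const x)) fun y hy => ?_
  have h : |((translateCbru y⁻¹ f - f : Cbru G) : G →ᵇ ℝ) x| ≤ ‖translateCbru y⁻¹ f - f‖ :=
    Cbru.abs_apply_le _ x
  change |(f : G →ᵇ ℝ) (y⁻¹⁻¹ * x) - (f : G →ᵇ ℝ) x| ≤ _ at h
  rw [inv_inv] at h
  exact h.trans ((dist_eq_norm (translateCbru y⁻¹ f) f).symm.trans_lt hy).le

/-- For an approximate identity `u` of `J¹(G, H)`, any limit of the functionals
`f ↦ f(1) - ∫ u f` is `H`-invariant: for `φ ∈ J¹(G, H)` these functionals tend to zero on the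
coefficient `x ↦ L (ρ x φ)`, since `∫ u(y) L (ρ y φ) dy = L (φ * u)`. -/
theorem exists_mean_of_approxIdentity
    (h : HasBoundedRightApproxIdentity μ (JOne μ ν hH) (LOneZero μ)) :
    ∃ m : Cbru G →ₗ[ℝ] ℝ, IsMean m ∧ IsLeftInvariant H m := by
  have : LocallyCompactSpace H := hH.isClosedEmbedding_subtypeVal.locallyCompactSpace
  obtain ⟨I, _, _, _, u, hu0, ⟨C, hC⟩, hu⟩ := h
  have hi : ∀ (i : I) (f : Cbru G), Integrable (fun y => u i y * (f : G →ᵇ ℝ) y) μ := fun i f =>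
    integrable_smul (u i) (f : G →ᵇ ℝ).continuous (Cbru.abs_apply_le f)
  let m : I → Cbru G →ₗ[ℝ] ℝ := fun i =>
    { toFun := fun f => (f : G →ᵇ ℝ) 1 - ∫ y, u i y * (f : G →ᵇ ℝ) y ∂μ
      map_add' := fun a b => by
        change (a : G →ᵇ ℝ) 1 + (b : G →ᵇ ℝ) 1 -
          ∫ y, u i y * ((a : G →ᵇ ℝ) y + (b : G →ᵇ ℝ) y) ∂μ = _
        simp only [mul_add]
        rw [integral_add (hi i a) (hi i b)]
        ring
      map_smul' := fun c a => by
        change c * (a : G →ᵇ ℝ) 1 - ∫ y, u i y * (c * (a : G →ᵇ ℝ) y) ∂μ = c * _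
        simp only [mul_left_comm (u i _) c, integral_const_mul]
        ring }
  have hm : ∀ i f, m i f = (f : G →ᵇ ℝ) 1 - ∫ y, u i y * (f : G →ᵇ ℝ) y ∂μ := fun _ _ => rfl
  have hb : ∀ i f, |m i f| ≤ (1 + C) * ‖f‖ := by
    intro i f
    have h1 := Cbru.abs_apply_le f 1
    have h2 : |∫ y, u i y * (f : G →ᵇ ℝ) y ∂μ| ≤ ‖u i‖ * ‖f‖ :=
      norm_integral_smul_le (k := (f : G →ᵇ ℝ)) (u i) (Cbru.abs_apply_le f)
    have h3 := mul_le_mul_of_nonneg_right (hC i) (norm_nonneg f)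
    rw [hm]
    refine (abs_sub _ _).trans ?_
    linarith
  obtain ⟨U, M, hU, hMb, hM⟩ : ∃ (U : Ultrafilter I) (M : Cbru G →ₗ[ℝ] ℝ),
      ↑U ≤ (atTop : Filter I) ∧ (∀ f, |M f| ≤ (1 + C) * ‖f‖) ∧
        ∀ f, Tendsto (fun i => m i f) U (𝓝 (M f)) :=
    exists_ultralimit (V := Cbru G) atTop m (1 + C) (Eventually.of_forall hb)
  have hC0 : 0 ≤ C := (norm_nonneg _).trans (hC (Classical.arbitrary I))
  have hM1 : M (oneCbru G) = 1 := by
    refine tendsto_nhds_unique (hM _) (tendsto_const_nhds.congr fun i => ?_)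
    have h0 : ∫ y, u i y ∂μ = 0 := hu0 i
    rw [hm]
    simp only [oneCbru_apply, mul_one]
    rw [h0, sub_zero]
  have hJ : ∀ (L : LOne μ →L[ℝ] ℝ), ∀ φ ∈ JOne μ ν hH, M (rightCoefficient L φ) = 0 := by
    intro L φ hφ
    refine tendsto_nhds_unique (hM _) ?_
    have h1 : Tendsto (fun i => L φ - L (conv μ φ (u i))) U (𝓝 (L φ - L φ)) :=
      tendsto_const_nhds.sub (((L.continuous.tendsto φ).comp (hu φ hφ)).mono_left hU)
    rw [sub_self] at h1
    refine h1.congr fun i => ?_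
    rw [map_conv_right, hm, rightCoefficient_apply, rightTranslate_one]
    rfl
  -- For coefficients of elements of `L¹(G)` invariance follows from `hJ`; they approximate `f`.
  refine exists_mean_of_functional hMb hM1 fun k hk f => ?_
  refine sub_eq_zero.1 (abs_eq_zero.1 (le_antisymm (le_of_forall_pos_le_add fun δ hδ => ?_)
    (abs_nonneg _)))
  obtain ⟨ε, hε, hεδ⟩ : ∃ ε > 0, 2 * ((1 + C) * ε) ≤ δ :=
    ⟨δ / (2 * (1 + C)), by positivity, le_of_eq (by field_simp)⟩
  have hnhds : {y | dist (translateCbru y⁻¹ f) f < ε} ∈ 𝓝 (1 : G) := by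
    have hc : Continuous fun y : G => dist (translateCbru y⁻¹ f) f :=
      ((continuous_translateCbru f).comp continuous_inv).dist continuous_const
    refine hc.continuousAt.eventually_lt_const ?_
    change dist (translateCbru 1⁻¹ f) f < ε
    rw [inv_one, translateCbru_one, dist_self]
    exact hε
  obtain ⟨q, hq⟩ := exists_isBump (μ := μ) hnhds
  set L := Cbru.dual μ f
  have hd : ‖rightCoefficient L (toLOne μ q) - f‖ ≤ ε :=
    norm_rightCoefficient_dual_sub_le hq hε.le
  have h0 := hJ L _ (rightTranslate_sub_mem_JOne hH ν q ⟨k, hk⟩)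
  rw [map_sub, Cbru.map_sub, ← translateCbru_rightCoefficient] at h0
  have h1 : |M (rightCoefficient L (toLOne μ q) - f)| ≤ (1 + C) * ε :=
    (hMb _).trans (mul_le_mul_of_nonneg_left hd (by linarith))
  have h2 : |M (translateCbru k (rightCoefficient L (toLOne μ q) - f))| ≤ (1 + C) * ε :=
    (hMb _).trans (mul_le_mul_of_nonneg_left ((norm_translateCbru_le k _).trans hd) (by linarith))
  change |M (translateCbru k (rightCoefficient L (toLOne μ q)) - translateCbru k f)| ≤ _ at h2
  rw [Cbru.map_sub] at h1 h2
  rw [abs_le] at h1 h2 ⊢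
  constructor <;> linarith

variable {m : Cbru G →ₗ[ℝ] ℝ}

include hH ν in
/-- For an invariant mean `m`, the functional `φ ↦ m (x ↦ L (ρ x φ))` vanishes on `J¹(G, H)`: its
values at `w * φ`, for `w` concentrating at `1`, are integrals of `φ` against right `H`-invariant
functions. -/
theorem meanRight_eq_zero (hm : IsMean m) (hmH : IsLeftInvariant H m) (L : LOne μ →L[ℝ] ℝ)
    {φ : LOne μ} (hφ : φ ∈ JOne μ ν hH) : meanRight L hm φ = 0 := by
  have : LocallyCompactSpace H := hH.isClosedEmbedding_subtypeVal.locallyCompactSpace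
  set Λ := meanRight L hm with hΛ
  have hinv : ∀ h : H, ∀ ψ, Λ (rightTranslate μ h ψ) = Λ ψ := fun h ψ => by
    rw [hΛ, meanRight_apply, meanRight_apply, ← hmH _ (H.inv_mem h.2) (rightCoefficient L ψ),
      translateCbru_rightCoefficient, inv_inv]
  refine tendsto_nhds_unique ((Λ.continuous.tendsto φ).comp (tendsto_conv_left φ))
    (tendsto_const_nhds.congr fun w => ?_)
  rw [Function.comp_apply, map_conv_right]
  refine (integral_mul_eq_zero_of_mem_JOne hH ν hφ
    (Λ.continuous.comp (continuous_rightTranslate (toLOne μ w)))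
    (fun x => norm_apply_le_of_isometric Λ norm_rightTranslate (toLOne μ w) x) fun x h => ?_).symm
  rw [Function.comp_apply, Function.comp_apply, rightTranslate_mul, hinv]

/-- Given an invariant mean, finitely many elements `φ` of `J¹(G, H)` have a common approximate
right unit of norm at most `2` and integral zero. Otherwise a functional `(L φ)` separates
`(φ)` from the family of all `(φ * u)`; letting `u` tend to the difference of the Dirac measures at
`1` and `x`, the function `x ↦ ∑ L φ (ρ x φ)` is bounded below by a positive constant, while `m`
vanishes at it. -/
theorem exists_conv_sub_lt_of_mean (hm : IsMean m) (hmH : IsLeftInvariant H m)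
    (Φ : Finset (JOne μ ν hH)) {ε : ℝ} (hε : 0 < ε) :
    ∃ u ∈ LOneZero μ, ‖u‖ ≤ 2 ∧ ∀ φ ∈ Φ, ‖conv μ φ u - φ‖ < ε := by
  classical
  let T : LOne μ →L[ℝ] (Φ → LOne μ) := ContinuousLinearMap.pi fun φ => convCLM μ φ
  let p : G → Φ → LOne μ := fun x φ => rightTranslate μ x φ
  let J : LOne μ →L[ℝ] ℝ := dualOf (F := fun _ => 1) (C := 1) measurable_const fun _ => by simp
  have hJ : ∀ u : LOne μ, J u = ∫ y, u y ∂μ := fun u => by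
    change ∫ y, u y * 1 ∂μ = _
    simp only [mul_one]
  let D : Set (LOne μ) := Metric.closedBall 0 2 ∩ {u | J u = 0}
  have hD : Convex ℝ D := (convex_closedBall 0 2).inter
    (convex_hyperplane (f := fun u => J u) J.toLinearMap.isLinear 0)
  have hmain : p 1 ∈ closure (T '' D) := by
    by_contra hp
    obtain ⟨F, c, hF, hc⟩ := geometric_hahn_banach_closed_point
      ((hD.linear_image T.toLinearMap).closure) isClosed_closure hp
    let Λ : Φ → LOne μ →L[ℝ] ℝ := fun φ => F.comp (ContinuousLinearMap.single ℝ (fun _ => LOne μ) φ)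
    have hΛ : ∀ a : Φ → LOne μ, F a = ∑ φ, Λ φ (a φ) := fun a => by
      conv_lhs => rw [← Finset.univ_sum_single a]
      rw [map_sum]
      rfl
    -- The function `f x = F (ρ x φ)_φ`.
    let f : Cbru G := ∑ φ : Φ, rightCoefficient (Λ φ) φ
    have hf : ∀ x, (f : G →ᵇ ℝ) x = F (p x) := fun x => by
      rw [hΛ]
      simp only [f, AddSubmonoidClass.coe_finsetSum, BoundedContinuousFunction.coe_sum,
        Finset.sum_apply]
      rfl
    have hmf : m f = 0 := by
      simp only [f]
      rw [map_sum]
      exact Finset.sum_eq_zero fun φ _ => meanRight_eq_zero hm hmH (Λ φ) φ.1.2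
    have hT : ∀ x, Tendsto (fun w => T (toLOne μ w)) (bumpFilter μ x) (𝓝 (p x)) := by
      intro x
      refine tendsto_pi_nhds.2 fun φ => ?_
      have h := tendsto_integral_bump (μ := μ) (continuous_rightTranslate (φ : LOne μ)) x
      refine h.congr fun w => ?_
      rw [← convRight_apply, ← conv_eq_convRight]
      rfl
    -- Test the separation with differences of densities concentrating at `1` and at `x`.
    have hle : ∀ x, F (p 1) - F (p x) ≤ c := by
      intro x
      have h1 : Tendsto (fun vw : C_c(G, ℝ) × C_c(G, ℝ) => F (T (toLOne μ vw.1 - toLOne μ vw.2)))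
          (bumpFilter μ 1 ×ˢ bumpFilter μ x) (𝓝 (F (p 1 - p x))) := by
        simp only [map_sub T]
        exact (F.continuous.tendsto _).comp
          (((hT 1).comp tendsto_fst).sub ((hT x).comp tendsto_snd))
      rw [map_sub] at h1
      refine le_of_tendsto h1 ?_
      filter_upwards [(eventually_isBump univ_mem).prod_mk (eventually_isBump univ_mem)]
        with vw hvw
      refine (hF _ (subset_closure ⟨_, ⟨?_, ?_⟩, rfl⟩)).le
      · rw [mem_closedBall_zero_iff]
        refine (norm_sub_le _ _).trans ?_
        rw [hvw.1.norm_toLOne, hvw.2.norm_toLOne]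
        norm_num
      · have h2 : ∀ w, IsBump μ Set.univ w → J (toLOne μ w) = 1 := fun w hw => by
          rw [hJ, ← hw.integral_eq]
          exact integral_congr_ae (coeFn_toLOne w)
        change J _ = 0
        rw [map_sub, h2 _ hvw.1, h2 _ hvw.2, sub_self]
    have h3 := hm.le_of_le (f := -f) (c := c - F (p 1)) fun x => by
      change -(f : G →ᵇ ℝ) x ≤ _
      rw [hf]
      linarith [hle x]
    rw [Cbru.map_neg, hmf] at h3
    linarith
  obtain ⟨_, ⟨u, hu, rfl⟩, hlt⟩ := Metric.mem_closure_iff.1 hmain ε hε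
  refine ⟨u, (hJ u).symm.trans hu.2, mem_closedBall_zero_iff.1 hu.1, fun φ hφ => ?_⟩
  have h4 : dist (rightTranslate μ 1 (φ : LOne μ)) (conv μ φ u) < ε :=
    (dist_le_pi_dist (p 1) (T u) ⟨φ, hφ⟩).trans_lt hlt
  rwa [rightTranslate_one, dist_comm, dist_eq_norm] at h4

/-- The net is indexed by the finite subsets of `J¹(G, H)` and the precision. -/
theorem approxIdentity_of_exists_mean
    (h : ∃ m : Cbru G →ₗ[ℝ] ℝ, IsMean m ∧ IsLeftInvariant H m) :
    HasBoundedRightApproxIdentity μ (JOne μ ν hH) (LOneZero μ) := by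
  classical
  obtain ⟨m, hm, hmH⟩ := h
  choose u hu0 hu2 hu using fun i : Finset (JOne μ ν hH) × ℕ =>
    exists_conv_sub_lt_of_mean hm hmH i.1 (Nat.one_div_pos_of_nat (α := ℝ) (n := i.2))
  refine ⟨Finset (JOne μ ν hH) × ℕ, inferInstance, inferInstance, inferInstance, u, hu0,
    ⟨2, hu2⟩, fun φ hφ => Metric.tendsto_nhds.2 fun ε hε => ?_⟩
  obtain ⟨n, hn⟩ := exists_nat_one_div_lt hε
  filter_upwards [eventually_ge_atTop (({⟨φ, hφ⟩}, n) : Finset (JOne μ ν hH) × ℕ)] with i hi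
  rw [dist_eq_norm]
  refine (hu i ⟨φ, hφ⟩ (hi.1 (Finset.mem_singleton_self _))).trans (lt_of_le_of_lt ?_ hn)
  exact Nat.one_div_le_one_div hi.2

end ApproxIdentity

end

end RelAmen

theorem mainTheorem1 (G : Type u) [Group G] [TopologicalSpace G] [IsTopologicalGroup G]
    [LocallyCompactSpace G] [T2Space G] [MeasurableSpace G] [BorelSpace G]
    (H : Subgroup G) (hH : IsClosed (H : Set G))
    (μ : Measure G) [μ.IsHaarMeasure] [μ.Regular]
    (ν : Measure H) [ν.IsHaarMeasure] [ν.Regular] :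
    List.TFAE [
      RelAmen.RelativelyAmenable.{u, v} G H,
      RelAmen.HasBoundedRightApproxIdentity μ (RelAmen.JOne μ ν hH) (RelAmen.LOneZero μ),
      ∃ m : RelAmen.Cbru G →ₗ[ℝ] ℝ, RelAmen.IsMean m ∧ RelAmen.IsLeftInvariant H m,
      ∃ α : RelAmen.LInftyGroup μ →L[ℝ] RelAmen.LInftyQuotient μ H,
        RelAmen.IsEquivariant α ∧ RelAmen.IsUnital α,
      ∃ α : RelAmen.LInftyGroup μ →L[ℝ] RelAmen.LInftyQuotient μ H,
        RelAmen.IsEquivariant α ∧ RelAmen.IsUnital α ∧ RelAmen.IsPositiveMap α ∧ ‖α‖ = 1,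
      ∃ α : RelAmen.LInftyGroup μ →L[ℝ] RelAmen.LInftyQuotient μ H,
        RelAmen.IsLOneEquivariant α ∧ RelAmen.IsUnital α,
      ∃ α : RelAmen.LInftyGroup μ →L[ℝ] RelAmen.LInftyQuotient μ H,
        RelAmen.IsLOneEquivariant α ∧ RelAmen.IsUnital α ∧ RelAmen.IsPositiveMap α ∧
          ‖α‖ = 1] := by
  tfae_have 1 → 3 := RelAmen.exists_mean_of_relativelyAmenable
  tfae_have 3 → 1 := RelAmen.relativelyAmenable_of_exists_mean
  tfae_have 2 → 3 := RelAmen.exists_mean_of_approxIdentity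
  tfae_have 3 → 2 := RelAmen.approxIdentity_of_exists_mean
  tfae_have 3 → 7 := RelAmen.exists_equivariant_of_mean
  tfae_have 7 → 5 := fun ⟨α, h1, h2⟩ => ⟨α, h1.isEquivariant, h2⟩
  tfae_have 7 → 6 := fun ⟨α, h1, h2, _⟩ => ⟨α, h1, h2⟩
  tfae_have 5 → 4 := fun ⟨α, h1, h2, _⟩ => ⟨α, h1, h2⟩
  tfae_have 6 → 4 := fun ⟨α, h1, h2⟩ => ⟨α, h1.isEquivariant, h2⟩
  tfae_have 4 → 3 := fun ⟨_, h1, h2⟩ => RelAmen.exists_mean_of_equivariant h1 h2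
  tfae_finish
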